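/- Let $N\ge 1$, let $\Omega\subset\mathbb{R}^N$ be a nonempty bounded open set with Lipschitz boundary, and let $s_1,s_2\in(0,1)$, $p,q\in(1,\infty)$. For $s\in(0,1)$ and $r\in(1,\infty)$ put $$[u]_{s,r}^r=\iint_{\mathbb{R}^N\times\mathbb{R}^N}\frac{|u(x)-u(y)|^r}{|x-y|^{N+sr}}\,dx\,dy,$$ $$\mathcal{E}_{r,s}(u,v)=\iint_{\mathbb{R}^N\times\mathbb{R}^N}\frac{|u(x)-u(y)|^{r-2}(u(x)-u(y))(v(x)-v(y))}{|x-y|^{N+sr}}\,dx\,dy,$$ $$W^{s,r}_0(\Omega)=\{u\in L^r(\mathbb{R}^N):\ [u]_{s,r}<\infty,\ u=0\text{ a.e. in }\mathbb{R}^N\setminus\Omega\},$$ and let $$\lambda_1(s_2,q)=\inf_{u\in W^{s_2,q}_0(\Omega)\setminus\{0\}}\frac{[u]_{s_2,q}^q}{\int_\Omega|u|^q\,dx}$$ be the first eigenvalue of the Dirichlet fractional $q$-Laplacian $(-\Delta)^{s_2}_q$ in $\Omega$. A number $\lambda\in\mathbb{R}$ is called an eigenvalue of the fractional $(p,q)$-Laplacian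 Dirichlet problem $$(-\Delta)^{s_1}_pu+(-\Delta)^{s_2}_qu=\lambda|u|^{q-2}u\ \text{ in }\Omega,\qquad u=0\ \text{ on }\mathbb{R}^N\setminus\Omega, \qquad (1)$$ with eigenfunction $u$, if $u\in (W^{s_1,p}_0(\Omega)\cap W^{s_2,q}_0(\Omega))\setminus\{0\}$ and $$\mathcal{E}_{p,s_1}(u,v)+\mathcal{E}_{q,s_2}(u,v)=\lambda\int_\Omega|u|^{q-2}uv\,dx\quad\text{for all }v\in W^{s_1,p}_0(\Omega)\cap W^{s_2,q}_0(\Omega).$$ Let $$F_\lambda(u)=\tfrac1p[u]_{s_1,p}^p+\tfrac1q[u]_{s_2,q}^q-\tfrac{\lambda}{q}\int_\Omega|u|^q\,dx .$$ A function is said to have constant sign in $\Omega$ if it is positive a.e. in $\Omega$ or negative a.e. in $\Omega$. (a) Suppose $0<s_2<s_1<1<q<p<\infty$. Then every $\lambda>\lambda_1(s_2,q)$ is an eigenvalue of (1). Moreover, for every such $\lambda$, the functional $F_\lambda$ is coercive on $W^{s_1,p}_0(\Omega)$ (that is, $F_\lambda(u)\to+\infty$ as $[u]_{s_1,p}\to\infty$),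 it attains its minimum over $W^{s_1,p}_0(\Omega)$, and every minimizer is an eigenfunction of (1) associated to $\lambda$ and has constant sign in $\Omega$. (b) Suppose $0<s_1<s_2<1<p<q<\infty$. Then every $\lambda>\lambda_1(s_2,q)$ is an eigenvalue of (1). Moreover, for every such $\lambda$, $F_\lambda$ attains its minimum on the Nehari set $$\mathcal{N}_\lambda=\Big\{u\in W^{s_2,q}_0(\Omega)\setminus\{0\}:\ [u]_{s_1,p}^p+[u]_{s_2,q}^q=\lambda\int_\Omega|u|^q\,dx\Big\},$$ and every minimizer $u$ of $F_\lambda$ on $\mathcal{N}_\lambda$ is a free critical point of $F_\lambda$, that is, $\frac{d}{dt}F_\lambda(u+tv)\big|_{t=0}=0$ for all $v\in W^{s_2,q}_0(\Omega)$; such a minimizer is an eigenfunction of (1) associated to $\lambda$ and has constant sign in $\Omega$. -/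

import Mathlib

open MeasureTheory Set

noncomputable section

/-- `Ω ⊆ ℝᴺ` has Lipschitz boundary: near every boundary point `z` there are a unit vector `e`
(the "vertical" direction) and a Lipschitz function `g` of the "horizontal" part
`x - ⟪e, x⟫ e` of `x` such that, in a ball around `z`, the set `Ω` is the strict
epigraph `{x | g (x - ⟪e, x⟫ e) < ⟪e, x⟫}`. -/
def HasLipschitzBoundary {N : ℕ} (Ω : Set (EuclideanSpace ℝ (Fin N))) : Prop :=
  ∀ z ∈ frontier Ω, ∃ (r : ℝ) (e : EuclideanSpace ℝ (Fin N)) (K : NNReal)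
    (g : EuclideanSpace ℝ (Fin N) → ℝ), 0 < r ∧ ‖e‖ = 1 ∧ LipschitzWith K g ∧
      ∀ x ∈ Metric.ball z r, x ∈ Ω ↔ g (x - inner ℝ e x • e) < inner ℝ e x

/-- The double integral `∬ |u(x) - u(y)|^r / |x - y|^(N + s r) dx dy` over `ℝᴺ × ℝᴺ`,
as an extended nonnegative number. -/
def gagliardoLIntegral {N : ℕ} (s r : ℝ) (u : EuclideanSpace ℝ (Fin N) → ℝ) : ENNReal :=
  ∫⁻ z : EuclideanSpace ℝ (Fin N) × EuclideanSpace ℝ (Fin N),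
    ENNReal.ofReal (|u z.1 - u z.2| ^ r / ‖z.1 - z.2‖ ^ ((N : ℝ) + s * r))

/-- `[u]_{s,r}^r`, the `r`-th power of the Gagliardo seminorm on `ℝᴺ`, for functions for which
it is finite. -/
def gagliardoPow {N : ℕ} (s r : ℝ) (u : EuclideanSpace ℝ (Fin N) → ℝ) : ℝ :=
  (gagliardoLIntegral s r u).toReal

/-- The Gagliardo seminorm `[u]_{s,r}` on `ℝᴺ`, for functions for which it is finite. -/
def gagliardoSeminorm {N : ℕ} (s r : ℝ) (u : EuclideanSpace ℝ (Fin N) → ℝ) : ℝ :=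
  gagliardoPow s r u ^ (1 / r)

/-- (Representatives of) the elements of the fractional Sobolev space `W_0^{s,r}(Ω)`:
functions in `W^{s,r}(ℝᴺ)` that vanish almost everywhere outside `Ω`. -/
def W0 {N : ℕ} (Ω : Set (EuclideanSpace ℝ (Fin N))) (s r : ℝ) :
    Set (EuclideanSpace ℝ (Fin N) → ℝ) :=
  {u | MemLp u (ENNReal.ofReal r) volume ∧ gagliardoLIntegral s r u < ⊤ ∧
    ∀ᵐ x ∂volume, x ∉ Ω → u x = 0}

/-- The form `𝓔_{r,s}(u, v)` of the fractional `r`-Laplacian. For `r > 1` the integrand is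
integrable, by Hölder's inequality, whenever `u` and `v` lie in `W^{s,r}(ℝᴺ)`. -/
def fracForm {N : ℕ} (r s : ℝ) (u v : EuclideanSpace ℝ (Fin N) → ℝ) : ℝ :=
  ∫ z : EuclideanSpace ℝ (Fin N) × EuclideanSpace ℝ (Fin N),
    |u z.1 - u z.2| ^ (r - 2) * (u z.1 - u z.2) * (v z.1 - v z.2) /
      ‖z.1 - z.2‖ ^ ((N : ℝ) + s * r)

/-- The first eigenvalue `λ₁(s, q)` of the Dirichlet fractional `q`-Laplacian in `Ω`: the infimum
of the Rayleigh quotient over the nonzero elements of `W_0^{s,q}(Ω)`. -/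
def firstEigenvalue {N : ℕ} (Ω : Set (EuclideanSpace ℝ (Fin N))) (s q : ℝ) : ℝ :=
  sInf {ρ : ℝ | ∃ u ∈ W0 Ω s q, ¬ (u =ᵐ[volume] 0) ∧
    ρ = gagliardoPow s q u / ∫ x in Ω, |u x| ^ q}

/-- `u` is an eigenfunction, associated to `lam`, of
`(-Δ)_p^{s₁} u + (-Δ)_q^{s₂} u = lam |u|^{q-2} u` in `Ω`, `u = 0` outside `Ω`: a nonzero weak
solution in `W_0^{s₁,p}(Ω) ∩ W_0^{s₂,q}(Ω)`. -/
def IsEigenfunction {N : ℕ} (Ω : Set (EuclideanSpace ℝ (Fin N))) (s₁ s₂ p q lam : ℝ)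
    (u : EuclideanSpace ℝ (Fin N) → ℝ) : Prop :=
  u ∈ W0 Ω s₁ p ∩ W0 Ω s₂ q ∧ ¬ (u =ᵐ[volume] 0) ∧
    ∀ v ∈ W0 Ω s₁ p ∩ W0 Ω s₂ q,
      fracForm p s₁ u v + fracForm q s₂ u v = lam * ∫ x in Ω, |u x| ^ (q - 2) * u x * v x

/-- `lam` is an eigenvalue of the fractional `(p,q)`-Laplacian Dirichlet problem in `Ω`. -/
def IsEigenvalue {N : ℕ} (Ω : Set (EuclideanSpace ℝ (Fin N))) (s₁ s₂ p q lam : ℝ) : Prop :=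
  ∃ u, IsEigenfunction Ω s₁ s₂ p q lam u

/-- The energy `F_lam(u) = (1/p) [u]_{s₁,p}^p + (1/q) [u]_{s₂,q}^q - (lam/q) ∫_Ω |u|^q`. -/
def energy {N : ℕ} (Ω : Set (EuclideanSpace ℝ (Fin N))) (s₁ s₂ p q lam : ℝ)
    (u : EuclideanSpace ℝ (Fin N) → ℝ) : ℝ :=
  1 / p * gagliardoPow s₁ p u + 1 / q * gagliardoPow s₂ q u - lam / q * ∫ x in Ω, |u x| ^ q

/-- The Nehari set: the nonzero `u ∈ W_0^{s₂,q}(Ω)` with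
`[u]_{s₁,p}^p + [u]_{s₂,q}^q = lam ∫_Ω |u|^q`. -/
def nehariSet {N : ℕ} (Ω : Set (EuclideanSpace ℝ (Fin N))) (s₁ s₂ p q lam : ℝ) :
    Set (EuclideanSpace ℝ (Fin N) → ℝ) :=
  {u | u ∈ W0 Ω s₂ q ∧ ¬ (u =ᵐ[volume] 0) ∧
    gagliardoPow s₁ p u + gagliardoPow s₂ q u = lam * ∫ x in Ω, |u x| ^ q}

/-- `u` is (almost everywhere) positive in `Ω` or (almost everywhere) negative in `Ω`. -/
def HasConstantSign {N : ℕ} (Ω : Set (EuclideanSpace ℝ (Fin N)))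
    (u : EuclideanSpace ℝ (Fin N) → ℝ) : Prop :=
  (∀ᵐ x ∂volume, x ∈ Ω → 0 < u x) ∨ (∀ᵐ x ∂volume, x ∈ Ω → u x < 0)

end

/-! ### Powers of absolute values and differentiation of the `L^r` norm -/

section LpPowers

variable {X : Type*} [MeasurableSpace X] {μ : Measure X} {r : ℝ} {U V : X → ℝ}

/-! Everything rests on reading `[u]_{s,r}^r` as the `r`-th power of the `L^r` norm of `(x, y) ↦ u x
- u y` for the measure `|x - y|^{-(N + s r)} dx dy`. Linearity, differentiability along lines and
Fatou's lemma are then inherited from `L^r`. The space with the larger order and exponent embeds in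
the other one (`W0_subset_W0`). A Poincaré inequality (`exists_poincare`) and compactness in `L^r`
(`exists_subseq_tendsto`) make the direct method available.

In (a), `q < p` and Poincaré let half of the `p`-term absorb the `L^q` term, so the energy is
coercive and has a minimizer. The minimizer is nonzero once the energy takes a negative value. Since
`λ > λ₁`, some `u` in the `q`-space makes the `q`-part negative; if `u` were also in
`W_0^{s₁,p}(Ω)`, then `t u` with small `t` would do, because `t^p` is negligible against `t^q`. The
`q`-space is the larger one, so `u` is first replaced by a Lipschitz function vanishing outside `Ω`
(`exists_lipschitzWith_gagliardoPow_lt`): mollify `u`, then compose with a bi-Lipschitz map close to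
the identity that pushes the complement of `Ω` away from `Ω`. This is where the Lipschitz boundary
enters.

In (b), write `A(w) = [w]_{s₁,p}^p` and `G(w) = λ ∫_Ω |w|^q - [w]_{s₂,q}^q`. The Nehari condition is
`A = G`, and there the energy is a positive multiple of `A`. Every `w` in the `q`-space with `G(w) >
0` has a multiple in the Nehari set, so the problem is to minimize the 0-homogeneous quotient `A^q /
G^p` over `G > 0`. This condition is open along lines, hence minimizers satisfy the Euler–Lagrange
equation without a multiplier.

In both cases passing to `|u|` increases no seminorm, so `|u|` is again a minimizer with the same
seminorm, which excludes a change of sign. A strong minimum principle (`ae_pos_of_isEigenfunction`),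
obtained by testing with `η (1 - n u)⁺` and letting `n → ∞`, gives strict positivity. -/

theorem memLp_ofReal_iff (hr : 0 < r) :
    MemLp U (ENNReal.ofReal r) μ ↔
      AEStronglyMeasurable U μ ∧ ∫⁻ x, ENNReal.ofReal (|U x| ^ r) ∂μ < ⊤ := by
  have h0 : ENNReal.ofReal r ≠ 0 := by simpa using hr
  have h : ∀ x, ‖U x‖ₑ ^ (ENNReal.ofReal r).toReal = ENNReal.ofReal (|U x| ^ r) := fun x => by
    rw [ENNReal.toReal_ofReal hr.le, ← Real.norm_eq_abs, ← ofReal_norm,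
      ENNReal.ofReal_rpow_of_nonneg (norm_nonneg _) hr.le]
  rw [MemLp, eLpNorm_lt_top_iff_lintegral_rpow_enorm_lt_top h0 ENNReal.ofReal_ne_top]
  simp only [h]

theorem MeasureTheory.MemLp.integrable_abs_rpow (hr : 0 < r) (hU : MemLp U (ENNReal.ofReal r) μ) :
    Integrable (fun x => |U x| ^ r) μ := by
  have := hU.integrable_norm_rpow (by simpa using hr) ENNReal.ofReal_ne_top
  simpa only [ENNReal.toReal_ofReal hr.le, Real.norm_eq_abs] using this

theorem aestronglyMeasurable_abs_rpow (hU : AEStronglyMeasurable U μ) (r : ℝ) :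
    AEStronglyMeasurable (fun x => |U x| ^ r) μ :=
  (hU.aemeasurable.abs.pow_const r).aestronglyMeasurable

theorem integral_abs_rpow_eq (hU : AEStronglyMeasurable U μ) (r : ℝ) :
    ∫ x, |U x| ^ r ∂μ = (∫⁻ x, ENNReal.ofReal (|U x| ^ r) ∂μ).toReal :=
  integral_eq_lintegral_of_nonneg_ae (.of_forall fun x => by positivity)
    (aestronglyMeasurable_abs_rpow hU r)

theorem abs_rpow_sub_two_mul (hr : 1 < r) (a : ℝ) : |(|a| ^ (r - 2) * a)| = |a| ^ (r - 1) := by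
  rcases eq_or_ne a 0 with rfl | ha
  · simp [Real.zero_rpow (sub_ne_zero.2 hr.ne')]
  · have h : 0 < |a| := abs_pos.2 ha
    rw [abs_mul, abs_of_nonneg (by positivity : 0 ≤ |a| ^ (r - 2))]
    nth_rw 2 [← Real.rpow_one |a|]
    rw [← Real.rpow_add h]
    ring_nf

/-- Takes the place of Hölder's inequality: with `c = |U| + |V|`, which is in `L^r`, it makes
`|U|^(r-1) |V|` integrable and also dominates difference quotients. -/
theorem rpow_sub_one_mul_le (hr : 1 < r) {a b c : ℝ} (ha : 0 ≤ a) (hb : 0 ≤ b) (hac : a ≤ c)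
    (hbc : b ≤ c) : a ^ (r - 1) * b ≤ c ^ r := by
  rcases eq_or_lt_of_le (ha.trans hac) with h | h
  · have hb0 : b = 0 := le_antisymm (h ▸ hbc) hb
    subst hb0
    rw [mul_zero]
    exact Real.rpow_nonneg (ha.trans hac) _
  calc a ^ (r - 1) * b ≤ c ^ (r - 1) * c := by gcongr
    _ = c ^ r := by
      nth_rw 2 [← Real.rpow_one c]
      rw [← Real.rpow_add h]
      ring_nf

theorem MeasureTheory.MemLp.integrable_rpow_sub_one_mul (hr : 1 < r)
    (hU : MemLp U (ENNReal.ofReal r) μ) (hV : MemLp V (ENNReal.ofReal r) μ) :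
    Integrable (fun x => |U x| ^ (r - 1) * |V x|) μ := by
  have h := (hU.abs.add hV.abs).integrable_abs_rpow (by linarith)
  refine h.mono' ((aestronglyMeasurable_abs_rpow hU.1 _).mul hV.abs.1) (.of_forall fun x => ?_)
  rw [Real.norm_of_nonneg (by positivity)]
  refine rpow_sub_one_mul_le hr (abs_nonneg _) (abs_nonneg _) ?_ ?_
  all_goals
    simp only [Pi.add_apply, Pi.abs_apply]
    rw [abs_of_nonneg (a := |U x| + |V x|) (by positivity)]
    linarith [abs_nonneg (U x), abs_nonneg (V x)]

theorem aestronglyMeasurable_rpow_sub_two_mul (hU : AEStronglyMeasurable U μ)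
    (hV : AEStronglyMeasurable V μ) (r : ℝ) :
    AEStronglyMeasurable (fun x => |U x| ^ (r - 2) * U x * V x) μ :=
  ((aestronglyMeasurable_abs_rpow hU _).mul hU).mul hV

theorem MeasureTheory.MemLp.integrable_rpow_sub_two_mul (hr : 1 < r)
    (hU : MemLp U (ENNReal.ofReal r) μ) (hV : MemLp V (ENNReal.ofReal r) μ) :
    Integrable (fun x => |U x| ^ (r - 2) * U x * V x) μ := by
  refine (hU.integrable_rpow_sub_one_mul hr hV).mono'
    (aestronglyMeasurable_rpow_sub_two_mul hU.1 hV.1 r) (.of_forall fun x => ?_)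
  rw [Real.norm_eq_abs, abs_mul, abs_rpow_sub_two_mul hr]

/-- The `r`-th power of the `L^r` norm is differentiable along lines, for `r > 1`. -/
theorem hasDerivAt_integral_abs_add_rpow (hr : 1 < r)
    (hU : MemLp U (ENNReal.ofReal r) μ) (hV : MemLp V (ENNReal.ofReal r) μ) :
    HasDerivAt (fun t : ℝ => ∫ x, |U x + t * V x| ^ r ∂μ)
      (r * ∫ x, |U x| ^ (r - 2) * U x * V x ∂μ) 0 := by
  have hm : ∀ t : ℝ, MemLp (fun x => U x + t * V x) (ENNReal.ofReal r) μ :=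
    fun t => hU.add (hV.const_mul t)
  -- For `|t| < 1` the `t`-derivative of the integrand is at most `r (|U| + |V|)^r`, which does not
  -- depend on `t`.
  have key := hasDerivAt_integral_of_dominated_loc_of_deriv_le (μ := μ)
    (F := fun (t : ℝ) x => |U x + t * V x| ^ r)
    (F' := fun (t : ℝ) x => r * (|U x + t * V x| ^ (r - 2) * (U x + t * V x) * V x))
    (bound := fun x => r * |(|U x| + |V x|)| ^ r) (x₀ := (0 : ℝ)) (s := Ioo (-1) 1)
    (Ioo_mem_nhds (by norm_num) (by norm_num))
    (.of_forall fun t => aestronglyMeasurable_abs_rpow (hm t).1 r)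
    ((hm 0).integrable_abs_rpow (by linarith))
    ((aestronglyMeasurable_rpow_sub_two_mul (hm 0).1 hV.1 r).const_mul r)
    (.of_forall fun x t ht => ?_)
    (((hU.abs.add hV.abs).integrable_abs_rpow (by linarith)).const_mul r)
    (.of_forall fun x t ht => ?_)
  · have := key.2
    simp only [zero_mul, add_zero, integral_const_mul] at this
    exact this
  · have ht' : |t| ≤ 1 := abs_le.2 ⟨ht.1.le, ht.2.le⟩
    rw [Real.norm_eq_abs, abs_mul, abs_of_pos (by linarith : 0 < r), abs_mul,
      abs_rpow_sub_two_mul hr, abs_of_nonneg (a := |U x| + |V x|) (by positivity)]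
    refine mul_le_mul_of_nonneg_left ?_ (by linarith)
    refine rpow_sub_one_mul_le hr (abs_nonneg _) (abs_nonneg _) ?_ (by linarith [abs_nonneg (U x)])
    refine (abs_add_le _ _).trans (add_le_add le_rfl ?_)
    rw [abs_mul]
    exact mul_le_of_le_one_left (abs_nonneg _) ht'
  · have h1 := hasDerivAt_abs_rpow (U x + t * V x) hr
    have h2 : HasDerivAt (fun t : ℝ => U x + t * V x) (V x) t := by
      simpa using ((hasDerivAt_id t).mul_const (V x)).const_add (U x)
    refine (h1.comp t h2).congr_deriv ?_
    ring

end LpPowers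

/-! ### The Gagliardo seminorm as a weighted `L^r` norm -/

noncomputable section

variable {N : ℕ} {Ω : Set (EuclideanSpace ℝ (Fin N))} {s r : ℝ}
  {u v : EuclideanSpace ℝ (Fin N) → ℝ}

/-- The difference function `(x, y) ↦ u x - u y`. -/
def pairDiff (u : EuclideanSpace ℝ (Fin N) → ℝ) :
    EuclideanSpace ℝ (Fin N) × EuclideanSpace ℝ (Fin N) → ℝ := fun z => u z.1 - u z.2

/-- The density `|x - y|^{-(N + s r)}`. -/
def gagKernel (N : ℕ) (s r : ℝ) (z : EuclideanSpace ℝ (Fin N) × EuclideanSpace ℝ (Fin N)) : ℝ :=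
  (‖z.1 - z.2‖ ^ ((N : ℝ) + s * r))⁻¹

/-- The measure `dx dy / |x - y|^{N + s r}` on `ℝᴺ × ℝᴺ`. -/
def gagMeasure (N : ℕ) (s r : ℝ) :
    Measure (EuclideanSpace ℝ (Fin N) × EuclideanSpace ℝ (Fin N)) :=
  volume.withDensity fun z => ENNReal.ofReal (gagKernel N s r z)

theorem gagKernel_nonneg (z : EuclideanSpace ℝ (Fin N) × EuclideanSpace ℝ (Fin N)) :
    0 ≤ gagKernel N s r z := by unfold gagKernel; positivity

theorem measurable_gagKernel : Measurable (gagKernel N s r) := by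
  unfold gagKernel
  fun_prop

theorem lintegral_gagMeasure
    (f : EuclideanSpace ℝ (Fin N) × EuclideanSpace ℝ (Fin N) → ENNReal) :
    ∫⁻ z, f z ∂gagMeasure N s r = ∫⁻ z, ENNReal.ofReal (gagKernel N s r z) * f z :=
  lintegral_withDensity_eq_lintegral_mul_non_measurable _ measurable_gagKernel.ennreal_ofReal
    (.of_forall fun _ => ENNReal.ofReal_lt_top) _

theorem integral_gagMeasure (f : EuclideanSpace ℝ (Fin N) × EuclideanSpace ℝ (Fin N) → ℝ) :
    ∫ z, f z ∂gagMeasure N s r = ∫ z, gagKernel N s r z * f z := by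
  refine (integral_withDensity_eq_integral_toReal_smul measurable_gagKernel.ennreal_ofReal
    (.of_forall fun _ => ENNReal.ofReal_lt_top) f).trans ?_
  simp only [ENNReal.toReal_ofReal (gagKernel_nonneg _), smul_eq_mul]

theorem gagMeasure_absolutelyContinuous : gagMeasure N s r ≪ volume :=
  withDensity_absolutelyContinuous _ _

theorem gagliardoLIntegral_eq : gagliardoLIntegral s r u =
    ∫⁻ z, ENNReal.ofReal (|pairDiff u z| ^ r) ∂gagMeasure N s r := by
  rw [lintegral_gagMeasure, gagliardoLIntegral]
  congr 1 with z
  rw [← ENNReal.ofReal_mul (gagKernel_nonneg _), gagKernel, pairDiff, div_eq_mul_inv, mul_comm]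

theorem fracForm_eq : fracForm r s u v =
    ∫ z, |pairDiff u z| ^ (r - 2) * pairDiff u z * pairDiff v z ∂gagMeasure N s r := by
  rw [integral_gagMeasure, fracForm]
  congr 1 with z
  rw [gagKernel, pairDiff, pairDiff, div_eq_mul_inv, mul_comm]

theorem aestronglyMeasurable_pairDiff_volume (hu : AEStronglyMeasurable u volume) :
    AEStronglyMeasurable (pairDiff u) volume :=
  hu.comp_fst.sub hu.comp_snd

theorem aestronglyMeasurable_pairDiff (hu : AEStronglyMeasurable u volume) :
    AEStronglyMeasurable (pairDiff u) (gagMeasure N s r) :=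
  (aestronglyMeasurable_pairDiff_volume hu).mono_ac gagMeasure_absolutelyContinuous

theorem gagliardoPow_eq (hu : AEStronglyMeasurable u volume) :
    gagliardoPow s r u = ∫ z, |pairDiff u z| ^ r ∂gagMeasure N s r := by
  rw [integral_abs_rpow_eq (aestronglyMeasurable_pairDiff hu), gagliardoPow, gagliardoLIntegral_eq]

theorem ae_prod_of_ae {P : EuclideanSpace ℝ (Fin N) → Prop} (h : ∀ᵐ x ∂volume, P x) :
    ∀ᵐ z : EuclideanSpace ℝ (Fin N) × EuclideanSpace ℝ (Fin N), P z.1 ∧ P z.2 :=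
  (Measure.quasiMeasurePreserving_fst.ae h).and (Measure.quasiMeasurePreserving_snd.ae h)

theorem gagliardoLIntegral_congr (h : u =ᵐ[volume] v) :
    gagliardoLIntegral s r u = gagliardoLIntegral s r v := by
  refine lintegral_congr_ae ?_
  filter_upwards [ae_prod_of_ae h] with z hz
  rw [hz.1, hz.2]

/-- Turns closure properties of `W0` and integrability of the forms into facts about `MemLp`. -/
theorem mem_W0_iff (hr : 0 < r) : u ∈ W0 Ω s r ↔ MemLp u (ENNReal.ofReal r) volume ∧
    MemLp (pairDiff u) (ENNReal.ofReal r) (gagMeasure N s r) ∧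
    ∀ᵐ x ∂volume, x ∉ Ω → u x = 0 := by
  rw [W0, mem_ofPred_eq, memLp_ofReal_iff (U := pairDiff u) hr, ← gagliardoLIntegral_eq]
  exact ⟨fun h => ⟨h.1, ⟨aestronglyMeasurable_pairDiff h.1.1, h.2.1⟩, h.2.2⟩,
    fun h => ⟨h.1, h.2.1.2, h.2.2⟩⟩

theorem W0_congr (h : u =ᵐ[volume] v) (hu : u ∈ W0 Ω s r) : v ∈ W0 Ω s r := by
  refine ⟨(memLp_congr_ae h).1 hu.1, gagliardoLIntegral_congr h ▸ hu.2.1, ?_⟩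
  filter_upwards [h, hu.2.2] with x hx hx'
  rwa [← hx]

theorem pairDiff_add_smul (t : ℝ) (z) :
    pairDiff (u + t • v) z = pairDiff u z + t * pairDiff v z := by
  simp only [pairDiff, Pi.add_apply, Pi.smul_apply, smul_eq_mul]; ring

theorem add_smul_mem_W0 (hr : 0 < r) (hu : u ∈ W0 Ω s r) (hv : v ∈ W0 Ω s r) (t : ℝ) :
    u + t • v ∈ W0 Ω s r := by
  rw [mem_W0_iff hr] at *
  refine ⟨hu.1.add (hv.1.const_smul t), ?_, ?_⟩
  · rw [show pairDiff (u + t • v) = fun z => pairDiff u z + t * pairDiff v z from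
      funext (pairDiff_add_smul t)]
    exact hu.2.1.add (hv.2.1.const_mul t)
  · filter_upwards [hu.2.2, hv.2.2] with x h1 h2 hx
    simp [h1 hx, h2 hx]

theorem zero_mem_W0 (hr : 0 < r) : (0 : EuclideanSpace ℝ (Fin N) → ℝ) ∈ W0 Ω s r := by
  rw [mem_W0_iff hr]
  refine ⟨MemLp.zero', ?_, .of_forall fun x _ => rfl⟩
  rw [show pairDiff (0 : EuclideanSpace ℝ (Fin N) → ℝ) = fun _ => 0 from
    funext fun z => by simp [pairDiff]]
  exact MemLp.zero'

theorem smul_mem_W0 (hr : 0 < r) (hv : v ∈ W0 Ω s r) (t : ℝ) : t • v ∈ W0 Ω s r := by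
  simpa using add_smul_mem_W0 hr (zero_mem_W0 hr) hv t

theorem sub_mem_W0 (hr : 0 < r) (hu : u ∈ W0 Ω s r) (hv : v ∈ W0 Ω s r) : u - v ∈ W0 Ω s r := by
  simpa [sub_eq_add_neg] using add_smul_mem_W0 hr hu hv (-1)

theorem gagliardoPow_nonneg : 0 ≤ gagliardoPow s r u := ENNReal.toReal_nonneg

theorem gagliardoPow_smul (t : ℝ) :
    gagliardoPow s r (t • u) = |t| ^ r * gagliardoPow s r u := by
  rw [gagliardoPow, gagliardoPow, gagliardoLIntegral_eq, gagliardoLIntegral_eq]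
  have h : ∀ z, ENNReal.ofReal (|pairDiff (t • u) z| ^ r) =
      ENNReal.ofReal (|t| ^ r) * ENNReal.ofReal (|pairDiff u z| ^ r) := fun z => by
    rw [← ENNReal.ofReal_mul (by positivity), ← Real.mul_rpow (abs_nonneg _) (abs_nonneg _),
      ← abs_mul]
    simp [pairDiff, mul_sub]
  simp only [h]
  rw [lintegral_const_mul' _ _ ENNReal.ofReal_ne_top, ENNReal.toReal_mul,
    ENNReal.toReal_ofReal (by positivity)]

theorem integral_abs_smul_rpow (t : ℝ) :
    ∫ x in Ω, |(t • u) x| ^ r = |t| ^ r * ∫ x in Ω, |u x| ^ r := by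
  rw [← integral_const_mul]
  congr 1 with x
  simp [abs_mul, Real.mul_rpow]

theorem hasDerivAt_gagliardoPow (hr : 1 < r) (hu : u ∈ W0 Ω s r) (hv : v ∈ W0 Ω s r) :
    HasDerivAt (fun t : ℝ => gagliardoPow s r (u + t • v)) (r * fracForm r s u v) 0 := by
  have hr0 : 0 < r := by linarith
  have h := hasDerivAt_integral_abs_add_rpow hr ((mem_W0_iff hr0).1 hu).2.1
    ((mem_W0_iff hr0).1 hv).2.1
  rw [← fracForm_eq] at h
  convert h using 2 with t
  rw [gagliardoPow_eq (add_smul_mem_W0 hr0 hu hv t).1.1]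
  simp only [pairDiff_add_smul]

theorem hasDerivAt_integral_Ω (hr : 1 < r) (hu : MemLp u (ENNReal.ofReal r) volume)
    (hv : MemLp v (ENNReal.ofReal r) volume) :
    HasDerivAt (fun t : ℝ => ∫ x in Ω, |(u + t • v) x| ^ r)
      (r * ∫ x in Ω, |u x| ^ (r - 2) * u x * v x) 0 :=
  hasDerivAt_integral_abs_add_rpow hr (hu.restrict Ω) (hv.restrict Ω)

theorem abs_pairDiff_abs_le (z) : |pairDiff (fun x => |u x|) z| ≤ |pairDiff u z| :=
  abs_abs_sub_abs_le_abs_sub _ _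

theorem gagliardoLIntegral_abs_le (hr : 0 ≤ r) :
    gagliardoLIntegral s r (fun x => |u x|) ≤ gagliardoLIntegral s r u := by
  rw [gagliardoLIntegral_eq, gagliardoLIntegral_eq]
  refine lintegral_mono fun z => ENNReal.ofReal_le_ofReal ?_
  exact Real.rpow_le_rpow (abs_nonneg _) (abs_pairDiff_abs_le z) hr

theorem abs_mem_W0 (hr : 0 ≤ r) (hu : u ∈ W0 Ω s r) : (fun x => |u x|) ∈ W0 Ω s r := by
  refine ⟨hu.1.abs, (gagliardoLIntegral_abs_le hr).trans_lt hu.2.1, ?_⟩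
  filter_upwards [hu.2.2] with x h hx
  simp [h hx]

theorem gagliardoPow_abs_le (hr : 0 ≤ r) (hu : u ∈ W0 Ω s r) :
    gagliardoPow s r (fun x => |u x|) ≤ gagliardoPow s r u :=
  ENNReal.toReal_mono hu.2.1.ne (gagliardoLIntegral_abs_le hr)

theorem integral_Ω_eq (hr : 0 < r) (h : ∀ᵐ x ∂volume, x ∉ Ω → u x = 0) :
    ∫ x in Ω, |u x| ^ r = ∫ x, |u x| ^ r := by
  refine setIntegral_eq_integral_of_ae_compl_eq_zero ?_
  filter_upwards [h] with x hx hx'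
  simp [hx hx', Real.zero_rpow hr.ne']

theorem integral_rpow_pos (hr : 0 < r) (hu : u ∈ W0 Ω s r) (h : ¬ u =ᵐ[volume] 0) :
    0 < ∫ x in Ω, |u x| ^ r := by
  rw [integral_Ω_eq hr hu.2.2]
  refine lt_of_le_of_ne (integral_nonneg fun x => by positivity) fun h0 => h ?_
  have := (integral_eq_zero_iff_of_nonneg (fun x => by positivity)
    (hu.1.integrable_abs_rpow hr)).1 h0.symm
  filter_upwards [this] with x hx
  simpa [Real.rpow_eq_zero_iff_of_nonneg, hr.ne'] using hx

end

/-! ### Integrability of the kernel, embeddings, Lipschitz functions -/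

section Kernels

variable {N : ℕ} {Ω : Set (EuclideanSpace ℝ (Fin N))} {s r : ℝ}
  {u v : EuclideanSpace ℝ (Fin N) → ℝ}

theorem lintegral_ball_norm_rpow_lt_top (hN : 1 ≤ N) {a : ℝ} (ha : 0 < a) :
    ∫⁻ h in Metric.ball (0 : EuclideanSpace ℝ (Fin N)) 1,
      ENNReal.ofReal (‖h‖ ^ (-(N : ℝ) + a)) < ⊤ := by
  have h := integrableOn_ball_of_norm_le_rpow (E := EuclideanSpace ℝ (Fin N)) (μ := volume)
    (f := fun h => ‖h‖ ^ (-(N : ℝ) + a)) (C := 1) (α := N - a) (r := 1) (by simpa using hN)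
    (by simpa using ha) (.of_forall fun x => by
      rw [Real.norm_of_nonneg (by positivity), one_mul, neg_sub, sub_eq_neg_add])
    (measurable_norm.pow_const _).aestronglyMeasurable
  exact h.lintegral_lt_top

theorem lintegral_compl_ball_norm_rpow_lt_top {b : ℝ} (hb : 0 < b) :
    ∫⁻ h in (Metric.ball (0 : EuclideanSpace ℝ (Fin N)) 1)ᶜ,
      ENNReal.ofReal ((‖h‖ ^ ((N : ℝ) + b))⁻¹) < ⊤ := by
  have hfin := finite_integral_one_add_norm (E := EuclideanSpace ℝ (Fin N)) (μ := volume)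
    (r := N + b) (by simpa using hb)
  calc _ ≤ ∫⁻ h in (Metric.ball (0 : EuclideanSpace ℝ (Fin N)) 1)ᶜ,
        ENNReal.ofReal (2 ^ ((N : ℝ) + b)) * ENNReal.ofReal ((1 + ‖h‖) ^ (-((N : ℝ) + b))) := by
        refine setLIntegral_mono' measurableSet_ball.compl fun h hh => ?_
        have h1 : 1 ≤ ‖h‖ := by simpa using hh
        have h0 : 0 < ‖h‖ := by linarith
        rw [← ENNReal.ofReal_mul (by positivity)]
        refine ENNReal.ofReal_le_ofReal ?_
        rw [Real.rpow_neg (by positivity), ← div_eq_mul_inv, le_div_iff₀ (by positivity),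
          inv_mul_le_iff₀ (by positivity), mul_comm, ← Real.mul_rpow (by positivity) h0.le]
        exact Real.rpow_le_rpow (by positivity) (by linarith) (by positivity)
    _ ≤ ∫⁻ h : EuclideanSpace ℝ (Fin N),
        ENNReal.ofReal (2 ^ ((N : ℝ) + b)) * ENNReal.ofReal ((1 + ‖h‖) ^ (-((N : ℝ) + b))) :=
        setLIntegral_le_lintegral _ _
    _ < ⊤ := by
        rw [lintegral_const_mul' _ _ ENNReal.ofReal_ne_top]
        exact ENNReal.mul_lt_top ENNReal.ofReal_lt_top hfin

/-- Tonelli and translation invariance: for fixed `x` the inner integral of `k (x - y)` is the same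
number. -/
theorem lintegral_prod_fst_mul_sub {f k : EuclideanSpace ℝ (Fin N) → ENNReal}
    (hf : AEMeasurable f volume) (hk : Measurable k) :
    ∫⁻ z : EuclideanSpace ℝ (Fin N) × EuclideanSpace ℝ (Fin N), f z.1 * k (z.1 - z.2) =
      (∫⁻ x, f x) * ∫⁻ x, k x := by
  have hm : AEMeasurable (fun z : EuclideanSpace ℝ (Fin N) × EuclideanSpace ℝ (Fin N) =>
      f z.1 * k (z.1 - z.2)) (volume.prod volume) :=
    hf.comp_fst.mul (hk.comp (by fun_prop)).aemeasurable
  rw [Measure.volume_eq_prod, lintegral_prod _ hm,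
    ← lintegral_mul_const'' _ hf]
  refine lintegral_congr fun x => ?_
  dsimp only
  rw [lintegral_const_mul _ (by fun_prop), lintegral_sub_left_eq_self k x]

theorem lintegral_prod_snd_mul_sub {f k : EuclideanSpace ℝ (Fin N) → ENNReal}
    (hf : AEMeasurable f volume) (hk : Measurable k) :
    ∫⁻ z : EuclideanSpace ℝ (Fin N) × EuclideanSpace ℝ (Fin N), f z.2 * k (z.1 - z.2) =
      (∫⁻ x, f x) * ∫⁻ x, k x := by
  have hm : AEMeasurable (fun z : EuclideanSpace ℝ (Fin N) × EuclideanSpace ℝ (Fin N) =>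
      f z.2 * k (z.1 - z.2)) (volume.prod volume) :=
    hf.comp_snd.mul (hk.comp (by fun_prop)).aemeasurable
  rw [Measure.volume_eq_prod, lintegral_prod_symm _ hm,
    ← lintegral_mul_const'' _ hf]
  refine lintegral_congr fun x => ?_
  dsimp only
  rw [lintegral_const_mul _ (by fun_prop), lintegral_sub_right_eq_self k x]

/-- The sum is at most twice the larger term; unlike a convexity argument this covers every `r > 0`.
-/
theorem add_rpow_le_two_rpow_mul {a b : ℝ} (ha : 0 ≤ a) (hb : 0 ≤ b) (hr : 0 < r) :
    (a + b) ^ r ≤ 2 ^ r * (a ^ r + b ^ r) := by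
  have h : ∀ c d : ℝ, 0 ≤ c → 0 ≤ d → c ≤ d → (c + d) ^ r ≤ 2 ^ r * (c ^ r + d ^ r) := by
    intro c d hc hd hcd
    calc (c + d) ^ r ≤ (2 * d) ^ r := Real.rpow_le_rpow (by positivity) (by linarith) hr.le
      _ = 2 ^ r * d ^ r := Real.mul_rpow (by norm_num) hd
      _ ≤ _ := by
        refine mul_le_mul_of_nonneg_left ?_ (by positivity)
        linarith [Real.rpow_nonneg hc r]
  rcases le_total a b with hab | hab
  · exact h a b ha hb hab
  · rw [add_comm a, add_comm (a ^ r)]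
    exact h b a hb ha hab

/-- The Gagliardo integral of an `L^r` function vanishing outside a bounded set is finite as soon
as its part near the diagonal is controlled. -/
theorem gagliardoLIntegral_lt_top_of_near (hN : 1 ≤ N) (hr : 0 < r) (hs : 0 < s)
    (hΩ : Bornology.IsBounded Ω) (hu : MemLp u (ENNReal.ofReal r) volume)
    (hu0 : ∀ᵐ x ∂volume, x ∉ Ω → u x = 0)
    {G : EuclideanSpace ℝ (Fin N) × EuclideanSpace ℝ (Fin N) → ENNReal}
    (hG : AEMeasurable G volume) (hGfin : ∫⁻ z, G z < ⊤) {a : ℝ} (ha : 0 < a) {C : ENNReal}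
    (hC : C ≠ ⊤)
    (hnear : ∀ z : EuclideanSpace ℝ (Fin N) × EuclideanSpace ℝ (Fin N), ‖z.1 - z.2‖ < 1 →
      ENNReal.ofReal (|pairDiff u z| ^ r * gagKernel N s r z) ≤
        G z + C * ENNReal.ofReal (‖z.1 - z.2‖ ^ (-(N : ℝ) + a))) :
    gagliardoLIntegral s r u < ⊤ := by
  obtain ⟨R, hR⟩ := hΩ.subset_ball (0 : EuclideanSpace ℝ (Fin N))
  have hfin : ∫⁻ x, ENNReal.ofReal (|u x| ^ r) < ⊤ := ((memLp_ofReal_iff hr).1 hu).2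
  have hum : AEMeasurable (fun x => ENNReal.ofReal (|u x| ^ r)) volume :=
    (aestronglyMeasurable_abs_rpow hu.1 r).aemeasurable.ennreal_ofReal
  set kn : EuclideanSpace ℝ (Fin N) → ENNReal := (Metric.ball 0 1).indicator
    fun h => ENNReal.ofReal (‖h‖ ^ (-(N : ℝ) + a)) with hkn
  set kf : EuclideanSpace ℝ (Fin N) → ENNReal := (Metric.ball 0 1)ᶜ.indicator
    fun h => ENNReal.ofReal ((‖h‖ ^ ((N : ℝ) + s * r))⁻¹) with hkf
  have hknm : Measurable kn := Measurable.indicator (by fun_prop) measurableSet_ball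
  have hkfm : Measurable kf := Measurable.indicator (by fun_prop) measurableSet_ball.compl
  have hknfin : ∫⁻ h, kn h < ⊤ := by
    rw [hkn, lintegral_indicator measurableSet_ball]
    exact lintegral_ball_norm_rpow_lt_top hN ha
  have hkffin : ∫⁻ h, kf h < ⊤ := by
    rw [hkf, lintegral_indicator measurableSet_ball.compl]
    exact lintegral_compl_ball_norm_rpow_lt_top (mul_pos hs hr)
  -- If `|x - y| < 1` and `x` is outside the ball of radius `R + 1`, then neither point is in `Ω`
  -- and the integrand vanishes. The near-diagonal singularity is thus integrated over a bounded set
  -- of `x` only.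
  set B : EuclideanSpace ℝ (Fin N) → ENNReal :=
    (Metric.ball (0 : EuclideanSpace ℝ (Fin N)) (R + 1)).indicator 1 with hB
  have hBm : Measurable B := measurable_one.indicator measurableSet_ball
  have hBfin : ∫⁻ x, B x < ⊤ := by
    rw [hB, lintegral_indicator_one measurableSet_ball]
    exact measure_ball_lt_top
  set c := ENNReal.ofReal (2 ^ r) with hc
  have hle : gagliardoLIntegral s r u ≤ ∫⁻ z : EuclideanSpace ℝ (Fin N) × EuclideanSpace ℝ (Fin N),
      (G z + (C * (B z.1 * kn (z.1 - z.2)) +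
        (c * (ENNReal.ofReal (|u z.1| ^ r) * kf (z.1 - z.2)) +
        c * (ENNReal.ofReal (|u z.2| ^ r) * kf (z.1 - z.2))))) := by
    refine lintegral_mono_ae ?_
    filter_upwards [ae_prod_of_ae hu0] with z hz
    rw [div_eq_mul_inv]
    change ENNReal.ofReal (|pairDiff u z| ^ r * gagKernel N s r z) ≤ _
    by_cases h1 : ‖z.1 - z.2‖ < 1
    · have hkz : kn (z.1 - z.2) = ENNReal.ofReal (‖z.1 - z.2‖ ^ (-(N : ℝ) + a)) := by
        rw [hkn, indicator_of_mem (by simpa using h1)]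
      by_cases h2 : z.1 ∈ Metric.ball (0 : EuclideanSpace ℝ (Fin N)) (R + 1)
      · rw [hkz, hB, indicator_of_mem h2, Pi.one_apply, one_mul, ← add_assoc]
        exact (hnear z h1).trans le_self_add
      · have h3 : z.1 ∉ Ω := fun h => h2 (Metric.ball_subset_ball (by linarith) (hR h))
        have h4 : z.2 ∉ Ω := fun h => h2 (by
          have h5 := hR h
          simp only [Metric.mem_ball, dist_zero_right] at h5 ⊢
          calc ‖z.1‖ = ‖z.2 + (z.1 - z.2)‖ := by congr 1; abel
            _ ≤ ‖z.2‖ + ‖z.1 - z.2‖ := norm_add_le _ _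
            _ < R + 1 := by linarith)
        simp [pairDiff, hz.1 h3, hz.2 h4, Real.zero_rpow hr.ne']
    -- Away from the diagonal `|u x - u y|^r` is split into the two separate powers, and the kernel
    -- tail is integrable.
    · have hkz : kf (z.1 - z.2) = ENNReal.ofReal (gagKernel N s r z) := by
        rw [hkf, indicator_of_mem (by simpa using h1)]; rfl
      rw [hkz]
      refine le_trans ?_ (le_add_self.trans le_add_self)
      rw [← mul_add, ← add_mul, hc, ← ENNReal.ofReal_add (by positivity) (by positivity),
        ← ENNReal.ofReal_mul (by positivity), ← ENNReal.ofReal_mul (by positivity), ← mul_assoc]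
      refine ENNReal.ofReal_le_ofReal (mul_le_mul_of_nonneg_right ?_ (gagKernel_nonneg z))
      refine le_trans ?_ (add_rpow_le_two_rpow_mul (abs_nonneg _) (abs_nonneg _) hr)
      exact Real.rpow_le_rpow (abs_nonneg _) (abs_sub _ _) hr.le
  refine hle.trans_lt ?_
  have hm1 : AEMeasurable (fun z : EuclideanSpace ℝ (Fin N) × EuclideanSpace ℝ (Fin N) =>
      c * (ENNReal.ofReal (|u z.1| ^ r) * kf (z.1 - z.2))) volume :=
    (hum.comp_fst.mul (by fun_prop)).const_mul _
  have hm2 : AEMeasurable (fun z : EuclideanSpace ℝ (Fin N) × EuclideanSpace ℝ (Fin N) =>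
      C * (B z.1 * kn (z.1 - z.2))) volume :=
    ((hBm.comp measurable_fst).mul (hknm.comp (by fun_prop))).aemeasurable.const_mul _
  rw [lintegral_add_left' hG, lintegral_add_left' hm2, lintegral_add_left' hm1,
    lintegral_const_mul' _ _ ENNReal.ofReal_ne_top, lintegral_const_mul' _ _ ENNReal.ofReal_ne_top,
    lintegral_const_mul' _ _ hC, lintegral_prod_fst_mul_sub hum hkfm,
    lintegral_prod_snd_mul_sub hum hkfm, lintegral_prod_fst_mul_sub hBm.aemeasurable hknm]
  have h5 := ENNReal.mul_lt_top (ENNReal.ofReal_lt_top (r := 2 ^ r))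
    (ENNReal.mul_lt_top hfin hkffin)
  exact ENNReal.add_lt_top.2 ⟨hGfin, ENNReal.add_lt_top.2
    ⟨ENNReal.mul_lt_top hC.lt_top (ENNReal.mul_lt_top hBfin hknfin), ENNReal.add_lt_top.2 ⟨h5, h5⟩⟩⟩

theorem lintegral_ofReal_mul_gagKernel :
    ∫⁻ z, ENNReal.ofReal (|pairDiff u z| ^ r * gagKernel N s r z) = gagliardoLIntegral s r u := by
  rw [gagliardoLIntegral]
  simp only [div_eq_mul_inv]
  rfl

theorem aemeasurable_ofReal_mul_gagKernel (hu : AEStronglyMeasurable u volume) :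
    AEMeasurable (fun z => ENNReal.ofReal (|pairDiff u z| ^ r * gagKernel N s r z)) volume :=
  ((aestronglyMeasurable_abs_rpow (aestronglyMeasurable_pairDiff_volume hu) r).aemeasurable.mul
    measurable_gagKernel.aemeasurable).ennreal_ofReal

/-- Pointwise interpolation inequality behind `W^{s,p}_0 ⊆ W^{σ,q}_0` for `σ < s`, `q < p`. -/
theorem rpow_mul_inv_rpow_le {n s p σ q d ρ : ℝ} (hq : 0 < q) (hqp : q < p) (hd : 0 ≤ d)
    (hρ : 0 < ρ) :
    d ^ q * (ρ ^ (n + σ * q))⁻¹ ≤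
      d ^ p * (ρ ^ (n + s * p))⁻¹ + ρ ^ (-n + (s - σ) * (q * p / (p - q))) := by
  have hp : 0 < p := hq.trans hqp
  have hpq : 0 < p - q := by linarith
  -- The power of `ρ` in the second term is chosen so that the weighted geometric mean is exactly
  -- the left side. When `σ < s` that power exceeds `-n`, which makes it integrable near the
  -- diagonal.
  have h := Real.geom_mean_le_arith_mean2_weighted (w₁ := q / p) (w₂ := (p - q) / p)
    (p₁ := d ^ p * (ρ ^ (n + s * p))⁻¹) (p₂ := ρ ^ (-n + (s - σ) * (q * p / (p - q))))
    (by positivity) (by positivity) (by positivity) (by positivity) (by field_simp; ring)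
  have e1 : (d ^ p * (ρ ^ (n + s * p))⁻¹) ^ (q / p) *
      (ρ ^ (-n + (s - σ) * (q * p / (p - q)))) ^ ((p - q) / p) =
      d ^ q * (ρ ^ (n + σ * q))⁻¹ := by
    rw [Real.mul_rpow (by positivity) (by positivity), ← Real.rpow_mul hd, ← Real.rpow_neg hρ.le,
      ← Real.rpow_neg hρ.le, ← Real.rpow_mul hρ.le, ← Real.rpow_mul hρ.le, mul_assoc,
      ← Real.rpow_add hρ]
    congr 2
    · field_simp
    · field_simp
      ring
  rw [e1] at h
  refine h.trans (add_le_add ?_ ?_)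
  · exact mul_le_of_le_one_left (by positivity) ((div_le_one hp).2 hqp.le)
  · exact mul_le_of_le_one_left (by positivity) ((div_le_one hp).2 (by linarith))

theorem memLp_of_exponent_le (hΩ : Bornology.IsBounded Ω) (hΩo : IsOpen Ω) {p q : ℝ}
    (hqp : q ≤ p) (hu : MemLp u (ENNReal.ofReal p) volume)
    (hu0 : ∀ᵐ x ∂volume, x ∉ Ω → u x = 0) : MemLp u (ENNReal.ofReal q) volume := by
  have : IsFiniteMeasure (volume.restrict Ω) := ⟨by simpa using hΩ.measure_lt_top⟩
  have h1 : MemLp u (ENNReal.ofReal q) (volume.restrict Ω) :=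
    (hu.restrict Ω).mono_exponent (ENNReal.ofReal_le_ofReal hqp)
  have h2 := (memLp_indicator_iff_restrict hΩo.measurableSet).2 h1
  refine (memLp_congr_ae ?_).1 h2
  filter_upwards [hu0] with x hx
  by_cases h : x ∈ Ω
  · simp [h]
  · simp [h, hx h]

/-- The embedding `W^{s,p}_0(Ω) ⊆ W^{σ,q}_0(Ω)` for `σ < s`, `q < p` and bounded `Ω`. -/
theorem W0_subset_W0 (hN : 1 ≤ N) (hΩ : Bornology.IsBounded Ω) (hΩo : IsOpen Ω) {s p σ q : ℝ}
    (hσ : 0 < σ) (hσs : σ < s) (hq : 0 < q) (hqp : q < p) : W0 Ω s p ⊆ W0 Ω σ q := by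
  intro u hu
  have hLq := memLp_of_exponent_le hΩ hΩo hqp.le hu.1 hu.2.2
  have hpq : 0 < p - q := by linarith
  have hp : 0 < p := by linarith
  have ha : 0 < (s - σ) * (q * p / (p - q)) :=
    mul_pos (by linarith) (div_pos (mul_pos hq hp) hpq)
  refine ⟨hLq, ?_, hu.2.2⟩
  refine gagliardoLIntegral_lt_top_of_near hN hq hσ hΩ hLq hu.2.2
    (G := fun z => ENNReal.ofReal (|pairDiff u z| ^ p * gagKernel N s p z))
    (aemeasurable_ofReal_mul_gagKernel hu.1.1) (lintegral_ofReal_mul_gagKernel.trans_lt hu.2.1)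
    (C := 1) ha ENNReal.one_ne_top fun z _ => ?_
  rw [one_mul, ← ENNReal.ofReal_add (mul_nonneg (by positivity) (gagKernel_nonneg z))
    (by positivity)]
  refine ENNReal.ofReal_le_ofReal ?_
  rcases (norm_nonneg (z.1 - z.2)).eq_or_lt' with h | h
  · have hz : z.1 = z.2 := by simpa [sub_eq_zero] using h
    have : pairDiff u z = 0 := by simp [pairDiff, hz]
    rw [this, abs_zero, Real.zero_rpow hq.ne', zero_mul]
    exact add_nonneg (mul_nonneg (by positivity) (gagKernel_nonneg z)) (by positivity)
  · exact rpow_mul_inv_rpow_le hq hqp (abs_nonneg _) h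

/-- A function whose increments are dominated by those of an element of `W^{s,r}_0(Ω)` and of a
Lipschitz function belongs to `W^{s,r}_0(Ω)`. -/
theorem mem_W0_of_abs_sub_le (hN : 1 ≤ N) (hΩ : Bornology.IsBounded Ω) (hr : 0 < r) (hs : 0 < s)
    (hs1 : s < 1) (hu : u ∈ W0 Ω s r) (hv : MemLp v (ENNReal.ofReal r) volume)
    (hv0 : ∀ᵐ x ∂volume, x ∉ Ω → v x = 0) {C : ℝ} (hC : 0 ≤ C)
    (h : ∀ x y, |v x - v y| ≤ C * (|u x - u y| + ‖x - y‖)) : v ∈ W0 Ω s r := by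
  refine ⟨hv, ?_, hv0⟩
  refine gagliardoLIntegral_lt_top_of_near hN hr hs hΩ hv hv0
    (G := fun z => ENNReal.ofReal (C ^ r * 2 ^ r) *
      ENNReal.ofReal (|pairDiff u z| ^ r * gagKernel N s r z))
    ((aemeasurable_ofReal_mul_gagKernel hu.1.1).const_mul _) ?_
    (C := ENNReal.ofReal (C ^ r * 2 ^ r)) (a := r * (1 - s)) (mul_pos hr (by linarith))
    ENNReal.ofReal_ne_top fun z _ => ?_
  · rw [lintegral_const_mul' _ _ ENNReal.ofReal_ne_top, lintegral_ofReal_mul_gagKernel]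
    exact ENNReal.mul_lt_top ENNReal.ofReal_lt_top hu.2.1
  · rw [← mul_add, ← ENNReal.ofReal_add (mul_nonneg (by positivity) (gagKernel_nonneg z))
      (by positivity), ← ENNReal.ofReal_mul (by positivity)]
    refine ENNReal.ofReal_le_ofReal ?_
    rcases (norm_nonneg (z.1 - z.2)).eq_or_lt' with h0 | h0
    · have hz : z.1 = z.2 := by simpa [sub_eq_zero] using h0
      have : pairDiff v z = 0 := by simp [pairDiff, hz]
      rw [this, abs_zero, Real.zero_rpow hr.ne', zero_mul]
      exact mul_nonneg (by positivity)
        (add_nonneg (mul_nonneg (by positivity) (gagKernel_nonneg z)) (by positivity))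
    -- The Lipschitz part contributes `|x - y|^r` times the kernel, whose exponent `-N + r (1 - s)`
    -- is above `-N` because `s < 1`.
    · have e1 : ‖z.1 - z.2‖ ^ (-(N : ℝ) + r * (1 - s)) =
          ‖z.1 - z.2‖ ^ r * gagKernel N s r z := by
        rw [gagKernel, ← Real.rpow_neg h0.le, ← Real.rpow_add h0]
        congr 1
        ring
      rw [e1, ← add_mul, ← mul_assoc, mul_assoc (C ^ r)]
      refine mul_le_mul_of_nonneg_right ?_ (gagKernel_nonneg z)
      calc |pairDiff v z| ^ r ≤ (C * (|pairDiff u z| + ‖z.1 - z.2‖)) ^ r :=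
            Real.rpow_le_rpow (abs_nonneg _) (h _ _) hr.le
        _ = C ^ r * (|pairDiff u z| + ‖z.1 - z.2‖) ^ r := Real.mul_rpow hC (by positivity)
        _ ≤ _ := mul_le_mul_of_nonneg_left
            (add_rpow_le_two_rpow_mul (abs_nonneg _) h0.le hr) (by positivity)

theorem memLp_of_bounded (hΩ : Bornology.IsBounded Ω) (hv : AEStronglyMeasurable v volume)
    (hv0 : ∀ᵐ x ∂volume, x ∉ Ω → v x = 0) {M : ℝ} (hM : ∀ x, |v x| ≤ M) (p : ENNReal) :
    MemLp v p volume := by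
  obtain ⟨R, hR⟩ := hΩ.subset_ball (0 : EuclideanSpace ℝ (Fin N))
  have : IsFiniteMeasure (volume.restrict (Metric.ball (0 : EuclideanSpace ℝ (Fin N)) R)) :=
    ⟨by simpa using measure_ball_lt_top⟩
  have h1 : MemLp v p (volume.restrict (Metric.ball (0 : EuclideanSpace ℝ (Fin N)) R)) :=
    MemLp.of_bound hv.restrict M (.of_forall hM)
  refine (memLp_congr_ae ?_).1 ((memLp_indicator_iff_restrict measurableSet_ball).2 h1)
  filter_upwards [hv0] with x hx
  by_cases h : x ∈ Metric.ball (0 : EuclideanSpace ℝ (Fin N)) R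
  · simp [h]
  · simp [h, hx fun h' => h (hR h')]

/-- Bounded Lipschitz functions vanishing outside a bounded set belong to every
`W^{s,r}_0(Ω)`. -/
theorem lipschitz_mem_W0 (hN : 1 ≤ N) (hΩ : Bornology.IsBounded Ω) (hr : 0 < r) (hs : 0 < s)
    (hs1 : s < 1) {K : NNReal} (hv : LipschitzWith K v) (hv0 : ∀ x, x ∉ Ω → v x = 0) {M : ℝ}
    (hM : ∀ x, |v x| ≤ M) : v ∈ W0 Ω s r := by
  have hv0' : ∀ᵐ x ∂volume, x ∉ Ω → v x = 0 := .of_forall hv0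
  refine mem_W0_of_abs_sub_le hN hΩ hr hs hs1 (zero_mem_W0 hr)
    (memLp_of_bounded hΩ hv.continuous.aestronglyMeasurable hv0' hM _) hv0' K.2 fun x y => ?_
  have := hv.dist_le_mul x y
  rw [Real.dist_eq, dist_eq_norm] at this
  simpa using this

end Kernels

/-! ### Poincaré inequality, lower semicontinuity, oscillation on small balls -/

section Compactness

open Filter Topology

variable {N : ℕ} {Ω : Set (EuclideanSpace ℝ (Fin N))} {s r : ℝ}
  {u v w : EuclideanSpace ℝ (Fin N) → ℝ}

/-- Jensen's inequality for powers. -/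
theorem ofReal_abs_integral_rpow_le {X : Type*} [MeasurableSpace X] {π : Measure X}
    [IsProbabilityMeasure π] {f : X → ℝ} (hr : 1 ≤ r) (hf : AEStronglyMeasurable f π) :
    ENNReal.ofReal (|∫ x, f x ∂π| ^ r) ≤ ∫⁻ x, ENNReal.ofReal (|f x| ^ r) ∂π := by
  have hr0 : 0 < r := by linarith
  have h0 : ENNReal.ofReal r ≠ 0 := by simpa using hr0
  have h : ∀ a : ℝ, ENNReal.ofReal (|a| ^ r) = ‖a‖ₑ ^ r := fun a => by
    rw [← Real.norm_eq_abs, ← ofReal_norm, ENNReal.ofReal_rpow_of_nonneg (norm_nonneg _) hr0.le]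
  simp only [h]
  have h1 : ‖∫ x, f x ∂π‖ₑ ≤ eLpNorm f (ENNReal.ofReal r) π := by
    refine (enorm_integral_le_lintegral_enorm f).trans ?_
    rw [← eLpNorm_one_eq_lintegral_enorm]
    exact eLpNorm_le_eLpNorm_of_exponent_le (by simpa using hr) hf
  rw [eLpNorm_eq_lintegral_rpow_enorm_toReal h0 ENNReal.ofReal_ne_top,
    ENNReal.toReal_ofReal hr0.le] at h1
  calc ‖∫ x, f x ∂π‖ₑ ^ r ≤ ((∫⁻ x, ‖f x‖ₑ ^ r ∂π) ^ (1 / r)) ^ r :=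
        ENNReal.rpow_le_rpow h1 hr0.le
    _ = _ := by rw [← ENNReal.rpow_mul, one_div, inv_mul_cancel₀ hr0.ne', ENNReal.rpow_one]

/-- The fractional Poincaré inequality for functions vanishing outside a bounded set. -/
theorem exists_poincare (hN : 1 ≤ N) (hΩ : Bornology.IsBounded Ω) (s : ℝ) {r : ℝ} (hr : 0 < r)
    (hs : 0 < s) :
    ∃ C : ℝ, 0 < C ∧ ∀ u ∈ W0 Ω s r, ∫ x in Ω, |u x| ^ r ≤ C * gagliardoPow s r u := by
  obtain ⟨R, hR0, hR⟩ := hΩ.subset_ball_lt 0 (0 : EuclideanSpace ℝ (Fin N))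
  have : Nonempty (Fin N) := ⟨⟨0, hN⟩⟩
  have : Nontrivial (EuclideanSpace ℝ (Fin N)) := inferInstance
  -- The unit ball around `y₀` misses `Ω`, and its points are within `D = 2R + 2` of those of `Ω`.
  -- For `x ∈ Ω` and `y` in that ball the Gagliardo integrand is therefore at least `k |u x|^r`;
  -- integrating in `y` gives the constant.
  obtain ⟨y₀, hy₀⟩ := exists_norm_eq (EuclideanSpace ℝ (Fin N)) (c := R + 1) (by linarith)
  set B := Metric.ball y₀ 1 with hB
  set D := 2 * R + 2 with hD
  set k : ℝ := (D ^ ((N : ℝ) + s * r))⁻¹ with hk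
  have hDpos : 0 < D := by positivity
  have hkpos : 0 < k := by positivity
  have hBpos : 0 < volume.real B := by
    rw [Measure.real]
    exact ENNReal.toReal_pos (Metric.measure_ball_pos _ _ one_pos).ne' measure_ball_lt_top.ne
  refine ⟨(k * volume.real B)⁻¹, by positivity, fun u hu => ?_⟩
  rw [← div_eq_inv_mul, le_div_iff₀ (by positivity), integral_Ω_eq hr hu.2.2,
    integral_abs_rpow_eq hu.1.1, gagliardoPow, Measure.real, ← ENNReal.toReal_ofReal hkpos.le,
    ← ENNReal.toReal_mul, ← ENNReal.toReal_mul]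
  refine ENNReal.toReal_mono hu.2.1.ne ?_
  have hum : AEMeasurable (fun x => ENNReal.ofReal (|u x| ^ r)) volume :=
    (aestronglyMeasurable_abs_rpow hu.1.1 r).aemeasurable.ennreal_ofReal
  have hBi : ∫⁻ y, ENNReal.ofReal k * B.indicator 1 y = ENNReal.ofReal k * volume B := by
    rw [lintegral_const_mul _ (measurable_one.indicator measurableSet_ball),
      lintegral_indicator_one measurableSet_ball]
  rw [← hBi, ← lintegral_prod_mul hum
    ((measurable_one.indicator measurableSet_ball).aemeasurable.const_mul _)]
  refine lintegral_mono_ae ?_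
  filter_upwards [ae_prod_of_ae hu.2.2] with z hz
  by_cases h2 : z.2 ∈ B
  · by_cases h1 : z.1 ∈ Ω
    · have h3 : z.2 ∉ Ω := fun h => by
        have h4 := hR h
        rw [mem_ball_zero_iff] at h4
        rw [hB, Metric.mem_ball, dist_eq_norm] at h2
        have h5 : ‖y₀‖ ≤ ‖z.2‖ + ‖z.2 - y₀‖ := by
          calc ‖y₀‖ = ‖z.2 - (z.2 - y₀)‖ := by congr 1; abel
            _ ≤ _ := norm_sub_le _ _
        linarith
      have hz2 : ‖z.2‖ ≤ R + 2 := by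
        simp only [hB, Metric.mem_ball, dist_eq_norm] at h2
        calc ‖z.2‖ = ‖(z.2 - y₀) + y₀‖ := by congr 1; abel
          _ ≤ ‖z.2 - y₀‖ + ‖y₀‖ := norm_add_le _ _
          _ ≤ R + 2 := by linarith
      have hz1 : ‖z.1‖ ≤ R := by
        have := hR h1
        simp only [Metric.mem_ball, dist_zero_right] at this
        exact this.le
      have hne : z.1 ≠ z.2 := fun h => h3 (h ▸ h1)
      have hpos : 0 < ‖z.1 - z.2‖ := norm_pos_iff.2 (sub_ne_zero.2 hne)
      rw [indicator_of_mem h2, Pi.one_apply, mul_one, ← ENNReal.ofReal_mul (by positivity),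
        hz.2 h3, sub_zero, div_eq_mul_inv]
      refine ENNReal.ofReal_le_ofReal (mul_le_mul_of_nonneg_left ?_ (by positivity))
      refine inv_anti₀ (by positivity) (Real.rpow_le_rpow hpos.le ?_ (by positivity))
      exact (norm_sub_le _ _).trans (by linarith)
    · simp [hz.1 h1, Real.zero_rpow hr.ne']
  · rw [indicator_of_notMem h2, mul_zero, mul_zero]
    exact zero_le

/-- Fatou's lemma for the Gagliardo integral. -/
theorem gagliardoLIntegral_le_liminf {f : ℕ → EuclideanSpace ℝ (Fin N) → ℝ} (hr : 0 ≤ r)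
    (hf : ∀ n, AEStronglyMeasurable (f n) volume)
    (hlim : ∀ᵐ x ∂volume, Tendsto (fun n => f n x) atTop (𝓝 (u x))) :
    gagliardoLIntegral s r u ≤ liminf (fun n => gagliardoLIntegral s r (f n)) atTop := by
  simp only [gagliardoLIntegral_eq]
  refine le_trans (lintegral_mono_ae ?_) (lintegral_liminf_le' fun n =>
    (aestronglyMeasurable_abs_rpow (aestronglyMeasurable_pairDiff (hf n)) r).aemeasurable.ennreal_ofReal)
  filter_upwards [gagMeasure_absolutelyContinuous.ae_le (ae_prod_of_ae hlim)] with z hz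
  refine le_of_eq (Tendsto.liminf_eq ?_).symm
  exact ENNReal.tendsto_ofReal (((hz.1.sub hz.2).abs).rpow_const (Or.inr hr))

theorem gagliardoLIntegral_eq_ofReal (h : gagliardoLIntegral s r u < ⊤) :
    gagliardoLIntegral s r u = ENNReal.ofReal (gagliardoPow s r u) :=
  (ENNReal.ofReal_toReal h.ne).symm

theorem gagliardoLIntegral_lt_top_of_tendsto {f : ℕ → EuclideanSpace ℝ (Fin N) → ℝ} (hr : 0 ≤ r)
    {C : ℝ} (hf : ∀ n, f n ∈ W0 Ω s r) (hC : ∀ n, gagliardoPow s r (f n) ≤ C)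
    (hlim : ∀ᵐ x ∂volume, Tendsto (fun n => f n x) atTop (𝓝 (u x))) :
    gagliardoLIntegral s r u < ⊤ := by
  refine (gagliardoLIntegral_le_liminf hr (fun n => (hf n).1.1) hlim).trans_lt ?_
  refine lt_of_le_of_lt (b := ENNReal.ofReal C) ?_ ENNReal.ofReal_lt_top
  refine liminf_le_of_frequently_le' (.of_forall fun n => ?_)
  rw [gagliardoLIntegral_eq_ofReal (hf n).2.1]
  exact ENNReal.ofReal_le_ofReal (hC n)

/-- Fatou's lemma as a real inequality holding eventually, so that the `p`-term and the `q`-term can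
be handled along one sequence at the same index. -/
theorem eventually_gagliardoPow_sub_le {f : ℕ → EuclideanSpace ℝ (Fin N) → ℝ} (hr : 0 ≤ r)
    (hf : ∀ n, f n ∈ W0 Ω s r) (hu : gagliardoLIntegral s r u < ⊤)
    (hlim : ∀ᵐ x ∂volume, Tendsto (fun n => f n x) atTop (𝓝 (u x))) {ε : ℝ} (hε : 0 < ε) :
    ∀ᶠ n in atTop, gagliardoPow s r u - ε ≤ gagliardoPow s r (f n) := by
  rcases lt_or_ge (gagliardoPow s r u - ε) 0 with h | h
  · exact .of_forall fun n => h.le.trans gagliardoPow_nonneg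
  have h1 : ENNReal.ofReal (gagliardoPow s r u - ε) <
      liminf (fun n => gagliardoLIntegral s r (f n)) atTop := by
    refine lt_of_lt_of_le ?_ (gagliardoLIntegral_le_liminf hr (fun n => (hf n).1.1) hlim)
    rw [gagliardoLIntegral_eq_ofReal hu]
    exact (ENNReal.ofReal_lt_ofReal_iff (by linarith)).2 (by linarith)
  filter_upwards [eventually_lt_of_lt_liminf h1] with n hn
  rw [gagliardoLIntegral_eq_ofReal (hf n).2.1] at hn
  exact (ENNReal.ofReal_le_ofReal_iff gagliardoPow_nonneg).1 hn.le

/-- The deviation from the mean over a ball is controlled by the Gagliardo integrand. -/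
theorem ofReal_abs_sub_average_rpow_le (hr : 1 ≤ r) (hs : 0 < s)
    (hw : MemLp w (ENNReal.ofReal r) volume) {c x : EuclideanSpace ℝ (Fin N)} {h : ℝ} (hh : 0 < h)
    (hx : x ∈ Metric.ball c h) :
    ENNReal.ofReal (|w x - ∫ y, w y ∂(ProbabilityTheory.cond volume (Metric.ball c h))| ^ r) ≤
      (volume (Metric.ball c h))⁻¹ * (ENNReal.ofReal ((2 * h) ^ ((N : ℝ) + s * r)) *
        ∫⁻ y, ENNReal.ofReal (|pairDiff w (x, y)| ^ r * gagKernel N s r (x, y))) := by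
  have hr0 : 0 < r := by linarith
  have hB0 : volume (Metric.ball c h) ≠ 0 := (Metric.measure_ball_pos _ _ hh).ne'
  have hBt : volume (Metric.ball c h) ≠ ⊤ := measure_ball_lt_top.ne
  have : IsProbabilityMeasure (ProbabilityTheory.cond volume (Metric.ball c h)) :=
    ProbabilityTheory.cond_isProbabilityMeasure_of_finite hB0 hBt
  have hwm : MemLp w (ENNReal.ofReal r) (ProbabilityTheory.cond volume (Metric.ball c h)) :=
    (hw.restrict _).smul_measure (ENNReal.inv_ne_top.2 hB0)
  have hwi : Integrable w (ProbabilityTheory.cond volume (Metric.ball c h)) :=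
    hwm.integrable (by simpa using hr)
  have e : w x - ∫ y, w y ∂(ProbabilityTheory.cond volume (Metric.ball c h)) =
      ∫ y, pairDiff w (x, y) ∂(ProbabilityTheory.cond volume (Metric.ball c h)) := by
    simp only [pairDiff]
    rw [integral_sub (integrable_const _) hwi]
    simp
  rw [e]
  refine (ofReal_abs_integral_rpow_le hr
    ((integrable_const (w x)).sub hwi).aestronglyMeasurable).trans ?_
  rw [ProbabilityTheory.cond, lintegral_smul_measure, smul_eq_mul]
  refine mul_le_mul_right ?_ _
  rw [← lintegral_const_mul' _ _ ENNReal.ofReal_ne_top]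
  refine (setLIntegral_mono' measurableSet_ball fun y hy => ?_).trans (setLIntegral_le_lintegral _ _)
  rw [← ENNReal.ofReal_mul (by positivity)]
  refine ENNReal.ofReal_le_ofReal ?_
  rcases eq_or_ne x y with rfl | hxy
  · simp [pairDiff, Real.zero_rpow hr0.ne']
  have hpos : 0 < ‖x - y‖ := norm_pos_iff.2 (sub_ne_zero.2 hxy)
  -- Two points of one ball are at distance at most `2h`, so `(2h)^(N + s r)` times the kernel is at
  -- least `1`.
  have hle : ‖x - y‖ ≤ 2 * h := by
    rw [← dist_eq_norm]
    have := dist_triangle_right x y c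
    rw [Metric.mem_ball] at hx hy
    linarith
  rw [mul_left_comm]
  refine le_mul_of_one_le_right (by positivity) ?_
  rw [gagKernel, ← div_eq_mul_inv, one_le_div (by positivity)]
  exact Real.rpow_le_rpow hpos.le hle (by positivity)

theorem lintegral_lintegral_gagKernel (hw : AEStronglyMeasurable w volume) :
    ∫⁻ x, ∫⁻ y, ENNReal.ofReal (|pairDiff w (x, y)| ^ r * gagKernel N s r (x, y)) =
      gagliardoLIntegral s r w := by
  rw [← lintegral_ofReal_mul_gagKernel, Measure.volume_eq_prod,
    lintegral_prod _ (aemeasurable_ofReal_mul_gagKernel hw)]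

/-- A function with small means over a fine finite cover by balls is small in `L^r`. -/
theorem lintegral_rpow_le_of_average_le (hr : 1 ≤ r) (hs : 0 < s) (hΩo : IsOpen Ω)
    (hw : w ∈ W0 Ω s r) {h : ℝ} (hh : 0 < h) {t : Set (EuclideanSpace ℝ (Fin N))}
    (ht : Ω ⊆ ⋃ c ∈ t, Metric.ball c h) {η : ℝ}
    (hη : ∀ c ∈ t, |∫ y, w y ∂(ProbabilityTheory.cond volume (Metric.ball c h))| ≤ η) :
    ∫⁻ x, ENNReal.ofReal (|w x| ^ r) ≤ ENNReal.ofReal (2 ^ r) *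
      ((volume (Metric.ball (0 : EuclideanSpace ℝ (Fin N)) h))⁻¹ *
        (ENNReal.ofReal ((2 * h) ^ ((N : ℝ) + s * r)) * gagliardoLIntegral s r w) +
        ENNReal.ofReal (η ^ r) * volume Ω) := by
  have hr0 : 0 < r := by linarith
  have hBt : (volume (Metric.ball (0 : EuclideanSpace ℝ (Fin N)) h))⁻¹ ≠ ⊤ :=
    ENNReal.inv_ne_top.2 (Metric.measure_ball_pos _ _ hh).ne'
  set g : EuclideanSpace ℝ (Fin N) → ENNReal := fun x =>
    ∫⁻ y, ENNReal.ofReal (|pairDiff w (x, y)| ^ r * gagKernel N s r (x, y)) with hg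
  have hle : ∀ᵐ x ∂volume, ENNReal.ofReal (|w x| ^ r) ≤ ENNReal.ofReal (2 ^ r) *
      ((volume (Metric.ball (0 : EuclideanSpace ℝ (Fin N)) h))⁻¹ *
        (ENNReal.ofReal ((2 * h) ^ ((N : ℝ) + s * r)) * g x) +
        Ω.indicator (fun _ => ENNReal.ofReal (η ^ r)) x) := by
    filter_upwards [hw.2.2] with x hx0
    by_cases hx : x ∈ Ω
    · obtain ⟨c, hc, hxc⟩ := mem_iUnion₂.1 (ht hx)
      have h1 := ofReal_abs_sub_average_rpow_le hr hs hw.1 hh hxc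
      -- All balls of radius `h` have the same volume, so the bound does not depend on which ball of
      -- the cover contains `x`; overlaps of the cover cost nothing.
      rw [Measure.addHaar_ball_center] at h1
      set m := ∫ y, w y ∂(ProbabilityTheory.cond volume (Metric.ball c h)) with hm
      calc ENNReal.ofReal (|w x| ^ r) ≤ ENNReal.ofReal ((|w x - m| + |m|) ^ r) := by
            refine ENNReal.ofReal_le_ofReal (Real.rpow_le_rpow (abs_nonneg _) ?_ hr0.le)
            have := abs_add_le (w x - m) m
            simpa using this
        _ ≤ ENNReal.ofReal (2 ^ r * (|w x - m| ^ r + |m| ^ r)) :=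
            ENNReal.ofReal_le_ofReal (add_rpow_le_two_rpow_mul (abs_nonneg _) (abs_nonneg _) hr0)
        _ = ENNReal.ofReal (2 ^ r) * (ENNReal.ofReal (|w x - m| ^ r) +
              ENNReal.ofReal (|m| ^ r)) := by
            rw [ENNReal.ofReal_mul (by positivity), ENNReal.ofReal_add (by positivity)
              (by positivity)]
        _ ≤ _ := by
            rw [indicator_of_mem hx]
            exact mul_le_mul_right (add_le_add h1 (ENNReal.ofReal_le_ofReal
              (Real.rpow_le_rpow (abs_nonneg _) (hη c hc) hr0.le))) _
    · simp [hx0 hx, Real.zero_rpow hr0.ne']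
  refine (lintegral_mono_ae hle).trans (le_of_eq ?_)
  rw [lintegral_const_mul' _ _ ENNReal.ofReal_ne_top,
    lintegral_add_right _ (measurable_const.indicator hΩo.measurableSet),
    lintegral_const_mul' _ _ hBt, lintegral_const_mul' _ _ ENNReal.ofReal_ne_top, hg,
    lintegral_lintegral_gagKernel hw.1.1, lintegral_indicator hΩo.measurableSet,
    setLIntegral_const]

end Compactness

/-! ### Compact embedding into `L^r` -/

section Compactness

open Filter Topology

variable {N : ℕ} {Ω : Set (EuclideanSpace ℝ (Fin N))} {s r : ℝ}
  {u v w : EuclideanSpace ℝ (Fin N) → ℝ}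

theorem gagliardoLIntegral_sub_le (hr : 0 < r) (hu : AEStronglyMeasurable u volume) :
    gagliardoLIntegral s r (u - v) ≤
      ENNReal.ofReal (2 ^ r) * (gagliardoLIntegral s r u + gagliardoLIntegral s r v) := by
  simp only [gagliardoLIntegral_eq]
  rw [← lintegral_add_left' (aestronglyMeasurable_abs_rpow
    (aestronglyMeasurable_pairDiff hu) r).aemeasurable.ennreal_ofReal,
    ← lintegral_const_mul' _ _ ENNReal.ofReal_ne_top]
  refine lintegral_mono fun z => ?_
  rw [← ENNReal.ofReal_add (by positivity) (by positivity), ← ENNReal.ofReal_mul (by positivity)]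
  refine ENNReal.ofReal_le_ofReal ?_
  refine le_trans (Real.rpow_le_rpow (abs_nonneg _) ?_ hr.le)
    (add_rpow_le_two_rpow_mul (abs_nonneg _) (abs_nonneg _) hr)
  rw [show pairDiff (u - v) z = pairDiff u z - pairDiff v z by simp only [pairDiff, Pi.sub_apply]; ring]
  exact abs_sub _ _

theorem eLpNorm_le_of_lintegral_le {X : Type*} [MeasurableSpace X] {μ : Measure X} {f : X → ℝ}
    (hr : 0 < r) {ε : ℝ} (hε : 0 ≤ ε)
    (h : ∫⁻ x, ENNReal.ofReal (|f x| ^ r) ∂μ ≤ ENNReal.ofReal (ε ^ r)) :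
    eLpNorm f (ENNReal.ofReal r) μ ≤ ENNReal.ofReal ε := by
  have h0 : ENNReal.ofReal r ≠ 0 := by simpa using hr
  have h1 : ∀ a : ℝ, ENNReal.ofReal (|a| ^ r) = ‖a‖ₑ ^ r := fun a => by
    rw [← Real.norm_eq_abs, ← ofReal_norm, ENNReal.ofReal_rpow_of_nonneg (norm_nonneg _) hr.le]
  simp only [h1] at h
  rw [eLpNorm_eq_lintegral_rpow_enorm_toReal h0 ENNReal.ofReal_ne_top,
    ENNReal.toReal_ofReal hr.le]
  refine (ENNReal.rpow_le_rpow h (by positivity)).trans (le_of_eq ?_)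
  rw [ENNReal.ofReal_rpow_of_nonneg (by positivity) (by positivity), ← Real.rpow_mul hε,
    mul_one_div_cancel hr.ne', Real.rpow_one]

/-- The product is a constant times `h^(s r)`; `h` is the radius at which it equals `δ`. -/
theorem exists_radius_kernel_le (hN : 1 ≤ N) (hr : 0 < r) (hs : 0 < s) {δ : ℝ} (hδ : 0 < δ) :
    ∃ h : ℝ, 0 < h ∧ (volume (Metric.ball (0 : EuclideanSpace ℝ (Fin N)) h))⁻¹ *
      ENNReal.ofReal ((2 * h) ^ ((N : ℝ) + s * r)) ≤ ENNReal.ofReal δ := by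
  have : Nonempty (Fin N) := ⟨⟨0, hN⟩⟩
  have : Nontrivial (EuclideanSpace ℝ (Fin N)) := inferInstance
  set V := (volume (Metric.ball (0 : EuclideanSpace ℝ (Fin N)) 1)).toReal with hV
  have hVpos : 0 < V := ENNReal.toReal_pos (Metric.measure_ball_pos _ _ one_pos).ne'
    measure_ball_lt_top.ne
  have hV' : volume (Metric.ball (0 : EuclideanSpace ℝ (Fin N)) 1) = ENNReal.ofReal V :=
    (ENNReal.ofReal_toReal measure_ball_lt_top.ne).symm
  have hsr : 0 < s * r := mul_pos hs hr
  set a : ℝ := δ * V / 2 ^ ((N : ℝ) + s * r) with ha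
  have hapos : 0 < a := by positivity
  set h : ℝ := a ^ (s * r)⁻¹ with hh
  have hpos : 0 < h := by positivity
  refine ⟨h, hpos, ?_⟩
  rw [Measure.addHaar_ball _ _ hpos.le, hV', finrank_euclideanSpace_fin,
    ← ENNReal.ofReal_mul (by positivity), ← ENNReal.ofReal_inv_of_pos (by positivity),
    ← ENNReal.ofReal_mul (by positivity)]
  refine ENNReal.ofReal_le_ofReal (le_of_eq ?_)
  have e : h ^ (s * r) = a := by
    rw [hh, ← Real.rpow_mul hapos.le, inv_mul_cancel₀ hsr.ne', Real.rpow_one]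
  rw [Real.mul_rpow (by norm_num) hpos.le, Real.rpow_add hpos, Real.rpow_natCast, e, ha]
  field_simp

/-- Bounded subsets of `W^{s,r}_0(Ω)` are totally bounded in `L^r`. -/
theorem totallyBounded_W0_bounded (hN : 1 ≤ N) (hΩ : Bornology.IsBounded Ω) (hΩo : IsOpen Ω)
    (hr : 1 ≤ r) (hs : 0 < s) [Fact (1 ≤ ENNReal.ofReal r)] {C : ℝ} (hC : 0 ≤ C) :
    TotallyBounded {F : Lp ℝ (ENNReal.ofReal r) (volume : Measure (EuclideanSpace ℝ (Fin N))) |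
      (F : EuclideanSpace ℝ (Fin N) → ℝ) ∈ W0 Ω s r ∧ gagliardoPow s r F ≤ C} := by
  have hr0 : 0 < r := by linarith
  obtain ⟨P, hP0, hP⟩ := exists_poincare hN hΩ s hr0 hs
  refine Metric.totallyBounded_of_finite_discretization fun ε hε => ?_
  set V := (volume Ω).toReal with hV
  have hV' : volume Ω = ENNReal.ofReal V := (ENNReal.ofReal_toReal hΩ.measure_lt_top.ne).symm
  have hV0 : 0 ≤ V := ENNReal.toReal_nonneg
  -- `δ` and `η` are calibrated so that the oscillation part and the part coming from the means are
  -- each at most `b / 2`. The summands `+ 1` only keep the denominators positive.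
  set b : ℝ := (ε / 2) ^ r with hb
  have hbpos : 0 < b := by positivity
  set δ : ℝ := b / (2 * 2 ^ r * (2 ^ r * (C + C) + 1)) with hδ
  have hδpos : 0 < δ := by positivity
  set η : ℝ := (b / (2 * 2 ^ r * (V + 1))) ^ (1 / r) with hη
  have hηpos : 0 < η := by positivity
  have hηr : η ^ r = b / (2 * 2 ^ r * (V + 1)) := by
    rw [hη, ← Real.rpow_mul (by positivity), one_div_mul_cancel hr0.ne', Real.rpow_one]
  obtain ⟨h, hh, hker⟩ := exists_radius_kernel_le hN hr0 hs hδpos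
  obtain ⟨t, htf, ht⟩ := Metric.totallyBounded_iff.1
    (hΩ.isCompact_closure.totallyBounded.subset subset_closure) h hh
  have := htf.fintype
  set m : (EuclideanSpace ℝ (Fin N) → ℝ) → EuclideanSpace ℝ (Fin N) → ℝ := fun F c =>
    ∫ y, F y ∂(ProbabilityTheory.cond volume (Metric.ball c h)) with hm
  set W := (volume (Metric.ball (0 : EuclideanSpace ℝ (Fin N)) h)).toReal with hW
  have hW0 : volume (Metric.ball (0 : EuclideanSpace ℝ (Fin N)) h) ≠ 0 :=
    (Metric.measure_ball_pos _ _ hh).ne'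
  have hWpos : 0 < W := ENNReal.toReal_pos hW0 measure_ball_lt_top.ne
  -- Uniform bound for the means over balls of radius `h`, by Jensen and Poincaré.
  set M : ℝ := (W⁻¹ * (P * C)) ^ (1 / r) with hM
  have hcondprob : ∀ c : EuclideanSpace ℝ (Fin N),
      IsProbabilityMeasure (ProbabilityTheory.cond volume (Metric.ball c h)) := fun c =>
    ProbabilityTheory.cond_isProbabilityMeasure_of_finite (Metric.measure_ball_pos _ _ hh).ne'
      measure_ball_lt_top.ne
  have hmem : ∀ F ∈ W0 Ω s r, ∀ c, MemLp F (ENNReal.ofReal r)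
      (ProbabilityTheory.cond volume (Metric.ball c h)) := fun F hF c =>
    (hF.1.restrict _).smul_measure (ENNReal.inv_ne_top.2 (Metric.measure_ball_pos _ _ hh).ne')
  have hmM : ∀ F ∈ W0 Ω s r, gagliardoPow s r F ≤ C → ∀ c, |m F c| ≤ M := by
    intro F hF hFC c
    have := hcondprob c
    have h1 : ENNReal.ofReal (|m F c| ^ r) ≤ ENNReal.ofReal (W⁻¹ * (P * C)) := by
      refine (ofReal_abs_integral_rpow_le hr (hmem F hF c).1).trans ?_
      rw [ProbabilityTheory.cond, lintegral_smul_measure, smul_eq_mul, Measure.addHaar_ball_center,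
        ENNReal.ofReal_mul (by positivity), ENNReal.ofReal_inv_of_pos hWpos, hW,
        ENNReal.ofReal_toReal measure_ball_lt_top.ne]
      refine mul_le_mul_right ((setLIntegral_le_lintegral _ _).trans ?_) _
      rw [← ENNReal.ofReal_toReal ((memLp_ofReal_iff hr0).1 hF.1).2.ne, ← integral_abs_rpow_eq hF.1.1,
        ← integral_Ω_eq hr0 hF.2.2]
      exact ENNReal.ofReal_le_ofReal ((hP F hF).trans (mul_le_mul_of_nonneg_left hFC hP0.le))
    have h2 := (ENNReal.ofReal_le_ofReal_iff (by positivity)).1 h1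
    rw [hM, ← Real.rpow_rpow_inv (abs_nonneg (m F c)) hr0.ne', ← one_div]
    exact Real.rpow_le_rpow (by positivity) h2 (by positivity)
  -- A function is encoded by its means over the covering balls, rounded to multiples of `η`.
  -- Finitely many codes occur, and functions with equal codes have means differing by less than
  -- `η`.
  refine ⟨t → Icc ⌊-M / η⌋ ⌊M / η⌋, inferInstance, fun F c => ⟨⌊m F.1 c / η⌋, ?_⟩, ?_⟩
  · have := abs_le.1 (hmM F.1 F.2.1 F.2.2 c)
    exact ⟨Int.floor_mono (by gcongr; exact this.1), Int.floor_mono (by gcongr; exact this.2)⟩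
  · rintro ⟨F, hF, hFC⟩ ⟨G, hG, hGC⟩ hFG
    have hw : ⇑F - ⇑G ∈ W0 Ω s r := sub_mem_W0 hr0 hF hG
    have hwη : ∀ c ∈ t, |m (⇑F - ⇑G) c| ≤ η := by
      intro c hc
      have := hcondprob c
      have e1 : m (⇑F - ⇑G) c = m F c - m G c :=
        integral_sub ((hmem F hF c).integrable (by simpa using hr))
          ((hmem G hG c).integrable (by simpa using hr))
      have e2 : ⌊m F c / η⌋ = ⌊m G c / η⌋ := by
        have := congrArg Subtype.val (congrFun hFG ⟨c, hc⟩)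
        exact this
      have e3 := Int.abs_sub_lt_one_of_floor_eq_floor e2
      rw [e1]
      rw [← sub_div, abs_div, abs_of_pos hηpos, div_lt_one hηpos] at e3
      exact e3.le
    have key := lintegral_rpow_le_of_average_le hr hs hΩo hw hh ht hwη
    have hgag : gagliardoLIntegral s r (⇑F - ⇑G) ≤
        ENNReal.ofReal (2 ^ r * (C + C)) := by
      refine (gagliardoLIntegral_sub_le hr0 hF.1.1).trans ?_
      rw [ENNReal.ofReal_mul (by positivity), ENNReal.ofReal_add hC hC,
        gagliardoLIntegral_eq_ofReal hF.2.1, gagliardoLIntegral_eq_ofReal hG.2.1]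
      exact mul_le_mul_right (add_le_add (ENNReal.ofReal_le_ofReal hFC)
        (ENNReal.ofReal_le_ofReal hGC)) _
    have hfin : ∫⁻ x, ENNReal.ofReal (|(⇑F - ⇑G) x| ^ r) ≤
        ENNReal.ofReal ((ε / 2) ^ r) := by
      refine key.trans ?_
      rw [← mul_assoc]
      refine (mul_le_mul_right (add_le_add (mul_le_mul' hker hgag) le_rfl) _).trans ?_
      rw [hV', ← ENNReal.ofReal_mul hδpos.le, ← ENNReal.ofReal_mul (by positivity),
        ← ENNReal.ofReal_add (by positivity) (by positivity), ← ENNReal.ofReal_mul (by positivity)]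
      refine ENNReal.ofReal_le_ofReal ?_
      rw [← hb, hηr, hδ]
      have h1 : 2 ^ r * (b / (2 * 2 ^ r * (2 ^ r * (C + C) + 1)) * (2 ^ r * (C + C))) ≤ b / 2 := by
        have : 2 ^ r * (b / (2 * 2 ^ r * (2 ^ r * (C + C) + 1)) * (2 ^ r * (C + C))) =
          b / 2 * ((2 ^ r * (C + C)) / (2 ^ r * (C + C) + 1)) := by field_simp
        rw [this]
        refine mul_le_of_le_one_right (by positivity) ((div_le_one (by positivity)).2 (by linarith))
      have h2 : 2 ^ r * (b / (2 * 2 ^ r * (V + 1)) * V) ≤ b / 2 := by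
        have : 2 ^ r * (b / (2 * 2 ^ r * (V + 1)) * V) = b / 2 * (V / (V + 1)) := by field_simp
        rw [this]
        refine mul_le_of_le_one_right (by positivity) ((div_le_one (by positivity)).2 (by linarith))
      rw [mul_add]
      linarith
    have hle := eLpNorm_le_of_lintegral_le hr0 (by positivity) hfin
    rw [Lp.dist_def]
    refine (ENNReal.toReal_mono ENNReal.ofReal_ne_top hle).trans_lt ?_
    rw [ENNReal.toReal_ofReal (by positivity)]
    linarith

/-- Compactness of the embedding of `W^{s,r}_0(Ω)` into `L^r`. -/
theorem exists_subseq_tendsto (hN : 1 ≤ N) (hΩ : Bornology.IsBounded Ω) (hΩo : IsOpen Ω)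
    (hr : 1 ≤ r) (hs : 0 < s) {f : ℕ → EuclideanSpace ℝ (Fin N) → ℝ} {C : ℝ}
    (hf : ∀ n, f n ∈ W0 Ω s r) (hC : ∀ n, gagliardoPow s r (f n) ≤ C) :
    ∃ φ : ℕ → ℕ, StrictMono φ ∧ ∃ u ∈ W0 Ω s r,
      (∀ᵐ x ∂volume, Tendsto (fun n => f (φ n) x) atTop (𝓝 (u x))) ∧
      Tendsto (fun n => eLpNorm (f (φ n) - u) (ENNReal.ofReal r) volume) atTop (𝓝 0) := by
  have hr0 : 0 < r := by linarith
  have hfact : Fact (1 ≤ ENNReal.ofReal r) := ⟨by simpa using hr⟩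
  have hC0 : 0 ≤ C := gagliardoPow_nonneg.trans (hC 0)
  have hcpt := (totallyBounded_W0_bounded hN hΩ hΩo hr hs hC0).closure.isCompact_of_isClosed
    isClosed_closure
  obtain ⟨F, -, φ, hφ, hlim⟩ := hcpt.tendsto_subseq (x := fun n => (hf n).1.toLp (f n))
    (fun n => subset_closure ⟨W0_congr (hf n).1.coeFn_toLp.symm (hf n), by
      rw [gagliardoPow, gagliardoLIntegral_congr (hf n).1.coeFn_toLp]
      exact hC n⟩)
  have hF : MemLp F (ENNReal.ofReal r) volume := Lp.memLp F
  have hLp : Tendsto (fun n => eLpNorm (f (φ n) - ⇑F) (ENNReal.ofReal r) volume) atTop (𝓝 0) := by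
    rw [← Lp.tendsto_Lp_iff_tendsto_eLpNorm'' (fun n => f (φ n)) (fun n => (hf (φ n)).1) F hF,
      Lp.toLp_coeFn]
    exact hlim
  -- A further subsequence converges almost everywhere. Fatou's lemma then puts the limit in `W0`,
  -- which the closure in `L^r` alone would not give.
  obtain ⟨ψ, hψ, hae⟩ := (tendstoInMeasure_of_tendsto_eLpNorm (by simpa using hr0)
    (fun n => (hf (φ n)).1.1) hF.1 hLp).exists_seq_tendsto_ae
  refine ⟨φ ∘ ψ, hφ.comp hψ, F, ⟨hF, ?_, ?_⟩, hae, hLp.comp hψ.tendsto_atTop⟩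
  · exact gagliardoLIntegral_lt_top_of_tendsto hr0.le (fun n => hf (φ (ψ n)))
      (fun n => hC (φ (ψ n))) hae
  · have h0 : ∀ᵐ x ∂volume, ∀ n, x ∉ Ω → f n x = 0 := ae_all_iff.2 fun n => (hf n).2.2
    filter_upwards [hae, h0] with x hx hx0 hxΩ
    refine tendsto_nhds_unique hx ?_
    simp only [hx0 _ hxΩ]
    exact tendsto_const_nhds

theorem tendsto_integral_abs_rpow {X : Type*} [MeasurableSpace X] {μ : Measure X} {f : ℕ → X → ℝ}
    {g : X → ℝ} (hr : 1 ≤ r) (hf : ∀ n, MemLp (f n) (ENNReal.ofReal r) μ)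
    (hg : MemLp g (ENNReal.ofReal r) μ)
    (h : Tendsto (fun n => eLpNorm (f n - g) (ENNReal.ofReal r) μ) atTop (𝓝 0)) :
    Tendsto (fun n => ∫ x, |f n x| ^ r ∂μ) atTop (𝓝 (∫ x, |g x| ^ r ∂μ)) := by
  have hr0 : 0 < r := by linarith
  have hfact : Fact (1 ≤ ENNReal.ofReal r) := ⟨by simpa using hr⟩
  have key : ∀ F : X → ℝ, ∀ hF : MemLp F (ENNReal.ofReal r) μ,
      ∫ x, |F x| ^ r ∂μ = ‖hF.toLp F‖ ^ r := by
    intro F hF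
    have hi : 0 ≤ ∫ x, ‖F x‖ ^ r ∂μ := integral_nonneg fun x => by positivity
    rw [Lp.norm_toLp, hF.eLpNorm_eq_integral_rpow_norm (by simpa using hr0) ENNReal.ofReal_ne_top,
      ENNReal.toReal_ofReal hr0.le, ENNReal.toReal_ofReal (Real.rpow_nonneg hi _),
      Real.rpow_inv_rpow hi hr0.ne']
    simp only [Real.norm_eq_abs]
  have h1 := (Lp.tendsto_Lp_iff_tendsto_eLpNorm'' f hf g hg).2 h
  rw [key g hg]
  simp only [fun n => key (f n) (hf n)]
  exact h1.norm.rpow_const (Or.inr hr0.le)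

theorem tendsto_setIntegral_abs_rpow {f : ℕ → EuclideanSpace ℝ (Fin N) → ℝ}
    (hΩ : Bornology.IsBounded Ω) {q : ℝ} (hq : 1 ≤ q) (hqr : q ≤ r)
    (hf : ∀ n, MemLp (f n) (ENNReal.ofReal r) volume) (hu : MemLp u (ENNReal.ofReal r) volume)
    (h : Tendsto (fun n => eLpNorm (f n - u) (ENNReal.ofReal r) volume) atTop (𝓝 0)) :
    Tendsto (fun n => ∫ x in Ω, |f n x| ^ q) atTop (𝓝 (∫ x in Ω, |u x| ^ q)) := by
  have : IsFiniteMeasure (volume.restrict Ω) := ⟨by simpa using hΩ.measure_lt_top⟩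
  have hqr' := ENNReal.ofReal_le_ofReal hqr
  refine tendsto_integral_abs_rpow hq (fun n => ((hf n).restrict Ω).mono_exponent hqr')
    ((hu.restrict Ω).mono_exponent hqr') ?_
  set c := (volume.restrict Ω) univ ^
    (1 / (ENNReal.ofReal q).toReal - 1 / (ENNReal.ofReal r).toReal) with hc
  have hct : c ≠ ⊤ := by
    refine ENNReal.rpow_ne_top_of_nonneg ?_ (measure_ne_top _ _)
    rw [ENNReal.toReal_ofReal (by linarith), ENNReal.toReal_ofReal (by linarith)]
    exact sub_nonneg.2 (one_div_le_one_div_of_le (by linarith) hqr)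
  have h2 : Tendsto (fun n => eLpNorm (f n - u) (ENNReal.ofReal r) volume * c) atTop (𝓝 0) := by
    simpa using ENNReal.Tendsto.mul_const h (Or.inr hct)
  refine tendsto_of_tendsto_of_tendsto_of_le_of_le tendsto_const_nhds h2 (fun n => zero_le)
    fun n => ?_
  refine (eLpNorm_le_eLpNorm_mul_rpow_measure_univ hqr'
    (((hf n).sub hu).1.restrict)).trans ?_
  exact mul_le_mul_left (eLpNorm_mono_measure _ Measure.restrict_le_self) _

end Compactness

/-! ### Bi-Lipschitz changes of variables and mollification -/

section Transformations

open Filter Topology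

variable {N : ℕ} {Ω : Set (EuclideanSpace ℝ (Fin N))} {s r : ℝ}
  {u v w : EuclideanSpace ℝ (Fin N) → ℝ}

/-- Volume is a normalized `N`-dimensional Hausdorff measure, and Hausdorff measure scales directly
under (anti-)Lipschitz maps; no Jacobian is involved. -/
theorem AntilipschitzWith.volume_preimage_le {A : NNReal}
    {S : EuclideanSpace ℝ (Fin N) → EuclideanSpace ℝ (Fin N)} (hS : AntilipschitzWith A S)
    (t : Set (EuclideanSpace ℝ (Fin N))) :
    volume (S ⁻¹' t) ≤ (A : ENNReal) ^ (N : ℝ) * volume t := by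
  rw [← EuclideanSpace.euclideanHausdorffMeasure_eq_volume, Measure.euclideanHausdorffMeasure_def,
    Measure.smul_apply, Measure.smul_apply, ENNReal.smul_def, ENNReal.smul_def, smul_eq_mul,
    smul_eq_mul, mul_left_comm]
  exact mul_le_mul_right (hS.hausdorffMeasure_preimage_le (by positivity) t) _

theorem LipschitzWith.volume_image_le {L : NNReal}
    {S : EuclideanSpace ℝ (Fin N) → EuclideanSpace ℝ (Fin N)} (hS : LipschitzWith L S)
    (t : Set (EuclideanSpace ℝ (Fin N))) :
    volume (S '' t) ≤ (L : ENNReal) ^ (N : ℝ) * volume t := by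
  rw [← EuclideanSpace.euclideanHausdorffMeasure_eq_volume, Measure.euclideanHausdorffMeasure_def,
    Measure.smul_apply, Measure.smul_apply, ENNReal.smul_def, ENNReal.smul_def, smul_eq_mul,
    smul_eq_mul, mul_left_comm]
  exact mul_le_mul_right (hS.hausdorffMeasure_image_le (by positivity) t) _

theorem lintegral_comp_le_of_antilipschitz {A : NNReal}
    {S : EuclideanSpace ℝ (Fin N) → EuclideanSpace ℝ (Fin N)} (hS : AntilipschitzWith A S)
    (hSm : Measurable S) {F : EuclideanSpace ℝ (Fin N) → ENNReal} (hF : Measurable F) :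
    ∫⁻ x, F (S x) ≤ (A : ENNReal) ^ (N : ℝ) * ∫⁻ x, F x := by
  rw [← lintegral_map hF hSm, ← lintegral_const_mul _ hF, lintegral_const_mul _ hF,
    ← smul_eq_mul, ← lintegral_smul_measure]
  refine lintegral_mono' (Measure.le_iff.2 fun t ht => ?_) le_rfl
  rw [Measure.map_apply hSm ht, Measure.smul_apply, smul_eq_mul]
  exact hS.volume_preimage_le t

/-- Surjectivity makes every set the image of its preimage, so volume is at most `L^N` times its
push-forward under `S`. -/
theorem lintegral_le_comp_of_lipschitz {L : NNReal}
    {S : EuclideanSpace ℝ (Fin N) → EuclideanSpace ℝ (Fin N)} (hS : LipschitzWith L S)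
    (hSs : Function.Surjective S) {F : EuclideanSpace ℝ (Fin N) → ENNReal} (hF : Measurable F) :
    ∫⁻ x, F x ≤ (L : ENNReal) ^ (N : ℝ) * ∫⁻ x, F (S x) := by
  have hSm := hS.continuous.measurable
  rw [← lintegral_map hF hSm, ← smul_eq_mul, ← lintegral_smul_measure]
  refine lintegral_mono' (Measure.le_iff.2 fun t ht => ?_) le_rfl
  rw [Measure.smul_apply, Measure.map_apply hSm ht, smul_eq_mul]
  calc volume t = volume (S '' (S ⁻¹' t)) := by rw [image_preimage_eq t hSs]
    _ ≤ _ := hS.volume_image_le _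

/-- The Gagliardo integral under a bi-Lipschitz change of variables. -/
theorem gagliardoLIntegral_comp_le {A L : NNReal} (hr : 0 < r) (hs : 0 < s)
    {S : EuclideanSpace ℝ (Fin N) → EuclideanSpace ℝ (Fin N)} (hA : AntilipschitzWith A S)
    (hL : LipschitzWith L S) (hw : Measurable w) :
    gagliardoLIntegral s r (w ∘ S) ≤ ENNReal.ofReal ((L : ℝ) ^ ((N : ℝ) + s * r)) *
      ((A : ENNReal) ^ (N : ℝ) * ((A : ENNReal) ^ (N : ℝ) * gagliardoLIntegral s r w)) := by
  have hSm := hL.continuous.measurable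
  have hF : Measurable fun z : EuclideanSpace ℝ (Fin N) × EuclideanSpace ℝ (Fin N) =>
      ENNReal.ofReal (|pairDiff w z| ^ r * gagKernel N s r z) := by
    have : Measurable (pairDiff w) := (hw.comp measurable_fst).sub (hw.comp measurable_snd)
    exact ((this.abs.pow_const r).mul measurable_gagKernel).ennreal_ofReal
  have hwS : Measurable (w ∘ S) := hw.comp hSm
  rw [← lintegral_lintegral_gagKernel hwS.aestronglyMeasurable,
    ← lintegral_lintegral_gagKernel hw.aestronglyMeasurable]
  -- From `|S x - S y| ≤ L |x - y|` the kernel grows by at most `L^(N + s r)` when moved to `(S x, S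
  -- y)`. Each of the two changes of variables afterwards costs a factor `A^N`.
  have hpt : ∀ x y, ENNReal.ofReal (|pairDiff (w ∘ S) (x, y)| ^ r * gagKernel N s r (x, y)) ≤
      ENNReal.ofReal ((L : ℝ) ^ ((N : ℝ) + s * r)) *
        ENNReal.ofReal (|pairDiff w (S x, S y)| ^ r * gagKernel N s r (S x, S y)) := by
    intro x y
    rw [← ENNReal.ofReal_mul (by positivity), mul_left_comm]
    refine ENNReal.ofReal_le_ofReal (mul_le_mul_of_nonneg_left ?_ (by positivity))
    rcases eq_or_ne x y with rfl | hxy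
    · simp only [gagKernel, sub_self, norm_zero]
      rw [Real.zero_rpow (by positivity)]
      simp
    · have h1 : 0 < ‖x - y‖ := norm_pos_iff.2 (sub_ne_zero.2 hxy)
      have h2 : 0 < ‖S x - S y‖ := norm_pos_iff.2 (sub_ne_zero.2 (hA.injective.ne hxy))
      have h3 : ‖S x - S y‖ ≤ L * ‖x - y‖ := by
        simpa [dist_eq_norm] using hL.dist_le_mul x y
      simp only [gagKernel]
      rw [← div_eq_mul_inv, le_div_iff₀ (by positivity), inv_mul_le_iff₀ (by positivity),
        ← Real.mul_rpow h1.le (by positivity)]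
      exact Real.rpow_le_rpow h2.le (h3.trans (mul_comm _ _).le) (by positivity)
  calc _ ≤ ∫⁻ x, ENNReal.ofReal ((L : ℝ) ^ ((N : ℝ) + s * r)) * ∫⁻ y,
        ENNReal.ofReal (|pairDiff w (S x, S y)| ^ r * gagKernel N s r (S x, S y)) := by
        refine lintegral_mono fun x => ?_
        rw [← lintegral_const_mul' _ _ ENNReal.ofReal_ne_top]
        exact lintegral_mono fun y => hpt x y
    _ = ENNReal.ofReal ((L : ℝ) ^ ((N : ℝ) + s * r)) * ∫⁻ x, ∫⁻ y,
        ENNReal.ofReal (|pairDiff w (S x, S y)| ^ r * gagKernel N s r (S x, S y)) :=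
        lintegral_const_mul' _ _ ENNReal.ofReal_ne_top
    _ ≤ _ := by
        refine mul_le_mul_right ?_ _
        have hI : Measurable fun x => ∫⁻ y,
            ENNReal.ofReal (|pairDiff w (x, S y)| ^ r * gagKernel N s r (x, S y)) :=
          Measurable.lintegral_prod_right (hF.comp (measurable_id.prodMap hSm))
        refine (lintegral_comp_le_of_antilipschitz hA hSm hI).trans (mul_le_mul_right ?_ _)
        rw [← lintegral_const_mul _ (Measurable.lintegral_prod_right hF)]
        exact lintegral_mono fun x =>
          lintegral_comp_le_of_antilipschitz hA hSm (hF.comp measurable_prodMk_left)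

theorem lintegral_gagKernel_comp_sub (hu : Measurable u) (z : EuclideanSpace ℝ (Fin N)) :
    ∫⁻ p : EuclideanSpace ℝ (Fin N) × EuclideanSpace ℝ (Fin N),
      ENNReal.ofReal (|u (p.1 - z) - u (p.2 - z)| ^ r * gagKernel N s r p) =
      gagliardoLIntegral s r u := by
  have hF : Measurable fun p : EuclideanSpace ℝ (Fin N) × EuclideanSpace ℝ (Fin N) =>
      ENNReal.ofReal (|pairDiff u p| ^ r * gagKernel N s r p) := by
    have : Measurable (pairDiff u) := (hu.comp measurable_fst).sub (hu.comp measurable_snd)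
    exact ((this.abs.pow_const r).mul measurable_gagKernel).ennreal_ofReal
  rw [← lintegral_ofReal_mul_gagKernel]
  rw [Measure.volume_eq_prod]
  have h := lintegral_sub_right_eq_self (μ := (volume : Measure (EuclideanSpace ℝ (Fin N))).prod
    (volume : Measure (EuclideanSpace ℝ (Fin N)))) (fun p => ENNReal.ofReal (|pairDiff u p| ^ r * gagKernel N s r p))
    (z, z)
  rw [← h]
  congr 1 with p
  simp [gagKernel, pairDiff]

/-- Averaging over translations does not increase the Gagliardo integral. -/
theorem gagliardoLIntegral_average_le (hr : 1 ≤ r) (hu : Measurable u)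
    (π : Measure (EuclideanSpace ℝ (Fin N))) [IsProbabilityMeasure π]
    (hint : ∀ x, Integrable (fun z => u (x - z)) π) :
    gagliardoLIntegral s r (fun x => ∫ z, u (x - z) ∂π) ≤ gagliardoLIntegral s r u := by
  rw [← lintegral_ofReal_mul_gagKernel]
  -- Jensen in `z` for each pair of points, then Tonelli, then invariance of the Gagliardo integral
  -- under translating both points by `z`.
  calc _ ≤ ∫⁻ p : EuclideanSpace ℝ (Fin N) × EuclideanSpace ℝ (Fin N), ∫⁻ z,
        ENNReal.ofReal (|u (p.1 - z) - u (p.2 - z)| ^ r * gagKernel N s r p) ∂π := by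
        refine lintegral_mono fun p => ?_
        simp only [ENNReal.ofReal_mul' (gagKernel_nonneg p)]
        rw [lintegral_mul_const' _ _ ENNReal.ofReal_ne_top]
        refine mul_le_mul_left ?_ _
        rw [pairDiff, ← integral_sub (hint _) (hint _)]
        exact ofReal_abs_integral_rpow_le hr ((hint _).sub (hint _)).aestronglyMeasurable
    _ = ∫⁻ z, (∫⁻ p : EuclideanSpace ℝ (Fin N) × EuclideanSpace ℝ (Fin N),
        ENNReal.ofReal (|u (p.1 - z) - u (p.2 - z)| ^ r * gagKernel N s r p)) ∂π := by
        refine lintegral_lintegral_swap (Measurable.aemeasurable ?_)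
        have h1 : Measurable fun a : (EuclideanSpace ℝ (Fin N) × EuclideanSpace ℝ (Fin N)) ×
            EuclideanSpace ℝ (Fin N) => u (a.1.1 - a.2) := hu.comp (by fun_prop)
        have h2 : Measurable fun a : (EuclideanSpace ℝ (Fin N) × EuclideanSpace ℝ (Fin N)) ×
            EuclideanSpace ℝ (Fin N) => u (a.1.2 - a.2) := hu.comp (by fun_prop)
        exact (((h1.sub h2).abs.pow_const r).mul
          (measurable_gagKernel.comp measurable_fst)).ennreal_ofReal
    _ = gagliardoLIntegral s r u := by
        simp only [lintegral_gagKernel_comp_sub hu]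
        simp

/-- The density of the normed bump as a probability measure. -/
theorem isProbabilityMeasure_withDensity_normed
    (φ : ContDiffBump (0 : EuclideanSpace ℝ (Fin N))) :
    IsProbabilityMeasure (volume.withDensity fun z => ENNReal.ofReal (φ.normed volume z)) := by
  refine ⟨?_⟩
  rw [withDensity_apply _ MeasurableSet.univ, Measure.restrict_univ,
    ← ofReal_integral_eq_lintegral_ofReal φ.integrable_normed (.of_forall φ.nonneg_normed),
    φ.integral_normed, ENNReal.ofReal_one]

theorem convolution_normed_eq (φ : ContDiffBump (0 : EuclideanSpace ℝ (Fin N)))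
    (x : EuclideanSpace ℝ (Fin N)) :
    convolution (φ.normed volume) u (ContinuousLinearMap.lsmul ℝ ℝ) volume x =
      ∫ z, u (x - z) ∂(volume.withDensity fun z => ENNReal.ofReal (φ.normed volume z)) := by
  rw [convolution_lsmul, integral_withDensity_eq_integral_toReal_smul
    (φ.continuous_normed.measurable.ennreal_ofReal) (.of_forall fun _ => ENNReal.ofReal_lt_top)]
  simp only [ENNReal.toReal_ofReal (φ.nonneg_normed _)]

theorem gagliardoLIntegral_convolution_le (hr : 1 ≤ r) (hu : Measurable u)
    (hui : Integrable u volume) (φ : ContDiffBump (0 : EuclideanSpace ℝ (Fin N))) :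
    gagliardoLIntegral s r (convolution (φ.normed volume) u (ContinuousLinearMap.lsmul ℝ ℝ) volume) ≤
      gagliardoLIntegral s r u := by
  have := isProbabilityMeasure_withDensity_normed φ
  rw [show convolution (φ.normed volume) u (ContinuousLinearMap.lsmul ℝ ℝ) volume = fun x =>
    ∫ z, u (x - z) ∂(volume.withDensity fun z => ENNReal.ofReal (φ.normed volume z)) from
    funext fun x => convolution_normed_eq φ x]
  refine gagliardoLIntegral_average_le hr hu _ fun x => ?_
  rw [integrable_withDensity_iff_integrable_smul' φ.continuous_normed.measurable.ennreal_ofReal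
    (.of_forall fun _ => ENNReal.ofReal_lt_top)]
  simp only [ENNReal.toReal_ofReal (φ.nonneg_normed _)]
  obtain ⟨M, hM⟩ := φ.continuous_normed.bounded_above_of_compact_support
    (φ.hasCompactSupport_normed (μ := volume))
  exact (hui.comp_sub_left x).bdd_mul φ.continuous_normed.aestronglyMeasurable (.of_forall hM)

/-- Increments fall on the smooth, compactly supported bump, so its Lipschitz constant times the
`L¹` norm of `u` works. -/
theorem exists_lipschitzWith_convolution (hui : Integrable u volume)
    (φ : ContDiffBump (0 : EuclideanSpace ℝ (Fin N))) :
    ∃ K, LipschitzWith K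
      (convolution (φ.normed volume) u (ContinuousLinearMap.lsmul ℝ ℝ) volume) := by
  obtain ⟨C, hC⟩ := (φ.contDiff_normed (μ := volume) (n := 1)).lipschitzWith_of_hasCompactSupport
    φ.hasCompactSupport_normed (by simp)
  obtain ⟨M, hM⟩ := φ.continuous_normed.bounded_above_of_compact_support
    (φ.hasCompactSupport_normed (μ := volume))
  refine ⟨C * (∫ t, ‖u t‖).toNNReal, LipschitzWith.of_dist_le_mul fun x y => ?_⟩
  have hi : ∀ x, Integrable (fun t => φ.normed volume (x - t) • u t) volume := fun x =>
    hui.bdd_mul (φ.continuous_normed.comp (continuous_sub_left x)).aestronglyMeasurable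
      (.of_forall fun t => hM _)
  rw [dist_eq_norm, convolution_lsmul_swap, convolution_lsmul_swap, ← integral_sub (hi x) (hi y)]
  have hI : 0 ≤ ∫ t, ‖u t‖ := integral_nonneg fun t => norm_nonneg _
  rw [NNReal.coe_mul, Real.coe_toNNReal _ hI, mul_right_comm, ← integral_const_mul]
  refine norm_integral_le_of_norm_le (hui.norm.const_mul _) (.of_forall fun t => ?_)
  rw [← sub_smul, norm_smul]
  refine mul_le_mul_of_nonneg_right ?_ (norm_nonneg _)
  have := hC.dist_le_mul (x - t) (y - t)
  rwa [dist_eq_norm, dist_sub_right] at this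

end Transformations

/-! ### An inward vector field for a Lipschitz domain -/

section LipschitzBoundary

open Filter Topology

variable {N : ℕ} {Ω : Set (EuclideanSpace ℝ (Fin N))}

/-- In a boundary chart, moving a point outside `Ω` in the direction `-e`, up to a small error,
keeps it outside `Ω`. -/
theorem sub_smul_sub_notMem {z e : EuclideanSpace ℝ (Fin N)} {ρ : ℝ} {K : NNReal}
    {g : EuclideanSpace ℝ (Fin N) → ℝ} (he : ‖e‖ = 1) (hg : LipschitzWith K g)
    (hΩ : ∀ x ∈ Metric.ball z ρ, x ∈ Ω ↔ g (x - inner ℝ e x • e) < inner ℝ e x)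
    {y w : EuclideanSpace ℝ (Fin N)} {t : ℝ} (hy : y ∉ Ω) (hyb : y ∈ Metric.ball z ρ)
    (hyb' : y - t • e - w ∈ Metric.ball z ρ) (hw : ‖w‖ * (1 + 2 * K) ≤ t) :
    y - t • e - w ∉ Ω := by
  rw [hΩ _ hyb, not_lt] at hy
  rw [hΩ _ hyb', not_lt]
  set a := inner ℝ e w with ha
  have hee : inner ℝ e e = (1 : ℝ) := by rw [real_inner_self_eq_norm_sq, he]; norm_num
  have h1 : inner ℝ e (y - t • e - w) = inner ℝ e y - t - a := by
    rw [inner_sub_right, inner_sub_right, inner_smul_right, hee, mul_one]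
  have hab : |a| ≤ ‖w‖ := by simpa [he] using abs_real_inner_le_norm e w
  have h2 := hg.dist_le_mul (y - t • e - w - inner ℝ e (y - t • e - w) • e) (y - inner ℝ e y • e)
  -- Moving along `e` does not change the horizontal part, so only `w` does, by at most `2‖w‖`, and
  -- `g` changes by at most `2K‖w‖`. The height falls by at least `t - ‖w‖`, which `hw` makes at
  -- least as large.
  have h3 : dist (y - t • e - w - inner ℝ e (y - t • e - w) • e) (y - inner ℝ e y • e) ≤
      2 * ‖w‖ := by
    rw [dist_eq_norm, h1, show y - t • e - w - (inner ℝ e y - t - a) • e - (y - inner ℝ e y • e) =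
      a • e - w by module]
    refine (norm_sub_le _ _).trans ?_
    rw [norm_smul, he, Real.norm_eq_abs]
    linarith
  have h4 : (K : ℝ) * dist (y - t • e - w - inner ℝ e (y - t • e - w) • e) (y - inner ℝ e y • e) ≤
      K * (2 * ‖w‖) := mul_le_mul_of_nonneg_left h3 K.2
  rw [Real.dist_eq] at h2
  have h5 := (abs_le.1 (h2.trans h4)).1
  have h6 := abs_le.1 hab
  rw [h1] at h5 ⊢
  linarith

theorem exists_pos_le_finset {ι : Type*} (T : Finset ι) {f : ι → ℝ} (hf : ∀ i ∈ T, 0 < f i) :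
    ∃ c, 0 < c ∧ ∀ i ∈ T, c ≤ f i := by
  classical
  induction T using Finset.induction_on with
  | empty => exact ⟨1, one_pos, by simp⟩
  | insert a T _ ih =>
    obtain ⟨c, hc, h⟩ := ih fun i hi => hf i (Finset.mem_insert_of_mem hi)
    refine ⟨min c (f a), lt_min hc (hf a (Finset.mem_insert_self _ _)), fun i hi => ?_⟩
    rcases Finset.mem_insert.1 hi with rfl | hi
    · exact min_le_right _ _
    · exact (min_le_left _ _).trans (h i hi)

/-- A bounded open set with Lipschitz boundary admits a Lipschitz vector field pointing uniformly
inwards along the boundary. -/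
theorem exists_inward_field (hΩo : IsOpen Ω) (hΩ : Bornology.IsBounded Ω)
    (hlip : HasLipschitzBoundary Ω) :
    ∃ (V : EuclideanSpace ℝ (Fin N) → EuclideanSpace ℝ (Fin N)) (K : NNReal) (ε₀ : ℝ),
      LipschitzWith K V ∧ 0 < ε₀ ∧ ∀ ε, 0 < ε → ε < ε₀ → ∃ δ, 0 < δ ∧
        ∀ x, x ∉ Ω → ∀ z, ‖z‖ ≤ δ → x - ε • V x - z ∉ Ω := by
  classical
  choose! ρ e L g hρ he hg hchart using hlip
  have hfc : IsCompact (frontier Ω) :=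
    hΩ.isCompact_closure.of_isClosed_subset isClosed_frontier frontier_subset_closure
  obtain ⟨T, hTf, hT⟩ := hfc.elim_nhds_subcover (fun z => Metric.ball z (ρ z / 4))
    fun z hz => Metric.ball_mem_nhds z (by linarith [hρ z hz])
  have hρT : ∀ z ∈ T, 0 < ρ z := fun z hz => hρ z (hTf z hz)
  -- Points outside `Ω` are either in a quarter-size chart ball or in `F`. The latter is at positive
  -- distance from the compact closure of `Ω`, so small displacements cannot carry it into `Ω`.
  set F : Set (EuclideanSpace ℝ (Fin N)) :=
    ((⋃ z ∈ T, Metric.ball z (ρ z / 4)) ∪ Ω)ᶜ with hF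
  have hFc : IsClosed F :=
    ((isOpen_biUnion fun z _ => Metric.isOpen_ball).union hΩo).isClosed_compl
  have hdisj : Disjoint (closure Ω) F := by
    rw [hF, disjoint_compl_right_iff_subset, closure_eq_self_union_frontier, union_comm]
    exact union_subset_union_left _ hT
  obtain ⟨η, hη, hηd⟩ := hdisj.exists_thickenings hΩ.isCompact_closure hFc
  obtain ⟨c₁, hc₁, hc₁T⟩ := exists_pos_le_finset T (f := fun z => ρ z / 2)
    fun z hz => by linarith [hρT z hz]
  obtain ⟨c₂, hc₂, hc₂T⟩ := exists_pos_le_finset T (f := fun z => ρ z / 4 / (1 + 2 * L z))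
    fun z hz => div_pos (by linarith [hρT z hz]) (by positivity)
  -- A displacement below `κ` neither reaches `Ω` from `F` nor leaves the chart of a point in a
  -- half-size ball.
  set κ := min η c₁ with hκ
  have hκpos : 0 < κ := lt_min hη hc₁
  set φ : EuclideanSpace ℝ (Fin N) → EuclideanSpace ℝ (Fin N) → ℝ :=
    fun z x => max 0 (ρ z / 2 - dist x z) with hφ
  have hφ0 : ∀ z x, 0 ≤ φ z x := fun z x => le_max_left _ _
  have hφle : ∀ z ∈ T, ∀ x, φ z x ≤ ρ z / 2 := fun z hz x =>
    max_le (by linarith [hρT z hz]) (by linarith [dist_nonneg (x := x) (y := z)])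
  have hφlip : ∀ z x y, |φ z x - φ z y| ≤ dist x y := by
    intro z x y
    have h := abs_max_sub_max_le_abs (ρ z / 2 - dist x z) (ρ z / 2 - dist y z) 0
    rw [sub_sub_sub_cancel_left] at h
    simp only [hφ, max_comm (0 : ℝ)]
    exact h.trans ((abs_dist_sub_le y x z).trans (dist_comm y x).le)
  set A := ∑ z ∈ T, ρ z / 2 with hA
  have hA0 : 0 ≤ A := Finset.sum_nonneg fun z hz => by linarith [hρT z hz]
  -- The field combines the chart directions with tent weights. `A` bounds its norm, so the range of
  -- `ε` makes `ε V` shorter than `κ / 2`.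
  refine ⟨fun x => ∑ z ∈ T, φ z x • e z, T.card, κ / (2 * (A + 1)), ?_, by positivity,
    fun ε hε hεle => ?_⟩
  · refine LipschitzWith.of_dist_le_mul fun x y => ?_
    rw [dist_eq_norm, ← Finset.sum_sub_distrib]
    refine (norm_sum_le _ _).trans ?_
    have : ∀ z ∈ T, ‖φ z x • e z - φ z y • e z‖ ≤ dist x y := by
      intro z hz
      rw [← sub_smul, norm_smul, he z (hTf z hz), mul_one]
      exact hφlip z x y
    refine (Finset.sum_le_sum this).trans ?_
    simp
  have hεA : ε * A < κ / 2 := by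
    rw [lt_div_iff₀ (by positivity)] at hεle
    nlinarith
  refine ⟨min (ε * c₂) (κ / 2), by positivity, fun x hx z hz => ?_⟩
  have hz1 : ‖z‖ ≤ ε * c₂ := hz.trans (min_le_left _ _)
  have hz2 : ‖z‖ ≤ κ / 2 := hz.trans (min_le_right _ _)
  have hmove : ∀ S ⊆ T, ‖∑ i ∈ S, (ε * φ i x) • e i‖ ≤ ε * A := by
    intro S hS
    rw [hA, Finset.mul_sum]
    refine (norm_sum_le _ _).trans ((Finset.sum_le_sum fun i hi => ?_).trans
      (Finset.sum_le_sum_of_subset_of_nonneg hS fun i hi _ =>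
        mul_nonneg hε.le (by linarith [hρT i hi])))
    rw [norm_smul, he i (hTf i (hS hi)), mul_one, Real.norm_of_nonneg (mul_nonneg hε.le (hφ0 i x))]
    exact mul_le_mul_of_nonneg_left (hφle i (hS hi) x) hε.le
  have hnear : ∀ S ⊆ T, dist (x - ∑ i ∈ S, (ε * φ i x) • e i - z) x < κ := by
    intro S hS
    rw [dist_eq_norm, show x - ∑ i ∈ S, (ε * φ i x) • e i - z - x =
      -(∑ i ∈ S, (ε * φ i x) • e i + z) by abel, norm_neg]
    exact (norm_add_le _ _).trans_lt (by linarith [hmove S hS])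
  rw [Finset.smul_sum]
  simp only [smul_smul]
  by_cases hxF : x ∈ F
  · intro hmem
    refine Set.disjoint_left.1 hηd
      (Metric.self_subset_thickening hη _ (subset_closure hmem))
      (Metric.mem_thickening_iff.2 ⟨x, hxF, ?_⟩)
    exact (hnear T subset_rfl).trans_le (min_le_left _ _)
  · have hx' : x ∈ ⋃ z ∈ T, Metric.ball z (ρ z / 4) := by
      by_contra h
      exact hxF fun h' => h'.elim h hx
    obtain ⟨z₀, hz₀, hxz₀⟩ := mem_iUnion₂.1 hx'
    rw [Metric.mem_ball] at hxz₀
    have hclose : ∀ S ⊆ T, ∀ i ∈ T, dist x i < ρ i / 2 →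
        x - ∑ j ∈ S, (ε * φ j x) • e j - z ∈ Metric.ball i (ρ i) := by
      intro S hS i hi hxi
      rw [Metric.mem_ball]
      refine (dist_triangle _ x _).trans_lt ?_
      have h1 := hnear S hS
      have h2 : c₁ ≤ ρ i / 2 := hc₁T i hi
      have h3 : κ ≤ c₁ := min_le_right _ _
      linarith
    -- The perturbation `z` is absorbed entirely in the chart at `z₀`: there `φ z₀ x ≥ ρ z₀ / 4`,
    -- and `c₂` was chosen for exactly this comparison.
    have hstart : x - (ε * φ z₀ x) • e z₀ - z ∉ Ω := by
      have hxb : dist x z₀ < ρ z₀ / 2 := by linarith [hρT z₀ hz₀]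
      have hb : x - (ε * φ z₀ x) • e z₀ - z ∈ Metric.ball z₀ (ρ z₀) := by
        have := hclose {z₀} (by simpa using hz₀) z₀ hz₀ hxb
        simpa using this
      refine sub_smul_sub_notMem (he z₀ (hTf z₀ hz₀)) (hg z₀ (hTf z₀ hz₀))
        (hchart z₀ (hTf z₀ hz₀)) hx ?_ hb ?_
      · rw [Metric.mem_ball]
        linarith [hρT z₀ hz₀]
      · have h1 := hc₂T z₀ hz₀
        rw [le_div_iff₀ (by positivity)] at h1
        have h2 : ρ z₀ / 4 ≤ φ z₀ x := le_max_of_le_right (by linarith)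
        calc ‖z‖ * (1 + 2 * L z₀) ≤ ε * c₂ * (1 + 2 * L z₀) :=
              mul_le_mul_of_nonneg_right hz1 (by positivity)
          _ = ε * (c₂ * (1 + 2 * L z₀)) := by ring
          _ ≤ ε * φ z₀ x := mul_le_mul_of_nonneg_left (h1.trans h2) hε.le
    -- The other directions are added one at a time with no further error. A nonzero weight places
    -- `x` in the half-size ball, so both positions lie in that chart.
    have hind : ∀ S : Finset (EuclideanSpace ℝ (Fin N)), S ⊆ T.erase z₀ →
        x - ∑ i ∈ insert z₀ S, (ε * φ i x) • e i - z ∉ Ω := by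
      intro S
      induction S using Finset.induction_on with
      | empty => intro _; simpa using hstart
      | insert a S haS ih =>
        intro hS
        have hS' : S ⊆ T.erase z₀ := (Finset.subset_insert _ _).trans hS
        have haT : a ∈ T.erase z₀ := hS (Finset.mem_insert_self _ _)
        have haz : a ≠ z₀ := Finset.ne_of_mem_erase haT
        have haT' : a ∈ T := Finset.mem_of_mem_erase haT
        have hins : insert z₀ S ⊆ T :=
          Finset.insert_subset hz₀ (hS'.trans (Finset.erase_subset _ _))
        have hins' : insert a (insert z₀ S) ⊆ T := Finset.insert_subset haT' hins
        have hnot : a ∉ insert z₀ S := by simp [haz, haS]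
        have heq : x - ∑ i ∈ insert z₀ (insert a S), (ε * φ i x) • e i - z =
            (x - ∑ i ∈ insert z₀ S, (ε * φ i x) • e i - z) - (ε * φ a x) • e a - 0 := by
          rw [Finset.insert_comm, Finset.sum_insert hnot]
          abel
        rcases (hφ0 a x).eq_or_lt' with h0 | hpos
        · rw [heq, h0]
          simpa using ih hS'
        · have hxa : dist x a < ρ a / 2 := by
            by_contra hcon
            exact hpos.ne' (max_eq_left (by linarith))
          have hb := hclose _ hins' a haT' hxa
          rw [Finset.insert_comm, heq] at hb
          rw [heq]
          refine sub_smul_sub_notMem (he a (hTf a haT')) (hg a (hTf a haT'))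
            (hchart a (hTf a haT')) (ih hS') (hclose _ hins a haT' hxa) hb ?_
          rw [norm_zero, zero_mul]
          positivity
    have := hind (T.erase z₀) subset_rfl
    rwa [Finset.insert_erase hz₀] at this

end LipschitzBoundary

/-! ### Lipschitz competitors for the Rayleigh quotient -/

section Density

open Filter Topology

variable {N : ℕ} {Ω : Set (EuclideanSpace ℝ (Fin N))} {s q : ℝ}
  {u v w : EuclideanSpace ℝ (Fin N) → ℝ}

theorem sub_smul_biLipschitz {V : EuclideanSpace ℝ (Fin N) → EuclideanSpace ℝ (Fin N)}
    {K : NNReal} (hV : LipschitzWith K V) {ε : ℝ} (hε : 0 ≤ ε) (hεK : ε * K < 1) :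
    LipschitzWith (1 + ε * K).toNNReal (fun x => x - ε • V x) ∧
      AntilipschitzWith ((1 - ε * K)⁻¹).toNNReal (fun x => x - ε • V x) ∧
      Function.Surjective fun x => x - ε • V x := by
  have hεV : ∀ x y, ‖ε • V x - ε • V y‖ ≤ ε * K * dist x y := by
    intro x y
    rw [← smul_sub, norm_smul, Real.norm_of_nonneg hε, mul_assoc, ← dist_eq_norm]
    exact mul_le_mul_of_nonneg_left (hV.dist_le_mul x y) hε
  have hεK0 : 0 ≤ ε * K := mul_nonneg hε K.2
  refine ⟨LipschitzWith.of_dist_le_mul fun x y => ?_,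
    AntilipschitzWith.of_le_mul_dist fun x y => ?_, fun y => ?_⟩
  · rw [Real.coe_toNNReal _ (by positivity), dist_eq_norm,
      show x - ε • V x - (y - ε • V y) = (x - y) - (ε • V x - ε • V y) by abel]
    refine (norm_sub_le _ _).trans ?_
    rw [← dist_eq_norm x y]
    linarith [hεV x y]
  · have h1 : 0 < 1 - ε * K := by linarith
    rw [Real.coe_toNNReal _ (by positivity), ← div_eq_inv_mul, le_div_iff₀ h1, dist_eq_norm (x - _),
      show x - ε • V x - (y - ε • V y) = (x - y) - (ε • V x - ε • V y) by abel]
    have h2 := norm_sub_norm_le (x - y) (ε • V x - ε • V y)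
    rw [← dist_eq_norm x y] at h2
    linarith [hεV x y]
  -- Surjectivity by Banach's theorem: a preimage of `y` is a fixed point of `x ↦ y + ε V x`.
  · have hc : ContractingWith (ε * K).toNNReal fun x => y + ε • V x := by
      refine ⟨Real.toNNReal_lt_one.2 hεK, LipschitzWith.of_dist_le_mul fun a b => ?_⟩
      rw [Real.coe_toNNReal _ hεK0, dist_add_left, dist_eq_norm]
      exact hεV a b
    refine ⟨ContractingWith.fixedPoint _ hc, ?_⟩
    have := hc.fixedPoint_isFixedPt
    rw [Function.IsFixedPt] at this
    exact sub_eq_iff_eq_add.2 this.symm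

theorem exists_bound_of_lipschitzWith (hΩ : Bornology.IsBounded Ω) {K : NNReal}
    (hv : LipschitzWith K v) (hv0 : ∀ x, x ∉ Ω → v x = 0) : ∃ M : ℝ, ∀ x, |v x| ≤ M :=
  hv.continuous.bounded_above_of_compact_support (HasCompactSupport.intro hΩ.isCompact_closure
    fun x hx => hv0 x fun h => hx (subset_closure h))

/-- Lipschitz functions vanishing outside a bounded set belong to every `W^{s,r}_0(Ω)`. -/
theorem mem_W0_of_lipschitzWith (hN : 1 ≤ N) (hΩ : Bornology.IsBounded Ω) {r : ℝ} (hr : 0 < r)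
    (hs : 0 < s) (hs1 : s < 1) {K : NNReal} (hv : LipschitzWith K v)
    (hv0 : ∀ x, x ∉ Ω → v x = 0) : v ∈ W0 Ω s r := by
  obtain ⟨M, hM⟩ := exists_bound_of_lipschitzWith hΩ hv hv0
  exact lipschitz_mem_W0 hN hΩ hr hs hs1 hv hv0 hM

/-- The factor collects all losses in the changes of variables. It tends to `1` as `ε → 0`, so a
strict inequality survives. -/
theorem exists_small_distortion {n a b K ε₀ g c : ℝ} (hε₀ : 0 < ε₀) (hgc : g < c) :
    ∃ ε, 0 < ε ∧ ε < ε₀ ∧ ε * K < 1 ∧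
      (1 + ε * K) ^ a * ((((1 - ε * K)⁻¹) ^ n * ((1 - ε * K)⁻¹) ^ n)) * (1 + ε * K) ^ b * g < c := by
  have hcont : ContinuousAt (fun ε : ℝ => (1 + ε * K) ^ a *
      ((((1 - ε * K)⁻¹) ^ n * ((1 - ε * K)⁻¹) ^ n)) * (1 + ε * K) ^ b * g) 0 := by
    have h1 : ContinuousAt (fun ε : ℝ => 1 + ε * K) 0 := by fun_prop
    have h2 : ContinuousAt (fun ε : ℝ => (1 - ε * K)⁻¹) 0 :=
      ContinuousAt.inv₀ (by fun_prop) (by simp)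
    have h3 := h2.rpow_const (p := n) (Or.inl (by simp))
    exact (((h1.rpow_const (Or.inl (by simp))).mul (h3.mul h3)).mul
      (h1.rpow_const (Or.inl (by simp)))).mul continuousAt_const
  have hev1 := hcont.eventually_lt (g := fun _ => c) continuousAt_const (by simpa using hgc)
  have hK : ContinuousAt (fun ε : ℝ => ε * K) 0 := by fun_prop
  have hev2 := hK.eventually_lt (g := fun _ => (1 : ℝ)) continuousAt_const (by simp)
  have hev : ∀ᶠ ε in 𝓝[>] (0 : ℝ), 0 < ε ∧ ε < ε₀ ∧ ε * K < 1 ∧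
      (1 + ε * K) ^ a * ((((1 - ε * K)⁻¹) ^ n * ((1 - ε * K)⁻¹) ^ n)) * (1 + ε * K) ^ b * g < c := by
    filter_upwards [self_mem_nhdsWithin, nhdsWithin_le_nhds hev1, nhdsWithin_le_nhds hev2,
      nhdsWithin_le_nhds (Iio_mem_nhds hε₀)] with ε h1 h2 h3 h4
    exact ⟨h1, h4, h3, h2⟩
  exact hev.exists

/-- On a bounded Lipschitz domain, the Rayleigh quotient of an element of `W^{s,q}_0(Ω)` can be
approximated from above by Lipschitz functions vanishing outside the domain. -/
theorem exists_lipschitzWith_gagliardoPow_lt (hN : 1 ≤ N) (hΩo : IsOpen Ω)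
    (hΩ : Bornology.IsBounded Ω) (hlip : HasLipschitzBoundary Ω) (hq : 1 ≤ q) (hs : 0 < s)
    (hs1 : s < 1) (hu : u ∈ W0 Ω s q) {lam : ℝ}
    (hlt : gagliardoPow s q u < lam * ∫ x in Ω, |u x| ^ q) :
    ∃ (K : NNReal) (v : EuclideanSpace ℝ (Fin N) → ℝ), LipschitzWith K v ∧ (∀ x, x ∉ Ω → v x = 0) ∧
      gagliardoPow s q v < lam * ∫ x in Ω, |v x| ^ q := by
  have hq0 : 0 < q := by linarith
  have hlam : 0 < lam := by
    have h0 : 0 ≤ ∫ x in Ω, |u x| ^ q := integral_nonneg fun x => by positivity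
    by_contra h
    have := mul_nonpos_of_nonpos_of_nonneg (not_lt.1 h) h0
    linarith [gagliardoPow_nonneg (s := s) (r := q) (u := u)]
  -- A measurable representative vanishing everywhere outside `Ω`, since the support argument below
  -- is pointwise.
  set u₀ := Ω.indicator (hu.1.1.mk u) with hu₀
  have hu₀m : Measurable u₀ := hu.1.1.stronglyMeasurable_mk.measurable.indicator hΩo.measurableSet
  have hu₀u : u =ᵐ[volume] u₀ := by
    filter_upwards [hu.1.1.ae_eq_mk, hu.2.2] with x h1 h2
    by_cases hx : x ∈ Ω
    · rw [hu₀, indicator_of_mem hx, h1]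
    · rw [hu₀, indicator_of_notMem hx, h2 hx]
  have hu₀0 : ∀ x, x ∉ Ω → u₀ x = 0 := fun x hx => indicator_of_notMem hx _
  have hu₀W : u₀ ∈ W0 Ω s q := W0_congr hu₀u hu
  have hu₀i : Integrable u₀ volume := by
    have := memLp_of_exponent_le hΩ hΩo hq hu₀W.1 hu₀W.2.2
    rw [ENNReal.ofReal_one] at this
    exact memLp_one_iff_integrable.1 this
  obtain ⟨V, K, ε₀, hV, hε₀, hin⟩ := exists_inward_field hΩo hΩ hlip
  set I := ∫ x in Ω, |u x| ^ q with hI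
  set G := gagliardoPow s q u with hG
  obtain ⟨ε, hε, hεε₀, hεK, hεlt⟩ := exists_small_distortion (n := N) (a := N + s * q) (b := N)
    (K := K) hε₀ hlt
  obtain ⟨hSL, hSA, hSs⟩ := sub_smul_biLipschitz hV hε.le hεK
  obtain ⟨δ, hδ, hout⟩ := hin ε hε hεε₀
  -- The competitor is a mollification of `u₀` composed with `S`. Every point within `δ` of the
  -- image of a point outside `Ω` is outside `Ω`, so a mollification radius below `δ` makes it
  -- vanish there.
  set S : EuclideanSpace ℝ (Fin N) → EuclideanSpace ℝ (Fin N) := fun x => x - ε • V x with hS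
  have hεK0 : 0 ≤ ε * K := mul_nonneg hε.le K.2
  set c₁ : ℝ := (1 + ε * K) ^ ((N : ℝ) + s * q) *
    ((((1 - ε * K)⁻¹) ^ (N : ℝ) * ((1 - ε * K)⁻¹) ^ (N : ℝ))) with hc₁
  set c₂ : ℝ := (1 + ε * K) ^ (N : ℝ) with hc₂
  have hA0 : 0 < (1 - ε * K)⁻¹ := inv_pos.2 (by linarith)
  have hc₁pos : 0 < c₁ := by positivity
  have hc₂pos : 0 < c₂ := by positivity
  let φ : ℕ → ContDiffBump (0 : EuclideanSpace ℝ (Fin N)) := fun n =>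
    ⟨1 / (n + 1) / 2, 1 / (n + 1), by positivity, half_lt_self (by positivity)⟩
  have hrout : Tendsto (fun n => (φ n).rOut) atTop (𝓝 0) := tendsto_one_div_add_atTop_nhds_zero_nat
  set f : ℕ → EuclideanSpace ℝ (Fin N) → ℝ := fun n =>
    convolution ((φ n).normed volume) u₀ (ContinuousLinearMap.lsmul ℝ ℝ) volume with hf
  have hae : ∀ᵐ x ∂volume, Tendsto (fun n => f n x) atTop (𝓝 (u₀ x)) :=
    ContDiffBump.ae_convolution_tendsto_right_of_locallyIntegrable (K := 2) hrout
      (.of_forall fun n => by simp only [φ]; linarith) hu₀i.locallyIntegrable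
  choose Kf hKf using fun n => exists_lipschitzWith_convolution hu₀i (φ n)
  have hfm : ∀ n, Measurable (f n) := fun n => (hKf n).continuous.measurable
  have hIu : ∫⁻ x, ENNReal.ofReal (|u₀ x| ^ q) = ENNReal.ofReal I := by
    rw [hI, integral_Ω_eq hq0 hu.2.2, integral_abs_rpow_eq hu.1.1, ENNReal.ofReal_toReal
      ((memLp_ofReal_iff hq0).1 hu.1).2.ne]
    refine lintegral_congr_ae ?_
    filter_upwards [hu₀u] with x hx
    rw [hx]
  -- Mollification does not increase the Gagliardo integral, so only a lower bound for the `L^q`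
  -- integrals is needed, and Fatou suffices.
  have hfatou : ENNReal.ofReal I ≤ liminf (fun n => ∫⁻ x, ENNReal.ofReal (|f n x| ^ q)) atTop := by
    rw [← hIu]
    refine le_trans (lintegral_mono_ae ?_) (lintegral_liminf_le' fun n =>
      ((hfm n).abs.pow_const q).ennreal_ofReal.aemeasurable)
    filter_upwards [hae] with x hx
    refine le_of_eq (Tendsto.liminf_eq ?_).symm
    exact ENNReal.tendsto_ofReal (hx.abs.rpow_const (Or.inr hq0.le))
  have hstrict : ENNReal.ofReal (c₁ * c₂ * G / lam) < ENNReal.ofReal I := by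
    have h1 : c₁ * c₂ * G / lam < I := by
      rw [div_lt_iff₀ hlam, mul_comm I]
      exact hεlt
    have h2 : 0 ≤ c₁ * c₂ * G / lam :=
      div_nonneg (mul_nonneg (by positivity) gagliardoPow_nonneg) hlam.le
    exact (ENNReal.ofReal_lt_ofReal_iff (h2.trans_lt h1)).2 h1
  obtain ⟨n, hn1, hn2⟩ := ((eventually_lt_of_lt_liminf (hstrict.trans_le hfatou)).and
    (hrout.eventually (Iio_mem_nhds hδ))).exists
  have hvlip : LipschitzWith (Kf n * (1 + ε * K).toNNReal) (f n ∘ S) := (hKf n).comp hSL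
  have hv0 : ∀ x, x ∉ Ω → (f n ∘ S) x = 0 := by
    intro x hx
    simp only [hf, Function.comp_apply, convolution_lsmul]
    refine integral_eq_zero_of_ae (.of_forall fun z => ?_)
    by_cases hz : z ∈ Metric.ball (0 : EuclideanSpace ℝ (Fin N)) (φ n).rOut
    · rw [mem_ball_zero_iff] at hz
      have : S x - z ∉ Ω := hout x hx z (hz.le.trans (le_of_lt hn2))
      simp [hu₀0 _ this]
    · rw [← (φ n).support_normed_eq (μ := volume), Function.notMem_support] at hz
      simp [hz]
  refine ⟨_, f n ∘ S, hvlip, hv0, ?_⟩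
  have hvW : f n ∘ S ∈ W0 Ω s q := mem_W0_of_lipschitzWith hN hΩ hq0 hs hs1 hvlip hv0
  have hgag : gagliardoPow s q (f n ∘ S) ≤ c₁ * G := by
    have h1 := gagliardoLIntegral_comp_le (r := q) hq0 hs hSA hSL (hfm n)
    have h2 : gagliardoLIntegral s q (f n) ≤ ENNReal.ofReal G := by
      refine (gagliardoLIntegral_convolution_le hq hu₀m hu₀i (φ n)).trans (le_of_eq ?_)
      rw [← gagliardoLIntegral_congr hu₀u, gagliardoLIntegral_eq_ofReal hu.2.1]
    have h3 : gagliardoLIntegral s q (f n ∘ S) ≤ ENNReal.ofReal (c₁ * G) := by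
      refine h1.trans ?_
      have e : (((1 - ε * K)⁻¹).toNNReal : ENNReal) ^ (N : ℝ) =
          ENNReal.ofReal (((1 - ε * K)⁻¹) ^ (N : ℝ)) :=
        ENNReal.ofReal_rpow_of_nonneg hA0.le (by positivity)
      rw [e, Real.coe_toNNReal _ (by positivity), hc₁, ENNReal.ofReal_mul (by positivity),
        ENNReal.ofReal_mul (by positivity), ENNReal.ofReal_mul (by positivity), mul_assoc,
        mul_assoc]
      gcongr
    rw [gagliardoLIntegral_eq_ofReal hvW.2.1] at h3
    exact (ENNReal.ofReal_le_ofReal_iff (mul_nonneg hc₁pos.le gagliardoPow_nonneg)).1 h3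
  have hint : c₁ * c₂ * G / lam < c₂ * ∫ x in Ω, |(f n ∘ S) x| ^ q := by
    have h1 := lintegral_le_comp_of_lipschitz hSL hSs (F := fun x => ENNReal.ofReal (|f n x| ^ q))
      ((hfm n).abs.pow_const q).ennreal_ofReal
    have e : ((1 + ε * K).toNNReal : ENNReal) ^ (N : ℝ) = ENNReal.ofReal c₂ :=
      ENNReal.ofReal_rpow_of_nonneg (by positivity) (by positivity)
    have e2 : ∫⁻ x, ENNReal.ofReal (|f n (S x)| ^ q) =
        ENNReal.ofReal (∫ x in Ω, |(f n ∘ S) x| ^ q) := by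
      rw [integral_Ω_eq hq0 hvW.2.2, integral_abs_rpow_eq hvW.1.1, ENNReal.ofReal_toReal
        ((memLp_ofReal_iff hq0).1 hvW.1).2.ne]
      rfl
    rw [e, e2, ← ENNReal.ofReal_mul hc₂pos.le] at h1
    exact (ENNReal.ofReal_lt_ofReal_iff_of_nonneg
      (div_nonneg (mul_nonneg (by positivity) gagliardoPow_nonneg) hlam.le)).1 (hn1.trans_le h1)
  refine hgag.trans_lt ?_
  rw [div_lt_iff₀ hlam] at hint
  nlinarith

end Density

/-! ### Strong minimum principle and constant sign -/

section ConstantSign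

open Filter Topology

variable {N : ℕ} {Ω : Set (EuclideanSpace ℝ (Fin N))} {s r : ℝ}
  {u v w : EuclideanSpace ℝ (Fin N) → ℝ}

theorem ae_volume_of_ae_gagMeasure
    {P : EuclideanSpace ℝ (Fin N) × EuclideanSpace ℝ (Fin N) → Prop}
    (h : ∀ᵐ z ∂gagMeasure N s r, P z) : ∀ᵐ z, z.1 ≠ z.2 → P z := by
  rw [gagMeasure, ae_withDensity_iff measurable_gagKernel.ennreal_ofReal] at h
  filter_upwards [h] with z hz hne
  refine hz ?_
  have : 0 < ‖z.1 - z.2‖ := norm_pos_iff.2 (sub_ne_zero.2 hne)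
  have : 0 < gagKernel N s r z := by unfold gagKernel; positivity
  simpa using this

theorem measure_eq_zero_or_of_ae_prod {A B : Set (EuclideanSpace ℝ (Fin N))}
    (h : ∀ᵐ z : EuclideanSpace ℝ (Fin N) × EuclideanSpace ℝ (Fin N), ¬ (z.1 ∈ A ∧ z.2 ∈ B)) :
    volume A = 0 ∨ volume B = 0 := by
  have h1 : volume (A ×ˢ B) = 0 := by
    rw [← nonpos_iff_eq_zero]
    refine (measure_mono ?_).trans (ae_iff.1 h).le
    intro z hz
    simpa using hz
  rwa [Measure.volume_eq_prod, Measure.prod_prod, mul_eq_zero] at h1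

/-- Reverse Fatou lemma for integrals of functions with nonpositive limit. -/
theorem eventually_integral_lt_of_tendsto {X : Type*} [MeasurableSpace X] {μ : Measure X}
    {f : ℕ → X → ℝ} {g h : X → ℝ} (hf : ∀ n, Integrable (f n) μ) (hh : Integrable h μ)
    (hh0 : ∀ x, 0 ≤ h x) (hfh : ∀ n x, f n x ≤ h x) (hg : ∀ x, g x ≤ 0)
    (hlim : ∀ x, Tendsto (fun n => f n x) atTop (𝓝 (g x))) {c : ℝ}
    (hc : ENNReal.ofReal ((∫ x, h x ∂μ) + c) <
      ENNReal.ofReal (∫ x, h x ∂μ) + ∫⁻ x, ENNReal.ofReal (-g x) ∂μ) :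
    ∀ᶠ n in atTop, ∫ x, f n x ∂μ < -c := by
  -- Fatou applied to `h - f n ≥ 0`. Extended values are kept because `g` is not known to be
  -- integrable.
  have h1 : ENNReal.ofReal (∫ x, h x ∂μ) + ∫⁻ x, ENNReal.ofReal (-g x) ∂μ ≤
      liminf (fun n => ENNReal.ofReal (∫ x, h x ∂μ - ∫ x, f n x ∂μ)) atTop := by
    rw [ofReal_integral_eq_lintegral_ofReal hh (.of_forall hh0),
      ← lintegral_add_left' hh.aestronglyMeasurable.aemeasurable.ennreal_ofReal]
    have e : ∀ n, ENNReal.ofReal (∫ x, h x ∂μ - ∫ x, f n x ∂μ) =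
        ∫⁻ x, ENNReal.ofReal (h x - f n x) ∂μ := fun n => by
      rw [← integral_sub hh (hf n)]
      exact ofReal_integral_eq_lintegral_ofReal (hh.sub (hf n))
        (.of_forall fun x => sub_nonneg.2 (hfh n x))
    simp only [e]
    refine le_trans (lintegral_mono fun x => ?_) (lintegral_liminf_le' fun n =>
      (hh.sub (hf n)).aestronglyMeasurable.aemeasurable.ennreal_ofReal)
    rw [← ENNReal.ofReal_add (hh0 x) (by linarith [hg x]), ← sub_eq_add_neg]
    exact (Tendsto.liminf_eq (ENNReal.tendsto_ofReal ((hlim x).const_sub (h x)))).ge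
  filter_upwards [eventually_lt_of_lt_liminf (hc.trans_le h1)] with n hn
  have := (ENNReal.ofReal_lt_ofReal_iff'.1 hn).1
  linarith

theorem eventually_integral_lt_of_tendsto_nonpos {X : Type*} [MeasurableSpace X] {μ : Measure X}
    {f : ℕ → X → ℝ} {g h : X → ℝ} (hf : ∀ n, Integrable (f n) μ) (hh : Integrable h μ)
    (hh0 : ∀ x, 0 ≤ h x) (hfh : ∀ n x, f n x ≤ h x) (hg : ∀ x, g x ≤ 0)
    (hlim : ∀ x, Tendsto (fun n => f n x) atTop (𝓝 (g x))) {ε : ℝ} (hε : 0 < ε) :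
    ∀ᶠ n in atTop, ∫ x, f n x ∂μ < ε := by
  by_cases hH : ∫ x, h x ∂μ < ε
  · exact .of_forall fun n => (integral_mono (hf n) hh (hfh n)).trans_lt hH
  · have := eventually_integral_lt_of_tendsto hf hh hh0 hfh hg hlim (c := -ε) ?_
    · simpa using this
    · refine lt_of_lt_of_le ?_ le_self_add
      exact (ENNReal.ofReal_lt_ofReal_iff (by linarith)).2 (by linarith)

theorem exists_eventually_integral_lt_of_tendsto {X : Type*} [MeasurableSpace X] {μ : Measure X}
    {f : ℕ → X → ℝ} {g h : X → ℝ} (hf : ∀ n, Integrable (f n) μ) (hh : Integrable h μ)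
    (hh0 : ∀ x, 0 ≤ h x) (hfh : ∀ n x, f n x ≤ h x) (hg : ∀ x, g x ≤ 0)
    (hlim : ∀ x, Tendsto (fun n => f n x) atTop (𝓝 (g x))) (hne : ¬ g =ᵐ[μ] 0) :
    ∃ c, 0 < c ∧ ∀ᶠ n in atTop, ∫ x, f n x ∂μ < -c := by
  have hgm : AEMeasurable g μ :=
    (aestronglyMeasurable_of_tendsto_ae atTop (fun n => (hf n).aestronglyMeasurable)
      (.of_forall hlim)).aemeasurable
  have hpos : ∫⁻ x, ENNReal.ofReal (-g x) ∂μ ≠ 0 := by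
    have hgm' : AEMeasurable (fun x => ENNReal.ofReal (-g x)) μ := hgm.neg.ennreal_ofReal
    rw [Ne, lintegral_eq_zero_iff' hgm']
    refine fun h0 => hne ?_
    filter_upwards [h0] with x hx
    have : -g x ≤ 0 := by simpa using hx
    exact le_antisymm (hg x) (by simpa using this)
  obtain ⟨c, hc0, hc⟩ := ENNReal.lt_iff_exists_nnreal_btwn.1 (pos_iff_ne_zero.2 hpos)
  have hc0' : 0 < c := by exact_mod_cast hc0
  refine ⟨c, hc0', eventually_integral_lt_of_tendsto hf hh hh0 hfh hg hlim ?_⟩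
  have hH : 0 ≤ ∫ x, h x ∂μ := integral_nonneg hh0
  rw [ENNReal.ofReal_add hH c.coe_nonneg, ENNReal.ofReal_coe_nnreal]
  exact (ENNReal.add_lt_add_iff_left ENNReal.ofReal_ne_top).2 hc

/-- The cutoff `t ↦ (1 - n t)⁺`. -/
noncomputable def hatCut (n : ℕ) (t : ℝ) : ℝ := max 0 (1 - n * t)

theorem hatCut_nonneg (n : ℕ) (t : ℝ) : 0 ≤ hatCut n t := le_max_left _ _

theorem hatCut_le_one {n : ℕ} {t : ℝ} (ht : 0 ≤ t) : hatCut n t ≤ 1 :=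
  max_le zero_le_one (by have : 0 ≤ (n : ℝ) * t := by positivity
                         linarith)

theorem hatCut_anti (n : ℕ) : Antitone (hatCut n) := fun a b hab =>
  max_le_max le_rfl (by gcongr)

theorem abs_hatCut_sub_le (n : ℕ) (a b : ℝ) : |hatCut n a - hatCut n b| ≤ n * |a - b| := by
  have h := abs_max_sub_max_le_abs (1 - n * a) (1 - n * b) 0
  simp only [hatCut, max_comm (0 : ℝ)]
  refine h.trans (le_of_eq ?_)
  rw [show 1 - n * a - (1 - n * b) = -(n * (a - b)) by ring, abs_neg, abs_mul, Nat.abs_cast]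

theorem tendsto_hatCut {t : ℝ} (ht : 0 ≤ t) :
    Tendsto (fun n => hatCut n t) atTop (𝓝 (if t = 0 then 1 else 0)) := by
  rcases ht.eq_or_lt' with rfl | hpos
  · simp [hatCut]
  · rw [if_neg hpos.ne']
    refine tendsto_const_nhds.congr' ?_
    have h := tendsto_natCast_atTop_atTop (R := ℝ) |>.atTop_mul_const hpos
    filter_upwards [h.eventually_ge_atTop 1] with n hn
    exact (max_eq_left (by linarith)).symm

/-- Only the part of `e` having the sign of `d` matters, so a one-sided bound suffices; `|e|` may be
large. -/
theorem rpow_sub_two_mul_mul_le (hr : 1 < r) {d e c : ℝ} (h1 : 0 ≤ d → e ≤ c)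
    (h2 : d ≤ 0 → -e ≤ c) : |d| ^ (r - 2) * d * e ≤ |d| ^ (r - 1) * c := by
  have h := abs_rpow_sub_two_mul hr d
  rw [← h]
  rcases le_total 0 d with hd | hd
  · rw [abs_of_nonneg (mul_nonneg (by positivity) hd)]
    exact mul_le_mul_of_nonneg_left (h1 hd) (mul_nonneg (by positivity) hd)
  · rw [abs_of_nonpos (mul_nonpos_of_nonneg_of_nonpos (by positivity) hd)]
    have := mul_le_mul_of_nonneg_left (h2 hd)
      (neg_nonneg.2 (mul_nonpos_of_nonneg_of_nonpos (by positivity : 0 ≤ |d| ^ (r - 2)) hd))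
    linarith

variable {η : EuclideanSpace ℝ (Fin N) → ℝ}

theorem cut_mem_W0 (hN : 1 ≤ N) (hΩ : Bornology.IsBounded Ω) (hr : 0 < r) (hs : 0 < s)
    (hs1 : s < 1) (hu : u ∈ W0 Ω s r) (hu0 : ∀ x, 0 ≤ u x) {K : NNReal} (hη : LipschitzWith K η)
    (hη0 : ∀ x, x ∉ Ω → η x = 0) {M : ℝ} (hM : ∀ x, |η x| ≤ M) (n : ℕ) :
    (fun x => η x * hatCut n (u x)) ∈ W0 Ω s r := by
  have hM0 : 0 ≤ M := (abs_nonneg _).trans (hM 0)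
  have hv0 : ∀ᵐ x ∂volume, x ∉ Ω → η x * hatCut n (u x) = 0 :=
    .of_forall fun x hx => by rw [hη0 x hx, zero_mul]
  have hcut : ∀ x, |hatCut n (u x)| ≤ 1 := fun x => by
    rw [abs_of_nonneg (hatCut_nonneg _ _)]
    exact hatCut_le_one (hu0 x)
  have hcont : Continuous (hatCut n) := by unfold hatCut; fun_prop
  -- The constant `M n + K` grows with `n`: the cutoffs are not bounded in `W0` by this estimate,
  -- which is why the passage to the limit uses one-sided bounds.
  refine mem_W0_of_abs_sub_le hN hΩ hr hs hs1 hu (memLp_of_bounded hΩ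
    (hη.continuous.aestronglyMeasurable.mul (hcont.comp_aestronglyMeasurable hu.1.1)) hv0
    (M := M) (fun x => ?_) _) hv0 (C := M * n + K) (by positivity) fun x y => ?_
  · change |η x * hatCut n (u x)| ≤ M
    rw [abs_mul]
    exact (mul_le_of_le_one_right (abs_nonneg _) (hcut x)).trans (hM x)
  · have e : η x * hatCut n (u x) - η y * hatCut n (u y) =
      η x * (hatCut n (u x) - hatCut n (u y)) + (η x - η y) * hatCut n (u y) := by ring
    rw [e]
    have h1 : |η x * (hatCut n (u x) - hatCut n (u y))| ≤ M * (n * |u x - u y|) := by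
      rw [abs_mul]
      exact mul_le_mul (hM x) (abs_hatCut_sub_le _ _ _) (abs_nonneg _) hM0
    have h2 : |(η x - η y) * hatCut n (u y)| ≤ K * ‖x - y‖ := by
      rw [abs_mul]
      refine (mul_le_of_le_one_right (abs_nonneg _) (hcut y)).trans ?_
      simpa [dist_eq_norm] using hη.dist_le_mul x y
    refine (abs_add_le _ _).trans ((add_le_add h1 h2).trans ?_)
    have : 0 ≤ M * n * ‖x - y‖ := by positivity
    have : 0 ≤ K * |u x - u y| := by positivity
    nlinarith

/-- The cutoff decreases in `u`, so its increment is opposed to that of `u` and contributes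
nonpositively. What remains is the increment of `η`, uniformly in `n`. -/
theorem pairDiff_cut_le (hr : 1 < r) (hu0 : ∀ x, 0 ≤ u x) (hη0 : ∀ x, 0 ≤ η x) (n : ℕ) (z) :
    |pairDiff u z| ^ (r - 2) * pairDiff u z * pairDiff (fun x => η x * hatCut n (u x)) z ≤
      |pairDiff u z| ^ (r - 1) * |pairDiff η z| := by
  have key : ∀ x y, u y ≤ u x →
      η x * hatCut n (u x) - η y * hatCut n (u y) ≤ |η x - η y| := by
    intro x y hxy
    have h1 := mul_le_mul_of_nonneg_left (hatCut_anti n hxy) (hη0 x)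
    have h2 : (η x - η y) * hatCut n (u y) ≤ |η x - η y| :=
      (mul_le_mul_of_nonneg_right (le_abs_self _) (hatCut_nonneg _ _)).trans
        (mul_le_of_le_one_right (abs_nonneg _) (hatCut_le_one (hu0 y)))
    linarith
  refine rpow_sub_two_mul_mul_le hr (fun h => key _ _ (sub_nonneg.1 h)) fun h => ?_
  have := key z.2 z.1 (sub_nonpos.1 h)
  rw [abs_sub_comm] at this
  simp only [pairDiff]
  linarith

theorem pairDiff_limit_le (hr : 1 < r) (hu0 : ∀ x, 0 ≤ u x) (hη0 : ∀ x, 0 ≤ η x) (z) :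
    |pairDiff u z| ^ (r - 2) * pairDiff u z *
      pairDiff (fun x => η x * (if u x = 0 then 1 else 0)) z ≤ 0 := by
  have key : ∀ x y, u y < u x →
      η x * (if u x = 0 then 1 else 0) - η y * (if u y = 0 then 1 else 0) ≤ 0 := by
    intro x y hxy
    have h1 : u x ≠ 0 := ((hu0 y).trans_lt hxy).ne'
    rw [if_neg h1]
    have : 0 ≤ η y * (if u y = 0 then 1 else 0) := mul_nonneg (hη0 y) (by split_ifs <;> norm_num)
    linarith
  rcases eq_or_ne (u z.1) (u z.2) with h | h
  · simp [pairDiff, h]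
  have h2 := rpow_sub_two_mul_mul_le hr (c := 0) (d := pairDiff u z)
    (e := pairDiff (fun x => η x * (if u x = 0 then 1 else 0)) z)
    (fun hd => key _ _ (lt_of_le_of_ne (sub_nonneg.1 hd) h.symm)) fun hd => by
      have := key z.2 z.1 (lt_of_le_of_ne (sub_nonpos.1 hd) h)
      simp only [pairDiff]
      linarith
  rwa [mul_zero] at h2

theorem tendsto_pairDiff_cut (hu0 : ∀ x, 0 ≤ u x) (z) :
    Tendsto (fun n : ℕ => |pairDiff u z| ^ (r - 2) * pairDiff u z *
      pairDiff (fun x => η x * hatCut n (u x)) z) atTop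
      (𝓝 (|pairDiff u z| ^ (r - 2) * pairDiff u z *
        pairDiff (fun x => η x * (if u x = 0 then 1 else 0)) z)) :=
  (((tendsto_hatCut (hu0 z.1)).const_mul _).sub ((tendsto_hatCut (hu0 z.2)).const_mul _)).const_mul _

theorem compl_nonempty_of_isBounded (hN : 1 ≤ N) (hΩ : Bornology.IsBounded Ω) :
    (Ωᶜ).Nonempty := by
  have : Nonempty (Fin N) := ⟨⟨0, hN⟩⟩
  have : Nontrivial (EuclideanSpace ℝ (Fin N)) := inferInstance
  rw [nonempty_compl]
  rintro rfl
  exact NormedSpace.unbounded_univ ℝ (EuclideanSpace ℝ (Fin N)) hΩ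

/-- The strong minimum principle for nonnegative eigenfunctions. -/
theorem ae_pos_of_isEigenfunction (hN : 1 ≤ N) (hΩ : Bornology.IsBounded Ω) (hΩo : IsOpen Ω)
    {s₁ s₂ p q lam : ℝ} (hp : 1 < p) (hq : 1 < q) (hs₁ : 0 < s₁) (hs₁' : s₁ < 1) (hs₂ : 0 < s₂)
    (hs₂' : s₂ < 1) (hlam : 0 ≤ lam) (hu : IsEigenfunction Ω s₁ s₂ p q lam u)
    (hu0 : ∀ x, 0 ≤ u x) : ∀ᵐ x ∂volume, x ∈ Ω → 0 < u x := by
  have hne := compl_nonempty_of_isBounded hN hΩ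
  set η : EuclideanSpace ℝ (Fin N) → ℝ := fun x => Metric.infDist x Ωᶜ with hη
  have hηlip : LipschitzWith 1 η := Metric.lipschitz_infDist_pt _
  have hη0 : ∀ x, 0 ≤ η x := fun x => Metric.infDist_nonneg
  have hηout : ∀ x, x ∉ Ω → η x = 0 := fun x hx => Metric.infDist_zero_of_mem hx
  have hηpos : ∀ x ∈ Ω, 0 < η x := fun x hx =>
    (hΩo.isClosed_compl.notMem_iff_infDist_pos hne).1 fun h => h hx
  obtain ⟨M, hM⟩ := exists_bound_of_lipschitzWith hΩ hηlip hηout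
  obtain ⟨⟨hu1, hu2⟩, hunz, heq⟩ := hu
  have hη1 := mem_W0_of_lipschitzWith hN hΩ (by linarith : 0 < p) hs₁ hs₁' hηlip hηout
  have hη2 := mem_W0_of_lipschitzWith hN hΩ (by linarith : 0 < q) hs₂ hs₂' hηlip hηout
  have hv1 := cut_mem_W0 hN hΩ (by linarith) hs₁ hs₁' hu1 hu0 hηlip hηout hM
  have hv2 := cut_mem_W0 hN hΩ (by linarith) hs₂ hs₂' hu2 hu0 hηlip hηout hM
  have hint : ∀ (s r : ℝ), 1 < r → ∀ a ∈ W0 Ω s r, ∀ b ∈ W0 Ω s r,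
      Integrable (fun z => |pairDiff a z| ^ (r - 2) * pairDiff a z * pairDiff b z)
        (gagMeasure N s r) := fun s r hr a ha b hb =>
    ((mem_W0_iff (by linarith)).1 ha).2.1.integrable_rpow_sub_two_mul hr
      ((mem_W0_iff (by linarith)).1 hb).2.1
  have hdom : ∀ (s r : ℝ), 1 < r → ∀ a ∈ W0 Ω s r, ∀ b ∈ W0 Ω s r,
      Integrable (fun z => |pairDiff a z| ^ (r - 1) * |pairDiff b z|)
        (gagMeasure N s r) := fun s r hr a ha b hb =>
    ((mem_W0_iff (by linarith)).1 ha).2.1.integrable_rpow_sub_one_mul hr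
      ((mem_W0_iff (by linarith)).1 hb).2.1
  -- Testing with `η (1 - n u)⁺ ≥ 0` makes the right side of the equation nonnegative.
  have hsum : ∀ n : ℕ, 0 ≤ fracForm p s₁ u (fun x => η x * hatCut n (u x)) +
      fracForm q s₂ u (fun x => η x * hatCut n (u x)) := by
    intro n
    rw [heq _ ⟨hv1 n, hv2 n⟩]
    refine mul_nonneg hlam (integral_nonneg fun x => ?_)
    exact mul_nonneg (mul_nonneg (by positivity) (hu0 x)) (mul_nonneg (hη0 x) (hatCut_nonneg _ _))
  simp only [fracForm_eq] at hsum
  -- In the limit both integrands are nonpositive. If the `p`-integrand were not null, its form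
  -- would eventually be below some `-c < 0` while the other is below `c`, against `hsum`.
  have hzero : (fun z => |pairDiff u z| ^ (p - 2) * pairDiff u z *
      pairDiff (fun x => η x * (if u x = 0 then 1 else 0)) z) =ᵐ[gagMeasure N s₁ p] 0 := by
    by_contra hcon
    obtain ⟨c, hc, hev⟩ := exists_eventually_integral_lt_of_tendsto
      (fun n => hint s₁ p hp u hu1 _ (hv1 n)) (hdom s₁ p hp u hu1 η hη1) (fun z => by positivity)
      (fun n z => pairDiff_cut_le hp hu0 hη0 n z) (pairDiff_limit_le hp hu0 hη0)
      (tendsto_pairDiff_cut hu0) hcon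
    have hev2 := eventually_integral_lt_of_tendsto_nonpos
      (fun n => hint s₂ q hq u hu2 _ (hv2 n)) (hdom s₂ q hq u hu2 η hη2) (fun z => by positivity)
      (fun n z => pairDiff_cut_le hq hu0 hη0 n z) (pairDiff_limit_le hq hu0 hη0)
      (tendsto_pairDiff_cut hu0) hc
    obtain ⟨n, h1, h2⟩ := (hev.and hev2).exists
    linarith [hsum n]
  have hprod : ∀ᵐ z : EuclideanSpace ℝ (Fin N) × EuclideanSpace ℝ (Fin N),
      ¬ (z.1 ∈ {x | x ∈ Ω ∧ u x = 0} ∧ z.2 ∈ {x | 0 < u x}) := by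
    filter_upwards [ae_volume_of_ae_gagMeasure hzero] with z hz
    rintro ⟨⟨h1, h2⟩, h3⟩
    have h3' : 0 < u z.2 := h3
    have hne : z.1 ≠ z.2 := fun h => h3'.ne' (h ▸ h2)
    have := hz hne
    -- Minus the limit integrand at a pair where `u` vanishes at the first point, in `Ω`, and is
    -- positive at the second.
    have hlt : 0 < |u z.2| ^ (p - 2) * u z.2 * η z.1 :=
      mul_pos (mul_pos (Real.rpow_pos_of_pos (abs_pos.2 h3'.ne') _) h3') (hηpos _ h1)
    simp [pairDiff, h2, h3'.ne', -mul_eq_zero] at this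
    linarith
  rcases measure_eq_zero_or_of_ae_prod hprod with h | h
  · have h' : ∀ᵐ x ∂volume, ¬ (x ∈ Ω ∧ u x = 0) := by
      rw [ae_iff]
      simpa using h
    filter_upwards [h'] with x hx hxΩ
    exact lt_of_le_of_ne (hu0 x) fun h => hx ⟨hxΩ, h.symm⟩
  · refine absurd ?_ hunz
    have h' : ∀ᵐ x ∂volume, ¬ 0 < u x := by
      rw [ae_iff]
      simpa using h
    filter_upwards [h'] with x hx
    exact le_antisymm (not_lt.1 hx) (hu0 x)

/-- A function whose Gagliardo seminorm equals that of its modulus does not change sign. -/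
theorem ae_nonneg_or_nonpos (hr : 0 < r) (hu : u ∈ W0 Ω s r)
    (h : gagliardoPow s r (fun x => |u x|) = gagliardoPow s r u) :
    (∀ᵐ x ∂volume, 0 ≤ u x) ∨ ∀ᵐ x ∂volume, u x ≤ 0 := by
  have hau := abs_mem_W0 hr.le hu
  rw [gagliardoPow_eq hu.1.1, gagliardoPow_eq hau.1.1] at h
  have hi1 := ((mem_W0_iff hr).1 hau).2.1.integrable_abs_rpow hr
  have hi2 := ((mem_W0_iff hr).1 hu).2.1.integrable_abs_rpow hr
  -- Equal integrals force equality almost everywhere in `||a| - |b|| ≤ |a - b|`, which is strict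
  -- for values of opposite sign.
  have hae := (integral_eq_iff_of_ae_le hi1 hi2 (.of_forall fun z =>
    Real.rpow_le_rpow (abs_nonneg _) (abs_pairDiff_abs_le z) hr.le)).1 h
  have hprod : ∀ᵐ z : EuclideanSpace ℝ (Fin N) × EuclideanSpace ℝ (Fin N),
      ¬ (z.1 ∈ {x | u x < 0} ∧ z.2 ∈ {x | 0 < u x}) := by
    filter_upwards [ae_volume_of_ae_gagMeasure hae] with z hz
    rintro ⟨h1, h2⟩
    have h1' : u z.1 < 0 := h1
    have h2' : 0 < u z.2 := h2
    have hne : z.1 ≠ z.2 := fun h => by rw [h] at h1'; linarith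
    have h3 := hz hne
    rw [Real.rpow_left_inj (abs_nonneg _) (abs_nonneg _) hr.ne'] at h3
    simp only [pairDiff] at h3
    rw [abs_of_neg h1', abs_of_pos h2', abs_of_neg (a := u z.1 - u z.2) (by linarith)] at h3
    rcases abs_cases (-u z.1 - u z.2) with h4 | h4 <;> linarith [h4.1]
  rcases measure_eq_zero_or_of_ae_prod hprod with h | h
  · left
    have h' : ∀ᵐ x ∂volume, ¬ u x < 0 := by
      rw [ae_iff]
      simpa using h
    filter_upwards [h'] with x hx
    exact not_lt.1 hx
  · right
    have h' : ∀ᵐ x ∂volume, ¬ 0 < u x := by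
      rw [ae_iff]
      simpa using h
    filter_upwards [h'] with x hx
    exact not_lt.1 hx

/-- If the modulus of `u` is an eigenfunction with the same Gagliardo seminorm as `u`, then `u`
has constant sign. -/
theorem hasConstantSign_of_abs (hN : 1 ≤ N) (hΩ : Bornology.IsBounded Ω) (hΩo : IsOpen Ω)
    {s₁ s₂ p q lam : ℝ} (hp : 1 < p) (hq : 1 < q) (hs₁ : 0 < s₁) (hs₁' : s₁ < 1) (hs₂ : 0 < s₂)
    (hs₂' : s₂ < 1) (hlam : 0 ≤ lam) (hu : u ∈ W0 Ω s₁ p)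
    (h : gagliardoPow s₁ p (fun x => |u x|) = gagliardoPow s₁ p u)
    (hau : IsEigenfunction Ω s₁ s₂ p q lam (fun x => |u x|)) : HasConstantSign Ω u := by
  have hpos := ae_pos_of_isEigenfunction hN hΩ hΩo hp hq hs₁ hs₁' hs₂ hs₂' hlam hau
    fun x => abs_nonneg _
  rcases ae_nonneg_or_nonpos (by linarith) hu h with h | h
  · left
    filter_upwards [hpos, h] with x h1 h2 hx
    exact lt_of_le_of_ne h2 (abs_pos.1 (h1 hx)).symm
  · right
    filter_upwards [hpos, h] with x h1 h2 hx
    exact lt_of_le_of_ne h2 (abs_pos.1 (h1 hx))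

end ConstantSign

/-! ### Global minimization for `q < p` -/

section Energy

open Filter Topology

variable {N : ℕ} {Ω : Set (EuclideanSpace ℝ (Fin N))} {s₁ s₂ p q lam : ℝ}
  {u v w : EuclideanSpace ℝ (Fin N) → ℝ}

theorem exists_mem_W0_not_ae_zero (hN : 1 ≤ N) (hΩ : Bornology.IsBounded Ω) (hΩo : IsOpen Ω)
    (hΩne : Ω.Nonempty) {s r : ℝ} (hr : 0 < r) (hs : 0 < s) (hs1 : s < 1) :
    ∃ u ∈ W0 Ω s r, ¬ u =ᵐ[volume] 0 := by
  have hne := compl_nonempty_of_isBounded hN hΩ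
  refine ⟨fun x => Metric.infDist x Ωᶜ, mem_W0_of_lipschitzWith hN hΩ hr hs hs1
    (Metric.lipschitz_infDist_pt _) (fun x hx => Metric.infDist_zero_of_mem hx), fun h => ?_⟩
  refine (hΩo.measure_pos volume hΩne).ne' ?_
  rw [← nonpos_iff_eq_zero]
  refine (measure_mono fun x hx => ?_).trans (ae_iff.1 h).le
  exact ((hΩo.isClosed_compl.notMem_iff_infDist_pos hne).1 fun h => h hx).ne'

theorem firstEigenvalue_nonneg {s r : ℝ} : 0 ≤ firstEigenvalue Ω s r := by
  refine Real.sInf_nonneg ?_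
  rintro _ ⟨u, -, -, rfl⟩
  exact div_nonneg gagliardoPow_nonneg (integral_nonneg fun x => by positivity)

theorem exists_gagliardoPow_lt_of_firstEigenvalue_lt (hN : 1 ≤ N) (hΩ : Bornology.IsBounded Ω)
    (hΩo : IsOpen Ω) (hΩne : Ω.Nonempty) {s r : ℝ} (hr : 0 < r) (hs : 0 < s) (hs1 : s < 1)
    (h : firstEigenvalue Ω s r < lam) :
    ∃ u ∈ W0 Ω s r, gagliardoPow s r u < lam * ∫ x in Ω, |u x| ^ r := by
  -- The set of Rayleigh quotients must be nonempty, since `sInf ∅ = 0` carries no information.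
  obtain ⟨u₀, hu₀, hu₀'⟩ := exists_mem_W0_not_ae_zero hN hΩ hΩo hΩne hr hs hs1
  rw [firstEigenvalue] at h
  obtain ⟨_, ⟨u, hu, hu', rfl⟩, hlt⟩ := exists_lt_of_csInf_lt (by exact ⟨_, u₀, hu₀, hu₀', rfl⟩) h
  exact ⟨u, hu, (div_lt_iff₀ (integral_rpow_pos hr hu hu')).1 hlt⟩

theorem hasDerivAt_energy (hp : 1 < p) (hq : 1 < q) (hu1 : u ∈ W0 Ω s₁ p) (hu2 : u ∈ W0 Ω s₂ q)
    (hv1 : v ∈ W0 Ω s₁ p) (hv2 : v ∈ W0 Ω s₂ q) :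
    HasDerivAt (fun t : ℝ => energy Ω s₁ s₂ p q lam (u + t • v))
      (fracForm p s₁ u v + fracForm q s₂ u v - lam * ∫ x in Ω, |u x| ^ (q - 2) * u x * v x) 0 := by
  have h1 := (hasDerivAt_gagliardoPow hp hu1 hv1).const_mul (1 / p)
  have h2 := (hasDerivAt_gagliardoPow hq hu2 hv2).const_mul (1 / q)
  have h3 := (hasDerivAt_integral_Ω (Ω := Ω) hq hu2.1 hv2.1).const_mul (lam / q)
  refine ((h1.add h2).sub h3).congr_deriv ?_
  have hp0 : p ≠ 0 := by linarith
  have hq0 : q ≠ 0 := by linarith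
  field_simp

theorem energy_smul {t : ℝ} (ht : 0 ≤ t) :
    energy Ω s₁ s₂ p q lam (t • u) = t ^ p * (1 / p * gagliardoPow s₁ p u) +
      t ^ q * (1 / q * gagliardoPow s₂ q u - lam / q * ∫ x in Ω, |u x| ^ q) := by
  rw [energy, gagliardoPow_smul, gagliardoPow_smul, integral_abs_smul_rpow, abs_of_nonneg ht]
  ring

theorem energy_congr (h : u =ᵐ[volume] v) :
    energy Ω s₁ s₂ p q lam u = energy Ω s₁ s₂ p q lam v := by
  have hi : ∫ x in Ω, |u x| ^ q = ∫ x in Ω, |v x| ^ q := by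
    refine integral_congr_ae (ae_restrict_of_ae ?_)
    filter_upwards [h] with x hx
    rw [hx]
  rw [energy, energy, gagliardoPow, gagliardoPow, gagliardoPow, gagliardoPow,
    gagliardoLIntegral_congr h, gagliardoLIntegral_congr h, hi]

theorem energy_zero (hp : 0 < p) (hq : 0 < q) :
    energy Ω s₁ s₂ p q lam (0 : EuclideanSpace ℝ (Fin N) → ℝ) = 0 := by
  have := energy_smul (Ω := Ω) (s₁ := s₁) (s₂ := s₂) (lam := lam)
    (u := (0 : EuclideanSpace ℝ (Fin N) → ℝ)) (p := p) (q := q) (t := 0) le_rfl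
  rw [Real.zero_rpow hp.ne', Real.zero_rpow hq.ne'] at this
  simpa using this

theorem exists_rpow_le_add (hqp : q < p) (hq : 0 < q) {ε : ℝ} (hε : 0 < ε) :
    ∃ C, 0 ≤ C ∧ ∀ t : ℝ, 0 ≤ t → t ^ q ≤ ε * t ^ p + C := by
  have hpq : 0 < p - q := by linarith
  set T : ℝ := (ε⁻¹) ^ (p - q)⁻¹ with hT
  have hT0 : 0 < T := by positivity
  have hTp : T ^ (p - q) = ε⁻¹ := by
    rw [hT, ← Real.rpow_mul (by positivity), inv_mul_cancel₀ hpq.ne', Real.rpow_one]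
  refine ⟨T ^ q, by positivity, fun t ht => ?_⟩
  rcases le_total t T with h | h
  · have := Real.rpow_le_rpow ht h hq.le
    have : 0 ≤ ε * t ^ p := by positivity
    linarith
  · have ht0 : 0 < t := hT0.trans_le h
    have h1 : ε⁻¹ ≤ t ^ (p - q) := hTp ▸ Real.rpow_le_rpow hT0.le h hpq.le
    have h2 : t ^ q ≤ ε * t ^ p := by
      rw [← div_le_iff₀' hε, div_eq_mul_inv]
      calc t ^ q * ε⁻¹ ≤ t ^ q * t ^ (p - q) := by gcongr
        _ = t ^ p := by rw [← Real.rpow_add ht0]; congr 1; ring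
    have : 0 ≤ T ^ q := by positivity
    linarith

theorem exists_energy_ge (hN : 1 ≤ N) (hΩ : Bornology.IsBounded Ω) (hΩo : IsOpen Ω)
    (hs₁ : 0 < s₁) (hq : 1 < q) (hqp : q < p) (hlam : 0 < lam) :
    ∃ C, ∀ u ∈ W0 Ω s₁ p, 1 / (2 * p) * gagliardoPow s₁ p u - C ≤ energy Ω s₁ s₂ p q lam u := by
  have hp : 0 < p := by linarith
  have hq0 : 0 < q := by linarith
  obtain ⟨P, hP0, hP⟩ := exists_poincare hN hΩ s₁ hp hs₁
  -- This `ε` solves `(lam / q) * ε * P = 1 / (2 p)`, so that the `L^q` term uses up half of the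
  -- `p`-term.
  obtain ⟨C, hC0, hC⟩ := exists_rpow_le_add hqp hq0 (ε := q / (lam * P * (2 * p))) (by positivity)
  refine ⟨lam / q * (C * volume.real Ω), fun u hu => ?_⟩
  have : IsFiniteMeasure (volume.restrict Ω) := ⟨by simpa using hΩ.measure_lt_top⟩
  have hi1 : Integrable (fun x => |u x| ^ p) (volume.restrict Ω) :=
    (hu.1.restrict Ω).integrable_abs_rpow hp
  have hi2 : Integrable (fun x => |u x| ^ q) (volume.restrict Ω) :=
    ((memLp_of_exponent_le hΩ hΩo hqp.le hu.1 hu.2.2).restrict Ω).integrable_abs_rpow hq0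
  have h1 : ∫ x in Ω, |u x| ^ q ≤
      q / (lam * P * (2 * p)) * (P * gagliardoPow s₁ p u) + C * volume.real Ω := by
    calc ∫ x in Ω, |u x| ^ q ≤ ∫ x in Ω, (q / (lam * P * (2 * p)) * |u x| ^ p + C) :=
          integral_mono hi2 ((hi1.const_mul _).add (integrable_const C))
            fun x => hC _ (abs_nonneg _)
      _ = q / (lam * P * (2 * p)) * (∫ x in Ω, |u x| ^ p) + C * volume.real Ω := by
          rw [integral_add (hi1.const_mul _) (integrable_const C), integral_const_mul,
            integral_const, smul_eq_mul, measureReal_restrict_apply_univ, mul_comm C]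
      _ ≤ _ := by
          gcongr
          exact hP u hu
  have h2 : lam / q * ∫ x in Ω, |u x| ^ q ≤
      1 / (2 * p) * gagliardoPow s₁ p u + lam / q * (C * volume.real Ω) := by
    refine (mul_le_mul_of_nonneg_left h1 (by positivity)).trans (le_of_eq ?_)
    field_simp
  have h3 : 0 ≤ 1 / q * gagliardoPow s₂ q u := mul_nonneg (by positivity) gagliardoPow_nonneg
  have h4 : 1 / p * gagliardoPow s₁ p u =
      1 / (2 * p) * gagliardoPow s₁ p u + 1 / (2 * p) * gagliardoPow s₁ p u := by
    field_simp
    ring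
  rw [energy]
  linarith

theorem energy_coercive (hN : 1 ≤ N) (hΩ : Bornology.IsBounded Ω) (hΩo : IsOpen Ω)
    (hs₁ : 0 < s₁) (hq : 1 < q) (hqp : q < p) (hlam : 0 < lam) (M : ℝ) :
    ∃ R : ℝ, ∀ u ∈ W0 Ω s₁ p, R ≤ gagliardoSeminorm s₁ p u → M ≤ energy Ω s₁ s₂ p q lam u := by
  have hp : 0 < p := by linarith
  obtain ⟨C, hC⟩ := exists_energy_ge (s₂ := s₂) hN hΩ hΩo hs₁ hq hqp hlam
  refine ⟨(max 0 (2 * p * (M + C))) ^ (1 / p), fun u hu hR => ?_⟩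
  rw [gagliardoSeminorm, Real.rpow_le_rpow_iff (le_max_left _ _) gagliardoPow_nonneg
    (by positivity)] at hR
  have h1 := (le_max_right _ _).trans hR
  have h2 := hC u hu
  have h3 : M + C ≤ 1 / (2 * p) * gagliardoPow s₁ p u := by
    rw [one_div, ← div_eq_inv_mul, le_div_iff₀ (by positivity)]
    linarith
  linarith

theorem exists_isMinOn_energy (hN : 1 ≤ N) (hΩ : Bornology.IsBounded Ω) (hΩo : IsOpen Ω)
    (hs₂ : 0 < s₂) (hs : s₂ < s₁) (hq : 1 < q) (hqp : q < p) (hlam : 0 < lam) :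
    ∃ u ∈ W0 Ω s₁ p, IsMinOn (energy Ω s₁ s₂ p q lam) (W0 Ω s₁ p) u := by
  have hp : 0 < p := by linarith
  have hq0 : 0 < q := by linarith
  have hs₁ : 0 < s₁ := hs₂.trans hs
  have hsub : W0 Ω s₁ p ⊆ W0 Ω s₂ q := W0_subset_W0 hN hΩ hΩo hs₂ hs hq0 hqp
  obtain ⟨C, hC⟩ := exists_energy_ge (s₂ := s₂) hN hΩ hΩo hs₁ hq hqp hlam
  set S := energy Ω s₁ s₂ p q lam '' W0 Ω s₁ p with hS
  have hSne : S.Nonempty := ⟨_, 0, zero_mem_W0 hp, rfl⟩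
  have hSb : BddBelow S := by
    refine ⟨-C, ?_⟩
    rintro _ ⟨u, hu, rfl⟩
    have : 0 ≤ 1 / (2 * p) * gagliardoPow s₁ p u := mul_nonneg (by positivity) gagliardoPow_nonneg
    linarith [hC u hu]
  obtain ⟨e, hanti, hlim, heS⟩ := exists_seq_tendsto_sInf hSne hSb
  choose f hf hfe using heS
  have hbound : ∀ n, gagliardoPow s₁ p (f n) ≤ 2 * p * (e 0 + C) := by
    intro n
    have h1 := hC _ (hf n)
    rw [hfe] at h1
    have h2 : 1 / (2 * p) * gagliardoPow s₁ p (f n) ≤ e 0 + C := by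
      linarith [hanti (Nat.zero_le n)]
    rwa [one_div, ← div_eq_inv_mul, div_le_iff₀' (by positivity)] at h2
  obtain ⟨φ, hφ, u, hu, hae, hLp⟩ := exists_subseq_tendsto hN hΩ hΩo (by linarith) hs₁ hf hbound
  refine ⟨u, hu, fun v hv => ?_⟩
  change energy Ω s₁ s₂ p q lam u ≤ energy Ω s₁ s₂ p q lam v
  refine le_trans ?_ (csInf_le hSb ⟨v, hv, rfl⟩)
  have hint := tendsto_setIntegral_abs_rpow hΩ hq.le hqp.le (fun n => (hf (φ n)).1) hu.1 hLp
  -- The `L^q` term enters the energy with a minus sign, but it converges, so it is moved across;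
  -- the two remaining terms are lower semicontinuous.
  have hsum : Tendsto (fun n => e (φ n) + lam / q * ∫ x in Ω, |f (φ n) x| ^ q) atTop
      (𝓝 (sInf S + lam / q * ∫ x in Ω, |u x| ^ q)) :=
    (hlim.comp hφ.tendsto_atTop).add (hint.const_mul _)
  refine le_of_forall_pos_le_add fun ε hε => ?_
  have hev1 := eventually_gagliardoPow_sub_le hp.le (fun n => hf (φ n)) hu.2.1 hae
    (ε := p * (ε / 2)) (by positivity)
  have hev2 := eventually_gagliardoPow_sub_le hq0.le (fun n => hsub (hf (φ n))) (hsub hu).2.1 hae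
    (ε := q * (ε / 2)) (by positivity)
  have key : 1 / p * gagliardoPow s₁ p u + 1 / q * gagliardoPow s₂ q u - ε ≤
      sInf S + lam / q * ∫ x in Ω, |u x| ^ q := by
    refine ge_of_tendsto hsum ?_
    filter_upwards [hev1, hev2] with n h1 h2
    have h3 : 1 / p * (gagliardoPow s₁ p u - p * (ε / 2)) ≤ 1 / p * gagliardoPow s₁ p (f (φ n)) :=
      mul_le_mul_of_nonneg_left h1 (by positivity)
    have h4 : 1 / q * (gagliardoPow s₂ q u - q * (ε / 2)) ≤ 1 / q * gagliardoPow s₂ q (f (φ n)) :=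
      mul_le_mul_of_nonneg_left h2 (by positivity)
    have e1 : 1 / p * (gagliardoPow s₁ p u - p * (ε / 2)) =
      1 / p * gagliardoPow s₁ p u - ε / 2 := by field_simp
    have e2 : 1 / q * (gagliardoPow s₂ q u - q * (ε / 2)) =
      1 / q * gagliardoPow s₂ q u - ε / 2 := by field_simp
    rw [← hfe (φ n), energy]
    linarith
  rw [energy]
  linarith

theorem exists_energy_neg (hN : 1 ≤ N) (hΩo : IsOpen Ω) (hΩne : Ω.Nonempty)
    (hΩ : Bornology.IsBounded Ω) (hlip : HasLipschitzBoundary Ω) (hs₂ : 0 < s₂) (hs : s₂ < s₁)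
    (hs₁ : s₁ < 1) (hq : 1 < q) (hqp : q < p) (hlam : firstEigenvalue Ω s₂ q < lam) :
    ∃ w ∈ W0 Ω s₁ p, energy Ω s₁ s₂ p q lam w < 0 := by
  have hp : 0 < p := by linarith
  have hq0 : 0 < q := by linarith
  obtain ⟨u, hu, hult⟩ := exists_gagliardoPow_lt_of_firstEigenvalue_lt hN hΩ hΩo hΩne hq0 hs₂
    (hs.trans hs₁) hlam
  obtain ⟨K, v, hvl, hv0, hv⟩ := exists_lipschitzWith_gagliardoPow_lt hN hΩo hΩ hlip hq.le hs₂
    (hs.trans hs₁) hu hult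
  have hvW : v ∈ W0 Ω s₁ p := mem_W0_of_lipschitzWith hN hΩ hp (hs₂.trans hs) hs₁ hvl hv0
  set A := 1 / p * gagliardoPow s₁ p v with hA
  set B := 1 / q * gagliardoPow s₂ q v - lam / q * ∫ x in Ω, |v x| ^ q with hB
  have hBneg : B < 0 := by
    have : B = 1 / q * (gagliardoPow s₂ q v - lam * ∫ x in Ω, |v x| ^ q) := by rw [hB]; ring
    rw [this]
    exact mul_neg_of_pos_of_neg (by positivity) (by linarith)
  have hpq : 0 < p - q := by linarith
  have hA0 : 0 ≤ A := mul_nonneg (by positivity) gagliardoPow_nonneg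
  -- With this `t` the energy `t^p A + t^q B` of `t v` equals `t^q B / (A + 1)`, which is negative.
  set t : ℝ := (-B / (A + 1)) ^ (p - q)⁻¹ with ht
  have hb : 0 < -B / (A + 1) := div_pos (by linarith) (by linarith)
  have ht0 : 0 < t := Real.rpow_pos_of_pos hb _
  have htp : t ^ (p - q) = -B / (A + 1) := by
    rw [ht, ← Real.rpow_mul hb.le, inv_mul_cancel₀ hpq.ne', Real.rpow_one]
  refine ⟨t • v, smul_mem_W0 hp hvW t, ?_⟩
  rw [energy_smul ht0.le, ← hA, ← hB]
  have e : t ^ p = t ^ q * t ^ (p - q) := by rw [← Real.rpow_add ht0]; congr 1; ring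
  rw [e, htp, mul_assoc, ← mul_add]
  refine mul_neg_of_pos_of_neg (Real.rpow_pos_of_pos ht0 _) ?_
  have : -B / (A + 1) * A + B = B / (A + 1) := by
    field_simp
    ring
  rw [this]
  exact div_neg_of_neg_of_pos hBneg (by linarith)

/-- The energy vanishes at `0`, so a negative value keeps the minimizer away from `0`; the equation
is stationarity along lines. -/
theorem isEigenfunction_of_isMinOn (hq : 1 < q) (hqp : q < p) (hsub : W0 Ω s₁ p ⊆ W0 Ω s₂ q)
    (hneg : ∃ w ∈ W0 Ω s₁ p, energy Ω s₁ s₂ p q lam w < 0) (hu : u ∈ W0 Ω s₁ p)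
    (hmin : IsMinOn (energy Ω s₁ s₂ p q lam) (W0 Ω s₁ p) u) :
    IsEigenfunction Ω s₁ s₂ p q lam u := by
  have hp : 1 < p := by linarith
  refine ⟨⟨hu, hsub hu⟩, fun h0 => ?_, fun v hv => ?_⟩
  · obtain ⟨w, hw, hwneg⟩ := hneg
    have h1 : energy Ω s₁ s₂ p q lam u ≤ energy Ω s₁ s₂ p q lam w := hmin hw
    rw [energy_congr h0, energy_zero (by linarith) (by linarith)] at h1
    linarith
  · have hd := hasDerivAt_energy (lam := lam) hp hq hu (hsub hu) hv.1 hv.2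
    have hloc : IsLocalMin (fun t : ℝ => energy Ω s₁ s₂ p q lam (u + t • v)) 0 := by
      refine .of_forall fun t => ?_
      simp only [zero_smul, add_zero]
      exact hmin (add_smul_mem_W0 (by linarith) hu hv.1 t)
    linarith [hloc.hasDerivAt_eq_zero hd]

theorem integral_abs_abs_rpow {r : ℝ} : ∫ x in Ω, |(|u x|)| ^ r = ∫ x in Ω, |u x| ^ r := by
  simp only [abs_abs]

/-- Replacing `u` by `|u|` keeps the integral and increases neither seminorm, so `|u|` is a
minimizer too and the seminorms agree. -/
theorem hasConstantSign_of_isMinOn (hN : 1 ≤ N) (hΩ : Bornology.IsBounded Ω) (hΩo : IsOpen Ω)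
    (hs₂ : 0 < s₂) (hs : s₂ < s₁) (hs₁ : s₁ < 1) (hq : 1 < q) (hqp : q < p) (hlam : 0 ≤ lam)
    (hneg : ∃ w ∈ W0 Ω s₁ p, energy Ω s₁ s₂ p q lam w < 0) (hu : u ∈ W0 Ω s₁ p)
    (hmin : IsMinOn (energy Ω s₁ s₂ p q lam) (W0 Ω s₁ p) u) : HasConstantSign Ω u := by
  have hp : 0 < p := by linarith
  have hq0 : 0 < q := by linarith
  have hsub : W0 Ω s₁ p ⊆ W0 Ω s₂ q := W0_subset_W0 hN hΩ hΩo hs₂ hs hq0 hqp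
  have hau := abs_mem_W0 hp.le hu
  have h1 := gagliardoPow_abs_le hp.le hu
  have h2 := gagliardoPow_abs_le hq0.le (hsub hu)
  have h1' : 1 / p * gagliardoPow s₁ p (fun x => |u x|) ≤ 1 / p * gagliardoPow s₁ p u :=
    mul_le_mul_of_nonneg_left h1 (by positivity)
  have h2' : 1 / q * gagliardoPow s₂ q (fun x => |u x|) ≤ 1 / q * gagliardoPow s₂ q u :=
    mul_le_mul_of_nonneg_left h2 (by positivity)
  have h3 : energy Ω s₁ s₂ p q lam u ≤ energy Ω s₁ s₂ p q lam (fun x => |u x|) := hmin hau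
  have h4 : energy Ω s₁ s₂ p q lam (fun x => |u x|) ≤ energy Ω s₁ s₂ p q lam u := by
    rw [energy, energy, integral_abs_abs_rpow]
    linarith
  have heq : gagliardoPow s₁ p (fun x => |u x|) = gagliardoPow s₁ p u := by
    rw [energy, energy, integral_abs_abs_rpow] at h3
    have : 1 / p * gagliardoPow s₁ p (fun x => |u x|) = 1 / p * gagliardoPow s₁ p u := by linarith
    exact mul_left_cancel₀ (by positivity) this
  refine hasConstantSign_of_abs hN hΩ hΩo (by linarith) hq (hs₂.trans hs) hs₁ hs₂ (hs.trans hs₁)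
    hlam hu heq (isEigenfunction_of_isMinOn hq hqp hsub hneg hau fun v hv => ?_)
  exact h4.trans (hmin hv)

end Energy

/-! ### Minimization on the Nehari set for `p < q` -/

section Nehari

open Filter Topology

variable {N : ℕ} {Ω : Set (EuclideanSpace ℝ (Fin N))} {s₁ s₂ p q lam : ℝ}
  {u v w : EuclideanSpace ℝ (Fin N) → ℝ}

/-- The functional `lam ∫_Ω |u|^q - [u]_{s,q}^q`. -/
noncomputable def rayleighGap (Ω : Set (EuclideanSpace ℝ (Fin N))) (s q lam : ℝ)
    (u : EuclideanSpace ℝ (Fin N) → ℝ) : ℝ :=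
  lam * (∫ x in Ω, |u x| ^ q) - gagliardoPow s q u

theorem rayleighGap_smul {t : ℝ} (ht : 0 ≤ t) :
    rayleighGap Ω s₂ q lam (t • u) = t ^ q * rayleighGap Ω s₂ q lam u := by
  rw [rayleighGap, rayleighGap, gagliardoPow_smul, integral_abs_smul_rpow, abs_of_nonneg ht]
  ring

theorem mem_nehariSet_iff : u ∈ nehariSet Ω s₁ s₂ p q lam ↔
    u ∈ W0 Ω s₂ q ∧ ¬ u =ᵐ[volume] 0 ∧ gagliardoPow s₁ p u = rayleighGap Ω s₂ q lam u := by
  rw [nehariSet, mem_ofPred_eq, rayleighGap, eq_sub_iff_add_eq]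

theorem energy_eq_of_mem_nehariSet (hu : u ∈ nehariSet Ω s₁ s₂ p q lam) :
    energy Ω s₁ s₂ p q lam u = (1 / p - 1 / q) * gagliardoPow s₁ p u := by
  have h := hu.2.2
  have e : energy Ω s₁ s₂ p q lam u = 1 / p * gagliardoPow s₁ p u +
      1 / q * (gagliardoPow s₂ q u - lam * ∫ x in Ω, |u x| ^ q) := by rw [energy]; ring
  rw [e, ← h]
  ring

theorem not_ae_zero_of_rayleighGap_pos (hq : 0 < q) (h : 0 < rayleighGap Ω s₂ q lam u) :
    ¬ u =ᵐ[volume] 0 := by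
  intro h0
  have hi : ∫ x in Ω, |u x| ^ q = 0 := by
    refine integral_eq_zero_of_ae (ae_restrict_of_ae ?_)
    filter_upwards [h0] with x hx
    simp [hx, Real.zero_rpow hq.ne']
  rw [rayleighGap, hi, mul_zero] at h
  linarith [gagliardoPow_nonneg (s := s₂) (r := q) (u := u)]

theorem gagliardoPow_pos (hN : 1 ≤ N) (hΩ : Bornology.IsBounded Ω) {s r : ℝ} (hr : 0 < r)
    (hs : 0 < s) (hu : u ∈ W0 Ω s r) (h : ¬ u =ᵐ[volume] 0) : 0 < gagliardoPow s r u := by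
  obtain ⟨P, hP0, hP⟩ := exists_poincare hN hΩ s hr hs
  have h1 := (integral_rpow_pos hr hu h).trans_le (hP u hu)
  exact pos_of_mul_pos_right h1 hP0.le

/-- Every function with positive gap can be scaled into the Nehari set. -/
theorem exists_smul_mem_nehariSet (hpq : p < q) (hp : 0 < p) (hw : w ∈ W0 Ω s₂ q)
    (hA : 0 < gagliardoPow s₁ p w) (hG : 0 < rayleighGap Ω s₂ q lam w) :
    ∃ t : ℝ, 0 < t ∧ t • w ∈ nehariSet Ω s₁ s₂ p q lam ∧
      gagliardoPow s₁ p (t • w) ^ (q - p) * rayleighGap Ω s₂ q lam w ^ p =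
        gagliardoPow s₁ p w ^ q := by
  have hq : 0 < q := by linarith
  have hd : 0 < q - p := by linarith
  set A := gagliardoPow s₁ p w with hAdef
  set G := rayleighGap Ω s₂ q lam w with hGdef
  -- The multiple solves `t^p A = t^q G`. The value `t^p A`, raised to `q - p`, is then the
  -- 0-homogeneous quotient `A^q / G^p`.
  set t : ℝ := (A / G) ^ (q - p)⁻¹ with ht
  have hAG : 0 < A / G := div_pos hA hG
  have ht0 : 0 < t := Real.rpow_pos_of_pos hAG _
  have htp : t ^ (q - p) = A / G := by
    rw [ht, ← Real.rpow_mul hAG.le, inv_mul_cancel₀ hd.ne', Real.rpow_one]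
  have hgap : rayleighGap Ω s₂ q lam (t • w) = t ^ q * G := rayleighGap_smul ht0.le
  have hAt : gagliardoPow s₁ p (t • w) = t ^ p * A := by
    rw [gagliardoPow_smul, abs_of_pos ht0]
  refine ⟨t, ht0, mem_nehariSet_iff.2 ⟨smul_mem_W0 hq hw t,
    not_ae_zero_of_rayleighGap_pos hq (lam := lam) (s₂ := s₂) (Ω := Ω) ?_, ?_⟩, ?_⟩
  · rw [hgap]
    positivity
  · rw [hgap, hAt]
    have : t ^ q = t ^ p * t ^ (q - p) := by rw [← Real.rpow_add ht0]; congr 1; ring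
    rw [this, htp]
    field_simp
  · rw [hAt, Real.mul_rpow (by positivity) hA.le, ← Real.rpow_mul ht0.le, mul_comm p,
      Real.rpow_mul ht0.le, htp, Real.div_rpow hA.le hG.le]
    have hGp : 0 < G ^ p := Real.rpow_pos_of_pos hG _
    rw [div_mul_eq_mul_div, ← Real.rpow_add hA, div_mul_cancel₀ _ hGp.ne']
    congr 1
    ring

/-- Removes the constraint: minimality is tested against every `w` with positive gap by scaling it
into the Nehari set. -/
theorem rpow_mul_rpow_le_of_isMinOn (hN : 1 ≤ N) (hΩ : Bornology.IsBounded Ω)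
    (hs₁ : 0 < s₁) (hp : 0 < p) (hpq : p < q) (hsub : W0 Ω s₂ q ⊆ W0 Ω s₁ p)
    (hu : u ∈ nehariSet Ω s₁ s₂ p q lam)
    (hmin : IsMinOn (energy Ω s₁ s₂ p q lam) (nehariSet Ω s₁ s₂ p q lam) u)
    (hw : w ∈ W0 Ω s₂ q) (hG : 0 < rayleighGap Ω s₂ q lam w) :
    gagliardoPow s₁ p u ^ (q - p) * rayleighGap Ω s₂ q lam w ^ p ≤ gagliardoPow s₁ p w ^ q := by
  have hq : 0 < q := by linarith
  have hA := gagliardoPow_pos hN hΩ hp hs₁ (hsub hw) (not_ae_zero_of_rayleighGap_pos hq hG)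
  obtain ⟨t, ht0, htw, heq⟩ := exists_smul_mem_nehariSet hpq hp hw hA hG
  rw [← heq]
  have h1 : energy Ω s₁ s₂ p q lam u ≤ energy Ω s₁ s₂ p q lam (t • w) := hmin htw
  rw [energy_eq_of_mem_nehariSet hu, energy_eq_of_mem_nehariSet htw] at h1
  have hc : 0 < 1 / p - 1 / q := sub_pos.2 (one_div_lt_one_div_of_lt hp hpq)
  have h2 := le_of_mul_le_mul_left h1 hc
  have h3 : 0 ≤ rayleighGap Ω s₂ q lam w ^ p := Real.rpow_nonneg hG.le _
  exact mul_le_mul_of_nonneg_right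
    (Real.rpow_le_rpow gagliardoPow_nonneg h2 (by linarith)) h3

theorem hasDerivAt_rayleighGap (hq : 1 < q) (hu : u ∈ W0 Ω s₂ q) (hv : v ∈ W0 Ω s₂ q) :
    HasDerivAt (fun t : ℝ => rayleighGap Ω s₂ q lam (u + t • v))
      (q * (lam * (∫ x in Ω, |u x| ^ (q - 2) * u x * v x) - fracForm q s₂ u v)) 0 := by
  refine (((hasDerivAt_integral_Ω (Ω := Ω) hq hu.1 hv.1).const_mul lam).sub
    (hasDerivAt_gagliardoPow hq hu hv)).congr_deriv ?_
  ring

/-- Minimizers on the Nehari set satisfy the Euler–Lagrange equation without multiplier. -/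
theorem fracForm_eq_of_isMinOn_nehariSet (hN : 1 ≤ N) (hΩ : Bornology.IsBounded Ω)
    (hs₁ : 0 < s₁) (hp : 1 < p) (hpq : p < q) (hsub : W0 Ω s₂ q ⊆ W0 Ω s₁ p)
    (hu : u ∈ nehariSet Ω s₁ s₂ p q lam)
    (hmin : IsMinOn (energy Ω s₁ s₂ p q lam) (nehariSet Ω s₁ s₂ p q lam) u)
    (hv : v ∈ W0 Ω s₂ q) :
    fracForm p s₁ u v + fracForm q s₂ u v = lam * ∫ x in Ω, |u x| ^ (q - 2) * u x * v x := by
  have hp0 : 0 < p := by linarith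
  have hq0 : 0 < q := by linarith
  obtain ⟨huW, hune, huG⟩ := mem_nehariSet_iff.1 hu
  have hA0 := gagliardoPow_pos hN hΩ hp0 hs₁ (hsub huW) hune
  set A := gagliardoPow s₁ p u with hA
  have hdA := hasDerivAt_gagliardoPow hp (hsub huW) (hsub hv)
  have hdG := hasDerivAt_rayleighGap (lam := lam) (by linarith) huW hv
  set A' := p * fracForm p s₁ u v with hA'
  set G' := q * (lam * (∫ x in Ω, |u x| ^ (q - 2) * u x * v x) - fracForm q s₂ u v) with hG'
  have hA00 : gagliardoPow s₁ p (u + (0 : ℝ) • v) = A := by rw [zero_smul, add_zero]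
  have hG00 : rayleighGap Ω s₂ q lam (u + (0 : ℝ) • v) = A := by rw [zero_smul, add_zero, ← huG]
  have hd := (hdA.rpow_const (p := q) (Or.inl (by rw [hA00]; exact hA0.ne'))).sub
    ((hdG.rpow_const (p := p) (Or.inl (by rw [hG00]; exact hA0.ne'))).const_mul (A ^ (q - p)))
  -- The gap stays positive for small `t`, so the unconstrained inequality makes this function
  -- nonnegative near `0`, where it vanishes. Both terms of its derivative carry `A^(q-1)`, leaving
  -- the Euler–Lagrange equation.
  have hloc : IsLocalMin (fun t : ℝ => gagliardoPow s₁ p (u + t • v) ^ q -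
      A ^ (q - p) * rayleighGap Ω s₂ q lam (u + t • v) ^ p) 0 := by
    have hev : ∀ᶠ t in 𝓝 (0 : ℝ), 0 < rayleighGap Ω s₂ q lam (u + t • v) :=
      hdG.continuousAt.eventually (lt_mem_nhds (hA0.trans_eq hG00.symm))
    filter_upwards [hev] with t ht
    have h1 := rpow_mul_rpow_le_of_isMinOn hN hΩ hs₁ hp0 hpq hsub hu hmin
      (add_smul_mem_W0 hq0 huW hv t) ht
    have h2 : A ^ q - A ^ (q - p) * A ^ p = 0 := by
      rw [← Real.rpow_add hA0, sub_add_cancel, sub_self]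
    rw [hA00, hG00, h2]
    exact sub_nonneg.2 h1
  have hzero := hloc.hasDerivAt_eq_zero hd
  rw [hA00, hG00] at hzero
  have e1 : A ^ (q - p) * (G' * p * A ^ (p - 1)) = G' * p * A ^ (q - 1) := by
    rw [mul_left_comm, ← Real.rpow_add hA0]
    congr 2
    ring
  rw [e1, ← sub_mul, mul_eq_zero] at hzero
  have h3 := hzero.resolve_right (Real.rpow_pos_of_pos hA0 _).ne'
  rw [hA', hG'] at h3
  have h4 : (p * q) * (fracForm p s₁ u v + fracForm q s₂ u v -
      lam * ∫ x in Ω, |u x| ^ (q - 2) * u x * v x) = 0 := by linarith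
  have h5 := (mul_eq_zero.1 h4).resolve_left (by positivity)
  linarith

theorem isEigenfunction_of_isMinOn_nehariSet (hN : 1 ≤ N) (hΩ : Bornology.IsBounded Ω)
    (hs₁ : 0 < s₁) (hp : 1 < p) (hpq : p < q) (hsub : W0 Ω s₂ q ⊆ W0 Ω s₁ p)
    (hu : u ∈ nehariSet Ω s₁ s₂ p q lam)
    (hmin : IsMinOn (energy Ω s₁ s₂ p q lam) (nehariSet Ω s₁ s₂ p q lam) u) :
    IsEigenfunction Ω s₁ s₂ p q lam u :=
  ⟨⟨hsub hu.1, hu.1⟩, hu.2.1, fun _ hv =>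
    fracForm_eq_of_isMinOn_nehariSet hN hΩ hs₁ hp hpq hsub hu hmin hv.2⟩

theorem hasConstantSign_of_isMinOn_nehariSet (hN : 1 ≤ N) (hΩ : Bornology.IsBounded Ω)
    (hΩo : IsOpen Ω) (hs₁ : 0 < s₁) (hs₁' : s₁ < 1) (hs₂ : 0 < s₂) (hs₂' : s₂ < 1) (hp : 1 < p)
    (hpq : p < q) (hlam : 0 ≤ lam) (hsub : W0 Ω s₂ q ⊆ W0 Ω s₁ p)
    (hu : u ∈ nehariSet Ω s₁ s₂ p q lam)
    (hmin : IsMinOn (energy Ω s₁ s₂ p q lam) (nehariSet Ω s₁ s₂ p q lam) u) :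
    HasConstantSign Ω u := by
  have hp0 : 0 < p := by linarith
  have hq0 : 0 < q := by linarith
  obtain ⟨huW, hune, huG⟩ := mem_nehariSet_iff.1 hu
  have hA0 := gagliardoPow_pos hN hΩ hp0 hs₁ (hsub huW) hune
  have hau := abs_mem_W0 hq0.le huW
  have h1 := gagliardoPow_abs_le hp0.le (hsub huW)
  have h2 : rayleighGap Ω s₂ q lam u ≤ rayleighGap Ω s₂ q lam (fun x => |u x|) := by
    rw [rayleighGap, rayleighGap, integral_abs_abs_rpow]
    linarith [gagliardoPow_abs_le hq0.le huW]
  rw [← huG] at h2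
  have h3 := rpow_mul_rpow_le_of_isMinOn hN hΩ hs₁ hp0 hpq hsub hu hmin hau (hA0.trans_le h2)
  set A := gagliardoPow s₁ p u with hA
  set B := gagliardoPow s₁ p (fun x => |u x|) with hB
  set G := rayleighGap Ω s₂ q lam (fun x => |u x|) with hG
  have hB0 : 0 ≤ B := gagliardoPow_nonneg
  have hAq : A ^ (q - p) * A ^ p = A ^ q := by rw [← Real.rpow_add hA0, sub_add_cancel]
  have hApos : 0 < A ^ (q - p) := Real.rpow_pos_of_pos hA0 _
  -- The chain `A^q = A^(q-p) A^p ≤ A^(q-p) G^p ≤ B^q ≤ A^q` consists of equalities; hence `|u|` is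
  -- in the Nehari set with the same energy.
  have hBA : B = A := by
    refine le_antisymm h1 ((Real.rpow_le_rpow_iff hA0.le hB0 hq0).1 ?_)
    refine le_trans ?_ h3
    rw [← hAq]
    exact mul_le_mul_of_nonneg_left (Real.rpow_le_rpow hA0.le h2 hp0.le) hApos.le
  have hGA : G = A := by
    refine le_antisymm ((Real.rpow_le_rpow_iff (hA0.le.trans h2) hA0.le hp0).1 ?_) h2
    rw [hBA, ← hAq] at h3
    exact le_of_mul_le_mul_left h3 hApos
  have haN : (fun x => |u x|) ∈ nehariSet Ω s₁ s₂ p q lam :=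
    mem_nehariSet_iff.2 ⟨hau, not_ae_zero_of_rayleighGap_pos hq0 (hA0.trans_le h2),
      hBA.trans hGA.symm⟩
  refine hasConstantSign_of_abs hN hΩ hΩo hp (by linarith) hs₁ hs₁' hs₂ hs₂' hlam (hsub huW) hBA
    (isEigenfunction_of_isMinOn_nehariSet hN hΩ hs₁ hp hpq hsub haN fun v hv => ?_)
  have h5 : energy Ω s₁ s₂ p q lam u ≤ energy Ω s₁ s₂ p q lam v := hmin hv
  change energy Ω s₁ s₂ p q lam (fun x => |u x|) ≤ energy Ω s₁ s₂ p q lam v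
  rw [energy_eq_of_mem_nehariSet haN, ← hB, hBA, hA,
    ← energy_eq_of_mem_nehariSet hu]
  exact h5

theorem exists_normalized_isMin (hN : 1 ≤ N) (hΩ : Bornology.IsBounded Ω) (hΩo : IsOpen Ω)
    (hs₁ : 0 < s₁) (hs₂ : 0 < s₂) (hp : 1 < p) (hpq : p < q)
    (hsub : W0 Ω s₂ q ⊆ W0 Ω s₁ p)
    (hne : ∃ w ∈ W0 Ω s₂ q, ∫ x in Ω, |w x| ^ q = 1 ∧ 0 < rayleighGap Ω s₂ q lam w) :
    ∃ w ∈ W0 Ω s₂ q, 0 < rayleighGap Ω s₂ q lam w ∧ ∀ v ∈ W0 Ω s₂ q, ∫ x in Ω, |v x| ^ q = 1 →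
      0 < rayleighGap Ω s₂ q lam v →
      gagliardoPow s₁ p w ^ q / rayleighGap Ω s₂ q lam w ^ p ≤
        gagliardoPow s₁ p v ^ q / rayleighGap Ω s₂ q lam v ^ p := by
  have hp0 : 0 < p := by linarith
  have hq0 : 0 < q := by linarith
  set D : Set (EuclideanSpace ℝ (Fin N) → ℝ) :=
    {w | w ∈ W0 Ω s₂ q ∧ ∫ x in Ω, |w x| ^ q = 1 ∧ 0 < rayleighGap Ω s₂ q lam w} with hD
  set R : (EuclideanSpace ℝ (Fin N) → ℝ) → ℝ := fun w =>
    gagliardoPow s₁ p w ^ q / rayleighGap Ω s₂ q lam w ^ p with hR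
  have hSne : (R '' D).Nonempty := by
    obtain ⟨w, hw⟩ := hne
    exact ⟨_, w, hw, rfl⟩
  have hSb : BddBelow (R '' D) := by
    refine ⟨0, ?_⟩
    rintro _ ⟨w, hw, rfl⟩
    exact div_nonneg (Real.rpow_nonneg gagliardoPow_nonneg _) (Real.rpow_nonneg hw.2.2.le _)
  obtain ⟨e, -, hlim, heS⟩ := exists_seq_tendsto_sInf hSne hSb
  choose f hf hfe using heS
  -- Under the normalization a positive gap is itself the bound needed for compactness.
  have hbound : ∀ n, gagliardoPow s₂ q (f n) ≤ lam := by
    intro n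
    have h1 := (hf n).2.2
    rw [rayleighGap, (hf n).2.1] at h1
    linarith
  obtain ⟨φ, hφ, w, hw, hae, hLp⟩ := exists_subseq_tendsto hN hΩ hΩo (by linarith) hs₂
    (fun n => (hf n).1) hbound
  have hint := tendsto_setIntegral_abs_rpow hΩ (by linarith) le_rfl (fun n => (hf (φ n)).1.1)
    hw.1 hLp
  have hw1 : ∫ x in Ω, |w x| ^ q = 1 := by
    refine tendsto_nhds_unique hint ?_
    simp only [(hf _).2.1]
    exact tendsto_const_nhds
  have hwne : ¬ w =ᵐ[volume] 0 := by
    intro h0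
    have : ∫ x in Ω, |w x| ^ q = 0 := by
      refine integral_eq_zero_of_ae (ae_restrict_of_ae ?_)
      filter_upwards [h0] with x hx
      simp [hx, Real.zero_rpow hq0.ne']
    linarith
  have hA0 := gagliardoPow_pos hN hΩ hp0 hs₁ (hsub hw) hwne
  set A := gagliardoPow s₁ p w with hA
  set G := rayleighGap Ω s₂ q lam w with hG
  have hlim' : Tendsto (fun n => e (φ n)) atTop (𝓝 (sInf (R '' D))) :=
    hlim.comp hφ.tendsto_atTop
  -- The inequality is kept free of division, because a priori the gap of the limit could be zero.
  have key : ∀ ε, 0 < ε → ε < A →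
      0 < G + ε ∧ (A - ε) ^ q ≤ sInf (R '' D) * (G + ε) ^ p := by
    intro ε hε hεA
    have hev1 := eventually_gagliardoPow_sub_le hp0.le (fun n => hsub (hf (φ n)).1)
      (hsub hw).2.1 hae hε
    have hev2 := eventually_gagliardoPow_sub_le hq0.le (fun n => (hf (φ n)).1) hw.2.1 hae hε
    have hev : ∀ᶠ n in atTop, 0 < G + ε ∧ (A - ε) ^ q ≤ e (φ n) * (G + ε) ^ p := by
      filter_upwards [hev1, hev2] with n h1 h2
      have hGn := (hf (φ n)).2.2
      have h3 : rayleighGap Ω s₂ q lam (f (φ n)) ≤ G + ε := by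
        rw [hG, rayleighGap, rayleighGap, (hf (φ n)).2.1, hw1]
        linarith
      refine ⟨hGn.trans_le h3, ?_⟩
      have hGp : 0 < rayleighGap Ω s₂ q lam (f (φ n)) ^ p := Real.rpow_pos_of_pos hGn _
      calc (A - ε) ^ q ≤ gagliardoPow s₁ p (f (φ n)) ^ q :=
            Real.rpow_le_rpow (by linarith) h1 hq0.le
        _ = e (φ n) * rayleighGap Ω s₂ q lam (f (φ n)) ^ p := by
            rw [← hfe (φ n), hR, div_mul_cancel₀ _ hGp.ne']
        _ ≤ e (φ n) * (G + ε) ^ p := by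
            refine mul_le_mul_of_nonneg_left (Real.rpow_le_rpow hGn.le h3 hp0.le) ?_
            rw [← hfe (φ n)]
            exact div_nonneg (Real.rpow_nonneg gagliardoPow_nonneg _) hGp.le
    obtain ⟨n, hn⟩ := hev.exists
    exact ⟨hn.1, ge_of_tendsto (hlim'.mul_const _) (hev.mono fun n hn => hn.2)⟩
  have hGnn : 0 ≤ G := by
    refine le_of_forall_pos_le_add fun ε hε => ?_
    have h1 := (key (min ε (A / 2)) (lt_min hε (by linarith))
      ((min_le_right _ _).trans_lt (by linarith))).1
    linarith [min_le_left ε (A / 2)]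
  have hle : A ^ q ≤ sInf (R '' D) * G ^ p := by
    have hc1 : Tendsto (fun ε : ℝ => (A - ε) ^ q) (𝓝[>] 0) (𝓝 (A ^ q)) := by
      have : ContinuousAt (fun ε : ℝ => (A - ε) ^ q) 0 :=
        ContinuousAt.rpow_const (by fun_prop) (Or.inr hq0.le)
      have h := this.tendsto
      rw [sub_zero] at h
      exact h.mono_left nhdsWithin_le_nhds
    have hc2 : Tendsto (fun ε : ℝ => sInf (R '' D) * (G + ε) ^ p) (𝓝[>] 0)
        (𝓝 (sInf (R '' D) * G ^ p)) := by
      have : ContinuousAt (fun ε : ℝ => sInf (R '' D) * (G + ε) ^ p) 0 :=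
        continuousAt_const.mul (ContinuousAt.rpow_const (by fun_prop) (Or.inr hp0.le))
      have h := this.tendsto
      rw [add_zero] at h
      exact h.mono_left nhdsWithin_le_nhds
    refine le_of_tendsto_of_tendsto hc1 hc2 ?_
    filter_upwards [self_mem_nhdsWithin, nhdsWithin_le_nhds (Iio_mem_nhds hA0)] with ε h1 h2
    exact (key ε h1 h2).2
  -- The limit has unit `L^q` integral, so `A > 0`, and `A^q ≤ inf · G^p` excludes `G = 0`.
  have hGpos : 0 < G := by
    refine lt_of_le_of_ne hGnn fun h0 => ?_
    rw [← h0, Real.zero_rpow hp0.ne', mul_zero] at hle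
    exact absurd hle (not_le.2 (Real.rpow_pos_of_pos hA0 _))
  refine ⟨w, hw, hGpos, fun v hv hv1 hvG => ?_⟩
  refine le_trans ?_ (csInf_le hSb ⟨v, ⟨hv, hv1, hvG⟩, rfl⟩)
  rwa [div_le_iff₀ (Real.rpow_pos_of_pos hGpos _)]

theorem exists_smul_integral_eq_one (hq : 0 < q) (hu : u ∈ W0 Ω s₂ q) (h : ¬ u =ᵐ[volume] 0) :
    ∃ c : ℝ, 0 < c ∧ ∫ x in Ω, |(c • u) x| ^ q = 1 := by
  have hI := integral_rpow_pos hq hu h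
  refine ⟨(∫ x in Ω, |u x| ^ q)⁻¹ ^ q⁻¹, by positivity, ?_⟩
  rw [integral_abs_smul_rpow, abs_of_pos (by positivity), Real.rpow_inv_rpow (by positivity) hq.ne',
    inv_mul_cancel₀ hI.ne']

theorem exists_isMinOn_nehariSet (hN : 1 ≤ N) (hΩ : Bornology.IsBounded Ω) (hΩo : IsOpen Ω)
    (hs₁ : 0 < s₁) (hs₂ : 0 < s₂) (hp : 1 < p) (hpq : p < q)
    (hsub : W0 Ω s₂ q ⊆ W0 Ω s₁ p)
    (hne : ∃ w ∈ W0 Ω s₂ q, gagliardoPow s₂ q w < lam * ∫ x in Ω, |w x| ^ q) :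
    ∃ u ∈ nehariSet Ω s₁ s₂ p q lam,
      IsMinOn (energy Ω s₁ s₂ p q lam) (nehariSet Ω s₁ s₂ p q lam) u := by
  have hp0 : 0 < p := by linarith
  have hq0 : 0 < q := by linarith
  obtain ⟨w₀, hw₀, hw₀lt⟩ := hne
  have hG₀ : 0 < rayleighGap Ω s₂ q lam w₀ := sub_pos.2 hw₀lt
  obtain ⟨c₀, hc₀, hc₀1⟩ := exists_smul_integral_eq_one hq0 hw₀
    (not_ae_zero_of_rayleighGap_pos hq0 hG₀)
  obtain ⟨w, hw, hG, hwmin⟩ := exists_normalized_isMin (s₁ := s₁) hN hΩ hΩo hs₁ hs₂ hp hpq hsub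
    ⟨c₀ • w₀, smul_mem_W0 hq0 hw₀ c₀, hc₀1, by
      rw [rayleighGap_smul hc₀.le]
      exact mul_pos (Real.rpow_pos_of_pos hc₀ _) hG₀⟩
  have hA := gagliardoPow_pos hN hΩ hp0 hs₁ (hsub hw) (not_ae_zero_of_rayleighGap_pos hq0 hG)
  obtain ⟨t, ht, htw, heq⟩ := exists_smul_mem_nehariSet hpq hp0 hw hA hG
  refine ⟨t • w, htw, fun u hu => ?_⟩
  change energy Ω s₁ s₂ p q lam (t • w) ≤ energy Ω s₁ s₂ p q lam u
  rw [energy_eq_of_mem_nehariSet hu, energy_eq_of_mem_nehariSet htw]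
  have hc : 0 < 1 / p - 1 / q := sub_pos.2 (one_div_lt_one_div_of_lt hp0 hpq)
  refine mul_le_mul_of_nonneg_left ?_ hc.le
  obtain ⟨huW, hune, huG⟩ := mem_nehariSet_iff.1 hu
  have hAu := gagliardoPow_pos hN hΩ hp0 hs₁ (hsub huW) hune
  -- A Nehari element is normalized to be compared with `w`. By homogeneity its quotient is
  -- `B^(q-p)`, since gap and `p`-seminorm power agree on the Nehari set.
  obtain ⟨c, hc0, hc1⟩ := exists_smul_integral_eq_one hq0 huW hune
  have hcG : rayleighGap Ω s₂ q lam (c • u) = c ^ q * gagliardoPow s₁ p u := by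
    rw [rayleighGap_smul hc0.le, huG]
  have hcA : gagliardoPow s₁ p (c • u) = c ^ p * gagliardoPow s₁ p u := by
    rw [gagliardoPow_smul, abs_of_pos hc0]
  have h1 := hwmin _ (smul_mem_W0 hq0 huW c) hc1 (by rw [hcG]; positivity)
  set B := gagliardoPow s₁ p u with hB
  have e1 : gagliardoPow s₁ p (c • u) ^ q / rayleighGap Ω s₂ q lam (c • u) ^ p = B ^ (q - p) := by
    rw [hcG, hcA, Real.mul_rpow (by positivity) hAu.le, Real.mul_rpow (by positivity) hAu.le,
      ← Real.rpow_mul hc0.le, ← Real.rpow_mul hc0.le, mul_comm q p,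
      mul_div_mul_left _ _ (Real.rpow_pos_of_pos hc0 _).ne', ← Real.rpow_sub hAu]
  have e2 : gagliardoPow s₁ p w ^ q / rayleighGap Ω s₂ q lam w ^ p =
      gagliardoPow s₁ p (t • w) ^ (q - p) := by
    rw [← heq, mul_div_cancel_right₀ _ (Real.rpow_pos_of_pos hG _).ne']
  rw [e1, e2] at h1
  exact (Real.rpow_le_rpow_iff gagliardoPow_nonneg hAu.le (by linarith)).1 h1

end Nehari

/-! ### The main theorem -/

theorem mainTheorem3 (N : ℕ) (hN : 1 ≤ N) (Ω : Set (EuclideanSpace ℝ (Fin N)))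
    (hΩ_open : IsOpen Ω) (hΩ_ne : Ω.Nonempty) (hΩ_bdd : Bornology.IsBounded Ω)
    (hΩ_lip : HasLipschitzBoundary Ω) (s₁ s₂ p q : ℝ) :
    (0 < s₂ → s₂ < s₁ → s₁ < 1 → 1 < q → q < p →
      ∀ lam : ℝ, firstEigenvalue Ω s₂ q < lam →
        IsEigenvalue Ω s₁ s₂ p q lam ∧
        -- the energy is coercive on `W_0^{s₁,p}(Ω)`
        (∀ M : ℝ, ∃ R : ℝ, ∀ u ∈ W0 Ω s₁ p,
          R ≤ gagliardoSeminorm s₁ p u → M ≤ energy Ω s₁ s₂ p q lam u) ∧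
        -- it has a global minimizer, and global minimizers are eigenfunctions of constant sign
        (∃ u ∈ W0 Ω s₁ p, IsMinOn (energy Ω s₁ s₂ p q lam) (W0 Ω s₁ p) u) ∧
        (∀ u ∈ W0 Ω s₁ p, IsMinOn (energy Ω s₁ s₂ p q lam) (W0 Ω s₁ p) u →
          IsEigenfunction Ω s₁ s₂ p q lam u ∧ HasConstantSign Ω u)) ∧
    (0 < s₁ → s₁ < s₂ → s₂ < 1 → 1 < p → p < q →
      ∀ lam : ℝ, firstEigenvalue Ω s₂ q < lam →
        IsEigenvalue Ω s₁ s₂ p q lam ∧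
        -- the energy has a minimizer on the Nehari set, and such minimizers are free critical
        -- points of the energy and eigenfunctions of constant sign
        (∃ u ∈ nehariSet Ω s₁ s₂ p q lam,
          IsMinOn (energy Ω s₁ s₂ p q lam) (nehariSet Ω s₁ s₂ p q lam) u) ∧
        (∀ u ∈ nehariSet Ω s₁ s₂ p q lam,
          IsMinOn (energy Ω s₁ s₂ p q lam) (nehariSet Ω s₁ s₂ p q lam) u →
          (∀ v ∈ W0 Ω s₂ q,
            HasDerivAt (fun t : ℝ => energy Ω s₁ s₂ p q lam (u + t • v)) 0 0) ∧
          IsEigenfunction Ω s₁ s₂ p q lam u ∧ HasConstantSign Ω u)) := by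
  refine ⟨fun hs₂ hs hs₁ hq hqp lam hlam => ?_, fun hs₁ hs hs₂ hp hpq lam hlam => ?_⟩
  · have hlam0 : 0 < lam := firstEigenvalue_nonneg.trans_lt hlam
    have hsub : W0 Ω s₁ p ⊆ W0 Ω s₂ q := W0_subset_W0 hN hΩ_bdd hΩ_open hs₂ hs (by linarith) hqp
    have hneg := exists_energy_neg hN hΩ_open hΩ_ne hΩ_bdd hΩ_lip hs₂ hs hs₁ hq hqp hlam
    have hex := exists_isMinOn_energy hN hΩ_bdd hΩ_open hs₂ hs hq hqp hlam0
    refine ⟨?_, energy_coercive hN hΩ_bdd hΩ_open (hs₂.trans hs) hq hqp hlam0, hex,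
      fun u hu hmin => ⟨isEigenfunction_of_isMinOn hq hqp hsub hneg hu hmin,
        hasConstantSign_of_isMinOn hN hΩ_bdd hΩ_open hs₂ hs hs₁ hq hqp hlam0.le hneg hu hmin⟩⟩
    obtain ⟨u, hu, hmin⟩ := hex
    exact ⟨u, isEigenfunction_of_isMinOn hq hqp hsub hneg hu hmin⟩
  · have hlam0 : 0 < lam := firstEigenvalue_nonneg.trans_lt hlam
    have hq0 : 0 < q := by linarith
    have hs₂0 : 0 < s₂ := hs₁.trans hs
    have hsub : W0 Ω s₂ q ⊆ W0 Ω s₁ p := W0_subset_W0 hN hΩ_bdd hΩ_open hs₁ hs (by linarith) hpq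
    have hex := exists_isMinOn_nehariSet hN hΩ_bdd hΩ_open hs₁ hs₂0 hp hpq hsub
      (exists_gagliardoPow_lt_of_firstEigenvalue_lt hN hΩ_bdd hΩ_open hΩ_ne hq0 hs₂0 hs₂ hlam)
    refine ⟨?_, hex, fun u hu hmin => ⟨fun v hv => ?_,
      isEigenfunction_of_isMinOn_nehariSet hN hΩ_bdd hs₁ hp hpq hsub hu hmin,
      hasConstantSign_of_isMinOn_nehariSet hN hΩ_bdd hΩ_open hs₁ (hs.trans hs₂) hs₂0 hs₂ hp hpq
        hlam0.le hsub hu hmin⟩⟩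
    · obtain ⟨u, hu, hmin⟩ := hex
      exact ⟨u, isEigenfunction_of_isMinOn_nehariSet hN hΩ_bdd hs₁ hp hpq hsub hu hmin⟩
    · refine (hasDerivAt_energy hp (hp.trans hpq) (hsub hu.1) hu.1 (hsub hv) hv).congr_deriv ?_
      rw [fracForm_eq_of_isMinOn_nehariSet hN hΩ_bdd hs₁ hp hpq hsub hu hmin hv, sub_self]
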